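/- Let $I=[0,1]$ and let Thompson's group $F=PL_2(I)$ be the group, under composition of functions, of the orientation-preserving piecewise linear homeomorphisms of $I$ with finitely many breakpoints, all of whose breakpoints lie in $\mathbb{Z}[\tfrac12]$ and all of whose slopes are integral powers of $2$. An element $f\in F$ is given to, and returned by, an algorithm as a finite list of dyadic points $(t_0,f(t_0)),\dots,(t_n,f(t_n))$ with $0=t_0<t_1<\dots<t_n=1$ such that $f$ is affine on each $[t_{j-1},t_j]$. Theorem. For every $k\in\mathbb{N}$ there is an algorithm which, given any two $k$-tuples $(x_1,\dots,x_k)$ and $(y_1,\dots,y_k)$ of elements of $F$, always halts, decides whether there is a $g\in F$ such that $g^{-1}x_i g=y_i$ for all $i=1,\dots,k$, and, whenever such a $g$ exists, outputs one. -/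

import Mathlib

/-- A real number is a dyadic rational if it lies in `ℤ[1/2]`, i.e. equals `m / 2 ^ e`. -/
def IsDyadic (r : ℝ) : Prop := ∃ (m : ℤ) (e : ℕ), r = m / 2 ^ e

theorem IsDyadic.add {r s : ℝ} (hr : IsDyadic r) (hs : IsDyadic s) : IsDyadic (r + s) := by
  obtain ⟨m, e, rfl⟩ := hr
  obtain ⟨m', e', rfl⟩ := hs
  refine ⟨m * 2 ^ e' + m' * 2 ^ e, e + e', ?_⟩
  push_cast
  field_simp
  ring

theorem IsDyadic.neg {r : ℝ} (hr : IsDyadic r) : IsDyadic (-r) := by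
  obtain ⟨m, e, rfl⟩ := hr
  exact ⟨-m, e, by push_cast; ring⟩

theorem IsDyadic.two_zpow_mul {r : ℝ} (hr : IsDyadic r) (n : ℤ) :
    IsDyadic ((2 : ℝ) ^ n * r) := by
  obtain ⟨m, e, rfl⟩ := hr
  obtain ⟨k, rfl | rfl⟩ := n.eq_nat_or_neg
  · exact ⟨2 ^ k * m, e, by push_cast; rw [zpow_natCast]; ring⟩
  · refine ⟨m, e + k, ?_⟩
    rw [zpow_neg, zpow_natCast]
    field_simp
    ring

/-- `IsPL2 f`: the homeomorphism `f` of `[0, 1]` is orientation-preserving and piecewise linear with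
finitely many breakpoints, all of them dyadic rationals, and all its slopes are integral powers of
two. The finite set `B` contains the breakpoints: `f` is affine on every interval whose interior
does not meet `B`. -/
def IsPL2 (f : unitInterval ≃ₜ unitInterval) : Prop :=
  StrictMono f ∧
    ∃ B : Finset unitInterval,
      (∀ b ∈ B, IsDyadic (b : ℝ)) ∧
      ∀ u v : unitInterval, u < v → (∀ b ∈ B, b ∉ Set.Ioo u v) →
        ∃ (n : ℤ) (c : ℝ), ∀ t ∈ Set.Icc u v, (f t : ℝ) = (2 : ℝ) ^ n * (t : ℝ) + c

theorem strictMono_homeo_zero {f : unitInterval ≃ₜ unitInterval} (hf : StrictMono f) :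
    f 0 = 0 := by
  apply le_antisymm
  · have h := hf.monotone (unitInterval.nonneg' (t := f.symm 0))
    rwa [f.apply_symm_apply] at h
  · exact unitInterval.nonneg'

theorem strictMono_homeo_one {f : unitInterval ≃ₜ unitInterval} (hf : StrictMono f) :
    f 1 = 1 := by
  apply le_antisymm
  · exact unitInterval.le_one'
  · have h := hf.monotone (unitInterval.le_one' (t := f.symm 1))
    rwa [f.apply_symm_apply] at h

/-- An element of `PL_2([0, 1])` preserves and reflects dyadic rationals. -/
theorem IsPL2.dyadic_iff {f : unitInterval ≃ₜ unitInterval} (hf : IsPL2 f) (t : unitInterval) :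
    IsDyadic (f t : ℝ) ↔ IsDyadic (t : ℝ) := by
  classical
  obtain ⟨hm, B, hB, hA⟩ := hf
  have key : ∀ (N : ℕ) (t : unitInterval), (B.filter (· < t)).card ≤ N →
      (IsDyadic (f t : ℝ) ↔ IsDyadic (t : ℝ)) := by
    intro N
    induction N with
    | zero =>
      intro t ht
      rcases eq_or_lt_of_le (unitInterval.nonneg' (t := t)) with h0 | h0
      · rw [← h0, strictMono_homeo_zero hm]
      · obtain ⟨n, c, hc⟩ := hA 0 t h0 (by
          intro b hb hbt
          have : 0 < (B.filter (· < t)).card :=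
            Finset.card_pos.2 ⟨b, Finset.mem_filter.2 ⟨hb, hbt.2⟩⟩
          omega)
        have h1 := hc 0 ⟨le_rfl, h0.le⟩
        have h2 := hc t ⟨h0.le, le_rfl⟩
        rw [strictMono_homeo_zero hm] at h1
        have hc0 : c = 0 := by simpa using h1.symm
        subst hc0
        rw [add_zero] at h2
        rw [h2]
        refine ⟨fun h => ?_, fun h => h.two_zpow_mul n⟩
        have := h.two_zpow_mul (-n)
        rwa [← mul_assoc, ← zpow_add₀ two_ne_zero, neg_add_cancel, zpow_zero, one_mul] at this
    | succ N ih =>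
      intro t ht
      by_cases hne : (B.filter (· < t)).Nonempty
      · obtain ⟨b, hmem, hmax⟩ : ∃ b ∈ B.filter (· < t), ∀ x ∈ B.filter (· < t), x ≤ b :=
          ⟨_, Finset.max'_mem _ hne, Finset.le_max' _⟩
        obtain ⟨hbB, hbt⟩ := Finset.mem_filter.1 hmem
        obtain ⟨n, c, hc⟩ := hA b t hbt (by
          intro b' hb' hbt'
          exact absurd (hmax b' (Finset.mem_filter.2 ⟨hb', hbt'.2⟩)) (not_le.2 hbt'.1))
        have hcard : (B.filter (· < b)).card ≤ N := by
          have : (B.filter (· < b)).card < (B.filter (· < t)).card := by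
            apply Finset.card_lt_card
            refine ⟨fun a ha => ?_, fun h => ?_⟩
            · obtain ⟨h1, h2⟩ := Finset.mem_filter.1 ha
              exact Finset.mem_filter.2 ⟨h1, h2.trans hbt⟩
            · exact absurd (Finset.mem_filter.1 (h hmem)).2 (lt_irrefl _)
          omega
        have hb1 := hB b hbB
        have hb2 := (ih b hcard).2 hb1
        have h1 := hc b ⟨le_rfl, hbt.le⟩
        have h2 := hc t ⟨hbt.le, le_rfl⟩
        have h3 : (f t : ℝ) = (2 : ℝ) ^ n * ((t : ℝ) + -(b : ℝ)) + (f b : ℝ) := by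
          rw [h1, h2]; ring
        constructor
        · intro h
          have h4 := ((h.add hb2.neg).two_zpow_mul (-n)).add hb1
          have h5 : (t : ℝ) = (2 : ℝ) ^ (-n) * ((f t : ℝ) + -(f b : ℝ)) + (b : ℝ) := by
            rw [h3, zpow_neg]
            have : (2 : ℝ) ^ n ≠ 0 := by positivity
            field_simp
            ring
          rwa [h5]
        · intro h
          rw [h3]
          exact ((h.add hb1.neg).two_zpow_mul n).add hb2
      · rw [Finset.not_nonempty_iff_eq_empty] at hne
        exact ih t (by simp [hne])
  exact key _ t le_rfl

theorem IsPL2.one : IsPL2 1 :=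
  ⟨strictMono_id, ∅, by simp, fun u v _ _ => ⟨0, 0, by simp⟩⟩

theorem IsPL2.mul {f g : unitInterval ≃ₜ unitInterval} (hf : IsPL2 f) (hg : IsPL2 g) :
    IsPL2 (f * g) := by
  classical
  have hgd := hg.dyadic_iff
  obtain ⟨hfm, B, hB, hA⟩ := hf
  obtain ⟨hgm, B', hB', hA'⟩ := hg
  refine ⟨hfm.comp hgm, B' ∪ B.image g.symm, ?_, ?_⟩
  · intro b hb
    rcases Finset.mem_union.1 hb with hb | hb
    · exact hB' b hb
    · obtain ⟨a, ha, rfl⟩ := Finset.mem_image.1 hb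
      rw [← hgd, g.apply_symm_apply]
      exact hB a ha
  · intro u v huv hav
    obtain ⟨n, c, h⟩ := hA' u v huv fun b hb => hav b (Finset.mem_union_left _ hb)
    obtain ⟨n', c', h'⟩ := hA (g u) (g v) (hgm huv) (by
      intro b hb hbt
      apply hav (g.symm b) (Finset.mem_union_right _ (Finset.mem_image_of_mem _ hb))
      constructor
      · rw [← hgm.lt_iff_lt, g.apply_symm_apply]; exact hbt.1
      · rw [← hgm.lt_iff_lt, g.apply_symm_apply]; exact hbt.2)
    refine ⟨n' + n, (2 : ℝ) ^ n' * c + c', fun t ht => ?_⟩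
    have h1 := h' (g t) ⟨hgm.monotone ht.1, hgm.monotone ht.2⟩
    rw [h t ht] at h1
    rw [zpow_add₀ two_ne_zero]
    change (f (g t) : ℝ) = _
    rw [h1]
    ring

theorem IsPL2.inv {f : unitInterval ≃ₜ unitInterval} (hf : IsPL2 f) : IsPL2 f⁻¹ := by
  classical
  have hfd := hf.dyadic_iff
  obtain ⟨hfm, B, hB, hA⟩ := hf
  have hsm : StrictMono f.symm := by
    intro a b hab
    rw [← hfm.lt_iff_lt, f.apply_symm_apply, f.apply_symm_apply]
    exact hab
  refine ⟨hsm, B.image f, ?_, ?_⟩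
  · intro b hb
    obtain ⟨a, ha, rfl⟩ := Finset.mem_image.1 hb
    exact (hfd a).2 (hB a ha)
  · intro u v huv hav
    obtain ⟨n, c, h⟩ := hA (f.symm u) (f.symm v) (hsm huv) (by
      intro b hb hbt
      apply hav (f b) (Finset.mem_image_of_mem _ hb)
      constructor
      · rw [← hsm.lt_iff_lt, f.symm_apply_apply]; exact hbt.1
      · rw [← hsm.lt_iff_lt, f.symm_apply_apply]; exact hbt.2)
    refine ⟨-n, -((2 : ℝ) ^ (-n) * c), fun t ht => ?_⟩
    have h1 := h (f.symm t) ⟨hsm.monotone ht.1, hsm.monotone ht.2⟩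
    rw [f.apply_symm_apply] at h1
    change (f.symm t : ℝ) = _
    rw [h1, zpow_neg]
    have : (2 : ℝ) ^ n ≠ 0 := by positivity
    field_simp
    ring

/-- Thompson's group `F = PL_2([0, 1])`, as a group of homeomorphisms of `[0, 1]` under composition
of functions, `(f * g) t = f (g t)`. -/
def ThompsonF : Subgroup (unitInterval ≃ₜ unitInterval) where
  carrier := {f | IsPL2 f}
  mul_mem' := IsPL2.mul
  one_mem' := IsPL2.one
  inv_mem' := IsPL2.inv

/-- Finite descriptions of elements of `F`: the pair `(e, [(a₀, b₀), …, (aₙ, bₙ)])` stands for the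
function whose graph is the polygonal line with vertices `(aᵢ / 2 ^ e, bᵢ / 2 ^ e)`. -/
abbrev PLCode : Type := ℕ × List (ℕ × ℕ)

/-- The code `c` describes `f`: its points, in units of `1 / 2 ^ e`, start at `(0, 0)`, end at
`(1, 1)`, have strictly increasing first coordinates, and between any two consecutive ones the graph
of `f` is the straight segment joining them. Subdivision points need not be genuine breakpoints. -/
def PLCode.Represents (c : PLCode) (f : ThompsonF) : Prop :=
  c.2.head? = some (0, 0) ∧ c.2.getLast? = some (2 ^ c.1, 2 ^ c.1) ∧
    c.2.IsChain fun p q =>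
      p.1 < q.1 ∧ ∀ t : unitInterval, (p.1 : ℝ) ≤ 2 ^ c.1 * t → 2 ^ c.1 * (t : ℝ) ≤ q.1 →
        (2 ^ c.1 * (f.1 t : ℝ) - p.2) * ((q.1 : ℝ) - p.1) =
          ((q.2 : ℝ) - p.2) * (2 ^ c.1 * (t : ℝ) - p.1)

/-- A code describes at most one element. -/
theorem PLCode.Represents.unique {c : PLCode} {f g : ThompsonF} (hf : c.Represents f)
    (hg : c.Represents g) : f = g := by
  obtain ⟨e, l⟩ := c
  obtain ⟨h0, h1, hf⟩ := hf
  obtain ⟨-, -, hg⟩ := hg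
  simp only at h0 h1 hf hg
  have key : ∀ (l : List (ℕ × ℕ)) (p q : ℕ × ℕ), l.head? = some p → l.getLast? = some q →
      (l.IsChain fun p q =>
        p.1 < q.1 ∧ ∀ t : unitInterval, (p.1 : ℝ) ≤ 2 ^ e * t → 2 ^ e * (t : ℝ) ≤ q.1 →
          (2 ^ e * (f.1 t : ℝ) - p.2) * ((q.1 : ℝ) - p.1) =
            ((q.2 : ℝ) - p.2) * (2 ^ e * (t : ℝ) - p.1)) →
      (l.IsChain fun p q =>
        p.1 < q.1 ∧ ∀ t : unitInterval, (p.1 : ℝ) ≤ 2 ^ e * t → 2 ^ e * (t : ℝ) ≤ q.1 →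
          (2 ^ e * (g.1 t : ℝ) - p.2) * ((q.1 : ℝ) - p.1) =
            ((q.2 : ℝ) - p.2) * (2 ^ e * (t : ℝ) - p.1)) →
      2 ≤ l.length →
      ∀ t : unitInterval, (p.1 : ℝ) ≤ 2 ^ e * t → 2 ^ e * (t : ℝ) ≤ q.1 → f.1 t = g.1 t := by
    intro l
    induction l with
    | nil => simp
    | cons a l ih =>
      intro p q hp hq hf hg hl t ht1 ht2
      obtain rfl : a = p := by simpa using hp
      cases l with
      | nil => simp at hl
      | cons b l =>
        rw [List.isChain_cons_cons] at hf hg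
        rcases le_total (2 ^ e * (t : ℝ)) (b.1 : ℝ) with h | h
        · have e1 := hf.1.2 t ht1 h
          have e2 := hg.1.2 t ht1 h
          have hlt : (0 : ℝ) < (b.1 : ℝ) - a.1 := sub_pos.2 (by exact_mod_cast hf.1.1)
          have e3 := mul_right_cancel₀ hlt.ne' (e1.trans e2.symm)
          have e4 : (2 : ℝ) ^ e * (f.1 t : ℝ) = 2 ^ e * (g.1 t : ℝ) := by linarith
          exact Subtype.ext (mul_left_cancel₀ (by positivity) e4)
        · cases l with
          | nil =>
            obtain rfl : b = q := by simpa using hq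
            have e1 := hf.1.2 t ht1 ht2
            have e2 := hg.1.2 t ht1 ht2
            have hlt : (0 : ℝ) < (b.1 : ℝ) - a.1 := sub_pos.2 (by exact_mod_cast hf.1.1)
            have e3 := mul_right_cancel₀ hlt.ne' (e1.trans e2.symm)
            have e4 : (2 : ℝ) ^ e * (f.1 t : ℝ) = 2 ^ e * (g.1 t : ℝ) := by linarith
            exact Subtype.ext (mul_left_cancel₀ (by positivity) e4)
          | cons d l =>
            exact ih b q (by simp) (by simpa using hq) hf.2 hg.2 (by simp) t h ht2
  have hlen : 2 ≤ l.length := by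
    match l, h0, h1 with
    | [a], h0, h1 =>
      obtain rfl : a = (0, 0) := by simpa using h0
      have : (0 : ℕ) = 2 ^ e := by simpa using h1
      exact absurd this.symm (by positivity)
    | a :: b :: l, _, _ => simp
  refine Subtype.ext (Homeomorph.ext fun t => ?_)
  refine key l _ _ h0 h1 hf hg hlen t ?_ ?_
  · have := t.2.1
    push_cast
    positivity
  · have := t.2.2
    push_cast
    have h2 : (0 : ℝ) < 2 ^ e := by positivity
    nlinarith

/-- Every element of `F` has a code. -/
theorem PLCode.exists_represents (f : ThompsonF) : ∃ c : PLCode, c.Represents f := by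
  classical
  have hd := IsPL2.dyadic_iff f.2
  obtain ⟨hm, B, hB, hA⟩ := f.2
  -- a common denominator
  have hden : ∀ S : Finset unitInterval, (∀ b ∈ S, IsDyadic (b : ℝ)) →
      ∃ e : ℕ, ∀ b ∈ S, ∃ m : ℕ, 2 ^ e * (b : ℝ) = m := by
    intro S
    induction S using Finset.induction_on with
    | empty => intro _; exact ⟨0, by simp⟩
    | insert a S _ ih =>
      intro hS
      obtain ⟨e, he⟩ := ih fun b hb => hS b (Finset.mem_insert_of_mem hb)
      obtain ⟨m, e', hm'⟩ := hS a (Finset.mem_insert_self _ _)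
      have hm0 : 0 ≤ m := by
        have h1 := a.2.1
        rw [hm'] at h1
        by_contra hlt
        have h2 : (m : ℝ) < 0 := by exact_mod_cast not_le.1 hlt
        have h3 : (0 : ℝ) < 2 ^ e' := by positivity
        exact absurd h1 (not_le.2 (div_neg_of_neg_of_pos h2 h3))
      lift m to ℕ using hm0
      refine ⟨e + e', fun b hb => ?_⟩
      rcases Finset.mem_insert.1 hb with rfl | hb
      · refine ⟨2 ^ e * m, ?_⟩
        rw [hm']
        push_cast
        field_simp
        ring
      · obtain ⟨m', h'⟩ := he b hb
        refine ⟨2 ^ e' * m', ?_⟩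
        push_cast
        rw [← h']
        ring
  obtain ⟨e, he⟩ := hden (insert 1 B ∪ (insert 1 B).image f.1) (by
    intro b hb
    have h1 : ∀ b ∈ insert 1 B, IsDyadic (b : ℝ) := by
      intro b hb
      rcases Finset.mem_insert.1 hb with rfl | hb
      · exact ⟨1, 0, by simp⟩
      · exact hB b hb
    rcases Finset.mem_union.1 hb with hb | hb
    · exact h1 b hb
    · obtain ⟨a, ha, rfl⟩ := Finset.mem_image.1 hb
      exact (hd a).2 (h1 a ha))
  have h2e : (0 : ℝ) < 2 ^ e := by positivity
  let R : ℕ × ℕ → ℕ × ℕ → Prop := fun p q =>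
      p.1 < q.1 ∧ ∀ t : unitInterval, (p.1 : ℝ) ≤ 2 ^ e * t → 2 ^ e * (t : ℝ) ≤ q.1 →
        (2 ^ e * (f.1 t : ℝ) - p.2) * ((q.1 : ℝ) - p.1) =
          ((q.2 : ℝ) - p.2) * (2 ^ e * (t : ℝ) - p.1)
  -- a vertex list ending at any given subdivision point
  have step : ∀ (u v : unitInterval) (p q : ℕ × ℕ), u < v → (∀ b ∈ B, b ∉ Set.Ioo u v) →
      2 ^ e * (u : ℝ) = p.1 → 2 ^ e * (f.1 u : ℝ) = p.2 →
      2 ^ e * (v : ℝ) = q.1 → 2 ^ e * (f.1 v : ℝ) = q.2 → R p q := by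
    intro u v p q huv hav h1 h2 h3 h4
    obtain ⟨n, c, hc⟩ := hA u v huv hav
    refine ⟨?_, fun t ht1 ht2 => ?_⟩
    · have : (p.1 : ℝ) < q.1 := by
        rw [← h1, ← h3]
        exact mul_lt_mul_of_pos_left huv h2e
      exact_mod_cast this
    · rw [← h1] at ht1
      rw [← h3] at ht2
      have e1 := hc t ⟨Subtype.coe_le_coe.1 (le_of_mul_le_mul_left ht1 h2e),
        Subtype.coe_le_coe.1 (le_of_mul_le_mul_left ht2 h2e)⟩
      have e2 := hc u ⟨le_rfl, huv.le⟩
      have e3 := hc v ⟨huv.le, le_rfl⟩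
      rw [← h1, ← h2, ← h3, ← h4, e1, e2, e3]
      ring
  have build : ∀ (N : ℕ) (v : unitInterval) (q : ℕ × ℕ), 0 < v → (B.filter (· < v)).card ≤ N →
      2 ^ e * (v : ℝ) = q.1 → 2 ^ e * (f.1 v : ℝ) = q.2 →
      ∃ l : List (ℕ × ℕ), l.head? = some (0, 0) ∧ l.getLast? = some q ∧ l.IsChain R := by
    intro N
    induction N with
    | zero =>
      intro v q hv hcard h1 h2
      refine ⟨[(0, 0), q], by simp, by simp, ?_⟩
      rw [List.isChain_pair]
      refine step 0 v _ _ hv ?_ (by simp) (by simp [strictMono_homeo_zero hm]) h1 h2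
      intro b hb hbt
      have : 0 < (B.filter (· < v)).card :=
        Finset.card_pos.2 ⟨b, Finset.mem_filter.2 ⟨hb, hbt.2⟩⟩
      omega
    | succ N ih =>
      intro v q hv hcard h1 h2
      by_cases hne : ((B.filter (· < v)).filter (0 < ·)).Nonempty
      · obtain ⟨b, hmem, hmax⟩ : ∃ b ∈ (B.filter (· < v)).filter (0 < ·), ∀ x ∈ (B.filter (· < v)).filter (0 < ·), x ≤ b :=
          ⟨_, Finset.max'_mem _ hne, Finset.le_max' _⟩
        obtain ⟨hb1, hb0⟩ := Finset.mem_filter.1 hmem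
        obtain ⟨hbB, hbv⟩ := Finset.mem_filter.1 hb1
        have hlt : (B.filter (· < b)).card < (B.filter (· < v)).card := by
          apply Finset.card_lt_card
          refine ⟨fun a ha => ?_, fun h => ?_⟩
          · obtain ⟨h1, h2⟩ := Finset.mem_filter.1 ha
            exact Finset.mem_filter.2 ⟨h1, h2.trans hbv⟩
          · exact absurd (Finset.mem_filter.1 (h hb1)).2 (lt_irrefl _)
        obtain ⟨m, hm1⟩ := he b (Finset.mem_union_left _ (Finset.mem_insert_of_mem hbB))
        obtain ⟨m', hm2⟩ := he (f.1 b) (Finset.mem_union_right _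
          (Finset.mem_image_of_mem _ (Finset.mem_insert_of_mem hbB)))
        obtain ⟨l, hl0, hl1, hl⟩ := ih b (m, m') hb0 (by omega) hm1 hm2
        refine ⟨l ++ [q], ?_, by simp, ?_⟩
        · rw [List.head?_append, hl0]; rfl
        · refine List.IsChain.append hl (List.isChain_singleton _) ?_
          intro x hx y hy
          rw [hl1] at hx
          obtain rfl : (m, m') = x := by simpa using hx
          obtain rfl : q = y := by simpa using hy
          refine step b v _ _ hbv ?_ hm1 hm2 h1 h2
          intro b' hb' hbt'
          exact absurd (hmax b' (Finset.mem_filter.2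
            ⟨Finset.mem_filter.2 ⟨hb', hbt'.2⟩, hb0.trans hbt'.1⟩)) (not_le.2 hbt'.1)
      · refine ⟨[(0, 0), q], by simp, by simp, ?_⟩
        rw [List.isChain_pair]
        refine step 0 v _ _ hv ?_ (by simp) (by simp [strictMono_homeo_zero hm]) h1 h2
        intro b hb hbt
        exact hne ⟨b, Finset.mem_filter.2 ⟨Finset.mem_filter.2 ⟨hb, hbt.2⟩, hbt.1⟩⟩
  obtain ⟨l, h0, h1, h2⟩ := build _ 1 (2 ^ e, 2 ^ e) (by simp) le_rfl (by simp)
    (by simp [strictMono_homeo_one hm])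
  exact ⟨(e, l), h0, h1, h2⟩

/-!
Elements of Thompson's group `F` are extended by the identity to homeomorphisms of the line, and
`Lev N f` says that `f` has breakpoints in `2 ^ (-N) ℤ` and slope exponents in `[-N, N]`. The
equation `g⁻¹ * x * g = y` is the equation `x * g = g * y`. Whether it holds for given `x`, `y`, `g`
can be decided by evaluating both sides on a sufficiently fine grid (`gridConj_iff`). So it suffices
to find a computable bound such that conjugate tuples have a conjugator within the bound
(`ConjData.exists_lev`); the algorithm then tests all codes up to the resulting size.

To obtain the bound, consider the common fixed set of the `yᵢ`. Its boundary points have an odd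
multiple, by a factor `2 ^ j - 1` coming from a slope, with bounded dyadic denominator
(`hasDen_of_notMem_interior`). Hence they are separated by a definite distance, the dyadic ones among
them have bounded denominators, and the same holds for their images under `g`. The dyadic boundary
points cut `[0, 1]` into two kinds of intervals, on each of which `g` can be changed independently.

* Intervals of common fixed points. There `g` can be replaced by any standard map with the same end
  values (`ConjData.exists_fine_of_fixed`).
* Blocks, that is, chains of components of the complement of the fixed set, separated by nondyadic
  common fixed points. On one component `g` is determined by its slope at an end: some `y`
  contracts towards the end and spreads the germ of `g` to a neighbourhood of definite size
  (`affOn_of_contracting`), and every other point is moved into that neighbourhood by the `y`'s in a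
  bounded number of steps, each of which changes the data of `g` by a bounded amount
  (`IsComp.fine`). As `g` has no breakpoint at a nondyadic point, a bound on the slope propagates
  from each component to the next (`IsBlock.fine_right`). It remains to bound the slope at one fixed
  point of the block.

For this the decisive fact is a rigidity property (`IsComp.commute_of_slope_gt`). Commutators of the
`y`'s are trivial on a small interval at the end of a component. If `g` has a very large slope there,
it stretches this interval over almost the entire image component, on which the commutators of the
`x`'s are then trivial, so that the `y`'s commute on the component. Therefore either some slope of
`g` at a fixed point of the block is bounded already, or the `y`'s commute on the whole block. In the
latter case the restriction of some `yᵢ` to the block centralizes all `y`'s and has a slope other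
than one at the left end of the block; multiplying `g` by one of its powers makes the slope of `g`
there small (`IsBlock.exists_fine`).

Finally, these bounds concern single points: each breakpoint of the new `g`, or its image, has a
bounded denominator, and the slopes are bounded. There are boundedly many such points, so that all
coordinates have bounded denominators (`lev_of_fine`).
-/

open Set Filter Topology

/-! ### Dyadic rationals of bounded denominator -/

/-- The additive group `2 ^ (-N) ℤ`. -/
def Dy (N : ℕ) : AddSubgroup ℝ where
  carrier := {x | ∃ m : ℤ, x * 2 ^ N = m}
  zero_mem' := ⟨0, by simp⟩
  add_mem' := by
    rintro x y ⟨m, hm⟩ ⟨n, hn⟩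
    exact ⟨m + n, by push_cast; rw [add_mul, hm, hn]⟩
  neg_mem' := by
    rintro x ⟨m, hm⟩
    exact ⟨-m, by push_cast; rw [neg_mul, hm]⟩

theorem Dy_mono {N M : ℕ} (h : N ≤ M) {x : ℝ} (hx : x ∈ Dy N) : x ∈ Dy M := by
  obtain ⟨m, hm⟩ := hx
  obtain ⟨k, rfl⟩ := Nat.exists_eq_add_of_le h
  exact ⟨m * 2 ^ k, by push_cast; rw [pow_add, ← mul_assoc, hm]⟩

theorem intCast_mem_Dy (m : ℤ) (N : ℕ) : (m : ℝ) ∈ Dy N := ⟨m * 2 ^ N, by push_cast; rfl⟩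

theorem int_mul_mem_Dy {N : ℕ} {x : ℝ} (k : ℤ) (hx : x ∈ Dy N) : (k : ℝ) * x ∈ Dy N := by
  obtain ⟨m, hm⟩ := hx
  exact ⟨k * m, by push_cast; rw [mul_assoc, hm]⟩

theorem div_two_pow_mem_Dy (m : ℤ) (N : ℕ) : (m : ℝ) / 2 ^ N ∈ Dy N := ⟨m, by field_simp⟩

theorem two_zpow_mul_mem_Dy {N K : ℕ} {x : ℝ} (hx : x ∈ Dy N) {n : ℤ} (hn : -(K : ℤ) ≤ n) :
    (2 : ℝ) ^ n * x ∈ Dy (N + K) := by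
  obtain ⟨m, hm⟩ := hx
  obtain ⟨j, hj⟩ := Int.eq_ofNat_of_zero_le (a := n + K) (by omega)
  refine ⟨2 ^ j * m, ?_⟩
  have : (2 : ℝ) ^ n * 2 ^ K = 2 ^ j := by
    rw [← zpow_natCast, ← zpow_natCast, ← zpow_add₀ two_ne_zero, hj]
  push_cast
  rw [← hm, ← this, pow_add]
  ring

/-- A nonzero element of `2 ^ (-N) ℤ` has absolute value at least `2 ^ (-N)`. -/
theorem Dy_abs_ge {N : ℕ} {x : ℝ} (hx : x ∈ Dy N) (h0 : x ≠ 0) : 1 / 2 ^ N ≤ |x| := by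
  obtain ⟨m, hm⟩ := hx
  have hm0 : m ≠ 0 := by
    rintro rfl
    simp at hm
    exact h0 hm
  have h1 : (1 : ℝ) ≤ |(m : ℝ)| := by exact_mod_cast Int.one_le_abs hm0
  rw [← hm, abs_mul, abs_of_pos (by positivity : (0 : ℝ) < 2 ^ N)] at h1
  rw [div_le_iff₀ (by positivity)]
  exact h1

/-- The cell of the grid `2 ^ (-N) ℤ` with a given left end contains no further grid points. -/
theorem Dy_not_mem_Ioo {N : ℕ} {e : ℝ} (he : e ∈ Dy N) :
    ∀ x ∈ Ioo e (e + 1 / 2 ^ N), x ∉ Dy N := by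
  intro x hx hxN
  have h := Dy_abs_ge ((Dy N).sub_mem hxN he) (sub_ne_zero.2 hx.1.ne')
  rw [abs_of_pos (sub_pos.2 hx.1)] at h
  linarith [hx.2]

theorem exists_Dy_floor (N : ℕ) (t : ℝ) : ∃ e ∈ Dy N, e ≤ t ∧ t < e + 1 / 2 ^ N := by
  have h2 : (0 : ℝ) < 2 ^ N := by positivity
  refine ⟨⌊t * 2 ^ N⌋ / 2 ^ N, div_two_pow_mem_Dy _ _, ?_, ?_⟩
  · rw [div_le_iff₀ h2]
    exact Int.floor_le _
  · rw [← add_div, lt_div_iff₀ h2]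
    exact Int.lt_floor_add_one _

theorem exists_Dy_floor_of_not_mem {N : ℕ} {t : ℝ} (ht : t ∉ Dy N) :
    ∃ e ∈ Dy N, e < t ∧ t < e + 1 / 2 ^ N := by
  obtain ⟨e, he, h1, h2⟩ := exists_Dy_floor N t
  exact ⟨e, he, lt_of_le_of_ne h1 (by rintro rfl; exact ht he), h2⟩

theorem exists_Dy_ceil (N : ℕ) (t : ℝ) : ∃ e ∈ Dy N, e - 1 / 2 ^ N < t ∧ t ≤ e := by
  obtain ⟨e, he, h1, h2⟩ := exists_Dy_floor N (-t)
  exact ⟨-e, (Dy N).neg_mem he, by linarith, by linarith⟩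

theorem one_div_mem_Dy (N : ℕ) : (1 : ℝ) / 2 ^ N ∈ Dy N := by
  simpa using div_two_pow_mem_Dy 1 N

theorem isDyadic_iff {x : ℝ} : IsDyadic x ↔ ∃ N, x ∈ Dy N := by
  constructor
  · rintro ⟨m, e, rfl⟩
    exact ⟨e, div_two_pow_mem_Dy m e⟩
  · rintro ⟨e, m, hm⟩
    exact ⟨m, e, by rw [← hm]; field_simp⟩

theorem countable_Dy (N : ℕ) : (Dy N : Set ℝ).Countable := by
  have : (Dy N : Set ℝ) ⊆ range fun m : ℤ => (m : ℝ) / 2 ^ N := by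
    rintro x ⟨m, hm⟩
    exact ⟨m, by simp only; rw [← hm]; field_simp⟩
  exact (countable_range _).mono this

/-! ### Affine pieces -/

/-- On the set `s` the function `f` is affine of slope `2 ^ n`. -/
def AffOn (f : ℝ → ℝ) (n : ℤ) (s : Set ℝ) : Prop :=
  ∀ x ∈ s, ∀ y ∈ s, f y - f x = 2 ^ n * (y - x)

theorem AffOn.mono {f : ℝ → ℝ} {n : ℤ} {s t : Set ℝ} (h : AffOn f n s) (hts : t ⊆ s) :
    AffOn f n t := fun x hx y hy => h x (hts hx) y (hts hy)

theorem AffOn.congr {f g : ℝ → ℝ} {n : ℤ} {s : Set ℝ} (h : AffOn f n s) (hfg : ∀ x ∈ s, g x = f x) :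
    AffOn g n s := fun x hx y hy => by rw [hfg x hx, hfg y hy]; exact h x hx y hy

theorem AffOn.comp {f g : ℝ → ℝ} {n m : ℤ} {s t : Set ℝ} (hf : AffOn f n t) (hg : AffOn g m s)
    (hst : MapsTo g s t) : AffOn (fun x => f (g x)) (n + m) s := by
  intro x hx y hy
  simp only
  rw [hf _ (hst hx) _ (hst hy), hg x hx y hy, zpow_add₀ two_ne_zero, mul_assoc]

theorem AffOn.inv {f : ℝ ≃o ℝ} {n : ℤ} {s t : Set ℝ} (hf : AffOn f n t) (hst : MapsTo (f⁻¹ : ℝ ≃o ℝ) s t) :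
    AffOn (f⁻¹ : ℝ ≃o ℝ) (-n) s := by
  intro x hx y hy
  have := hf _ (hst hx) _ (hst hy)
  rw [RelIso.apply_inv_self, RelIso.apply_inv_self] at this
  rw [this, ← mul_assoc, ← zpow_add₀ two_ne_zero]
  simp

theorem two_zpow_inj {n m : ℤ} (h : (2 : ℝ) ^ n = 2 ^ m) : n = m :=
  zpow_right_injective₀ (by norm_num) (by norm_num) h

theorem AffOn.unique {f : ℝ → ℝ} {n m : ℤ} {s t : Set ℝ} (h : AffOn f n s) (h' : AffOn f m t)
    {x y : ℝ} (hxy : x ≠ y) (hx : x ∈ s) (hy : y ∈ s) (hx' : x ∈ t) (hy' : y ∈ t) : n = m := by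
  have h1 := h x hx y hy
  rw [h' x hx' y hy'] at h1
  exact (two_zpow_inj (mul_right_cancel₀ (sub_ne_zero.2 hxy.symm) h1)).symm

/-- Two overlapping affine pieces have the same slope. -/
theorem AffOn.unique_Icc {f : ℝ → ℝ} {n m : ℤ} {a b c d : ℝ} (h : AffOn f n (Icc a b))
    (h' : AffOn f m (Icc c d)) (hl : max a c < min b d) : n = m := by
  have h1 := (le_max_left a c); have h2 := le_max_right a c
  have h3 := min_le_left b d; have h4 := min_le_right b d
  exact h.unique h' (x := max a c) (y := min b d) hl.ne ⟨h1, by linarith⟩ ⟨by linarith, h3⟩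
    ⟨h2, by linarith⟩ ⟨by linarith, h4⟩

/-- An affine piece of slope one with a fixed point is an identity. -/
theorem AffOn.eq_self {f : ℝ → ℝ} {s : Set ℝ} (h : AffOn f 0 s) {x : ℝ} (hx : x ∈ s) (hfx : f x = x)
    {y : ℝ} (hy : y ∈ s) : f y = y := by
  have := h x hx y hy
  rw [hfx] at this
  simp at this
  linarith

theorem AffOn.eq_zero_of_fixed {f : ℝ → ℝ} {n : ℤ} {s : Set ℝ} (h : AffOn f n s) {x y : ℝ}
    (hx : x ∈ s) (hy : y ∈ s) (hfx : f x = x) (hfy : f y = y) (hxy : x ≠ y) : n = 0 := by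
  have := h x hx y hy
  rw [hfx, hfy] at this
  have h1 : (2 : ℝ) ^ n = 2 ^ (0 : ℤ) := by
    rw [zpow_zero]
    exact mul_right_cancel₀ (sub_ne_zero.2 hxy.symm) (by rw [← this, one_mul])
  exact two_zpow_inj h1

/-! ### Piecewise linear homeomorphisms of the line with bounded data -/

/-- `Lev N f`: the breakpoints of `f` lie in `2 ^ (-N) ℤ`, the slopes are powers of two with
exponents in `[-N, N]`, and `f` maps `2 ^ (-N) ℤ` into `2 ^ (-2N) ℤ`. -/
def Lev (N : ℕ) (f : ℝ ≃o ℝ) : Prop :=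
  (∀ a b : ℝ, a < b → (∀ x ∈ Ioo a b, x ∉ Dy N) → ∃ n : ℤ, |n| ≤ N ∧ AffOn f n (Icc a b)) ∧
    ∀ x ∈ Dy N, f x ∈ Dy (2 * N)

/-- A cell of the grid is an affine piece. -/
theorem Lev.cell {N : ℕ} {f : ℝ ≃o ℝ} (hf : Lev N f) {e : ℝ} (he : e ∈ Dy N) :
    ∃ n : ℤ, |n| ≤ N ∧ AffOn f n (Icc e (e + 1 / 2 ^ N)) :=
  hf.1 _ _ (by simp) (Dy_not_mem_Ioo he)

theorem Lev.image_mem {N K : ℕ} {f : ℝ ≃o ℝ} (hf : Lev N f) (hK : N ≤ K) {x : ℝ} (hx : x ∈ Dy K) :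
    f x ∈ Dy (K + N) := by
  obtain ⟨e, he, h1, h2⟩ := exists_Dy_floor N x
  obtain ⟨n, hn, hA⟩ := hf.cell he
  have h3 := hA e ⟨le_rfl, by simp⟩ x ⟨h1, h2.le⟩
  have h4 : f x = 2 ^ n * (x - e) + f e := by linarith
  rw [h4]
  refine (Dy _).add_mem (two_zpow_mul_mem_Dy ((Dy K).sub_mem hx (Dy_mono hK he)) ?_)
    (Dy_mono (by omega) (hf.2 e he))
  exact (abs_le.1 hn).1

theorem Lev.mem_of_image {N K : ℕ} {f : ℝ ≃o ℝ} (hf : Lev N f) (hK : 2 * N ≤ K) {x : ℝ}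
    (hx : f x ∈ Dy K) : x ∈ Dy (K + N) := by
  obtain ⟨e, he, h1, h2⟩ := exists_Dy_floor N x
  obtain ⟨n, hn, hA⟩ := hf.cell he
  have h3 := hA e ⟨le_rfl, by simp⟩ x ⟨h1, h2.le⟩
  have h4 : x = 2 ^ (-n) * (f x - f e) + e := by
    rw [h3, ← mul_assoc, ← zpow_add₀ two_ne_zero]
    simp
  rw [h4]
  refine (Dy _).add_mem (two_zpow_mul_mem_Dy ((Dy K).sub_mem hx (Dy_mono hK (hf.2 e he))) ?_)
    (Dy_mono (by omega) he)
  have := (abs_le.1 hn).2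
  omega

theorem Lev.mono {N M : ℕ} (h : N ≤ M) {f : ℝ ≃o ℝ} (hf : Lev N f) : Lev M f := by
  refine ⟨fun a b hab hD => ?_, fun x hx => Dy_mono (by omega) (hf.image_mem h hx)⟩
  obtain ⟨n, hn, hA⟩ := hf.1 a b hab fun x hx hxN => hD x hx (Dy_mono h hxN)
  exact ⟨n, hn.trans (by exact_mod_cast h), hA⟩

theorem Lev.inv {N : ℕ} {f : ℝ ≃o ℝ} (hf : Lev N f) : Lev (2 * N) f⁻¹ := by
  refine ⟨fun a b hab hD => ?_, fun x hx => ?_⟩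
  · obtain ⟨n, hn, hA⟩ := hf.1 ((f⁻¹ : ℝ ≃o ℝ) a) ((f⁻¹ : ℝ ≃o ℝ) b) ((f⁻¹ : ℝ ≃o ℝ).lt_iff_lt.2 hab) (by
      intro x hx hxN
      refine hD (f x) ⟨?_, ?_⟩ (hf.2 x hxN)
      · have := f.lt_iff_lt.2 hx.1
        rwa [RelIso.apply_inv_self] at this
      · have := f.lt_iff_lt.2 hx.2
        rwa [RelIso.apply_inv_self] at this)
    refine ⟨-n, by rw [abs_neg]; push_cast; linarith [abs_nonneg n], hA.inv ?_⟩
    intro x hx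
    exact ⟨(f⁻¹ : ℝ ≃o ℝ).le_iff_le.2 hx.1, (f⁻¹ : ℝ ≃o ℝ).le_iff_le.2 hx.2⟩
  · refine Dy_mono (by omega) (hf.mem_of_image le_rfl ?_)
    rwa [RelIso.apply_inv_self]

theorem Lev.mul {N M : ℕ} {f g : ℝ ≃o ℝ} (hf : Lev N f) (hg : Lev M g) :
    Lev (N + 3 * M) (f * g) := by
  refine ⟨fun a b hab hD => ?_, fun x hx => ?_⟩
  · obtain ⟨m, hm, hA⟩ := hg.1 a b hab fun x hx hxM => hD x hx (Dy_mono (by omega) hxM)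
    obtain ⟨n, hn, hB⟩ := hf.1 (g a) (g b) (g.lt_iff_lt.2 hab) (by
      intro y hy hyN
      obtain ⟨x, rfl⟩ := g.surjective y
      refine hD x ⟨g.lt_iff_lt.1 hy.1, g.lt_iff_lt.1 hy.2⟩ ?_
      exact Dy_mono (by omega) (hg.mem_of_image (K := N + 2 * M) (by omega) (Dy_mono (by omega) hyN)))
    refine ⟨n + m, ?_, hB.comp hA fun x hx => ⟨g.le_iff_le.2 hx.1, g.le_iff_le.2 hx.2⟩⟩
    have := abs_add_le n m
    push_cast
    linarith
  · have h1 := hg.image_mem (by omega) hx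
    exact Dy_mono (by omega) (hf.image_mem (K := N + 3 * M + M) (by omega) h1)

theorem Lev.one : Lev 0 1 := by
  refine ⟨fun a b _ _ => ⟨0, by simp, fun x _ y _ => by simp⟩, fun x hx => hx⟩

/-- The group of homeomorphisms of the line that satisfy `Lev N` for some `N`. -/
def levGroup : Subgroup (ℝ ≃o ℝ) where
  carrier := {f | ∃ N, Lev N f}
  mul_mem' := by
    rintro f g ⟨N, hf⟩ ⟨M, hg⟩
    exact ⟨_, hf.mul hg⟩
  one_mem' := ⟨0, Lev.one⟩
  inv_mem' := by
    rintro f ⟨N, hf⟩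
    exact ⟨_, hf.inv⟩

/-- Elements of `levGroup` preserve and reflect dyadic rationals. -/
theorem dyadic_apply_iff {f : ℝ ≃o ℝ} (hf : f ∈ levGroup) {x : ℝ} :
    (∃ N, f x ∈ Dy N) ↔ ∃ N, x ∈ Dy N := by
  obtain ⟨M, hf⟩ := hf
  constructor
  · rintro ⟨N, h⟩
    exact ⟨_, hf.mem_of_image (K := N + 2 * M) (by omega) (Dy_mono (by omega) h)⟩
  · rintro ⟨N, h⟩
    exact ⟨_, hf.image_mem (K := N + M) (by omega) (Dy_mono (by omega) h)⟩

/-- Slopes are bounded, hence so are the difference quotients. -/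
theorem Lev.sub_le {N : ℕ} {f : ℝ ≃o ℝ} (hf : Lev N f) {x y : ℝ} (hxy : x ≤ y) :
    f y - f x ≤ 2 ^ N * (y - x) := by
  have hc : Continuous fun t => f t - f x - 2 ^ N * (t - x) := by
    have := f.continuous
    fun_prop
  have key : Icc x y ⊆ {t | f t - f x - 2 ^ N * (t - x) ≤ 0} := by
    refine IsClosed.Icc_subset_of_forall_exists_gt ?_ (by simp) ?_
    · exact (isClosed_le hc continuous_const).inter isClosed_Icc
    · rintro t ⟨ht, htx⟩ z hz
      obtain ⟨e, he, h1, h2⟩ := exists_Dy_floor N t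
      obtain ⟨n, hn, hA⟩ := hf.cell he
      have hz' : t < z := hz
      refine ⟨min z (e + 1 / 2 ^ N), ?_, lt_min hz' h2, min_le_left _ _⟩
      have h3 := hA t ⟨h1, h2.le⟩ (min z (e + 1 / 2 ^ N))
        ⟨h1.trans (lt_min hz' h2).le, min_le_right _ _⟩
      have h4 : (0 : ℝ) ≤ min z (e + 1 / 2 ^ N) - t := sub_nonneg.2 (lt_min hz' h2).le
      have h5 : (2 : ℝ) ^ n ≤ 2 ^ N := by
        rw [← zpow_natCast]
        exact zpow_le_zpow_right₀ (by norm_num) (abs_le.1 hn).2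
      have h6 := mul_le_mul_of_nonneg_right h5 h4
      simp only [mem_ofPred_eq] at ht ⊢
      linarith
  have := key ⟨hxy, le_rfl⟩
  simp only [mem_ofPred_eq] at this
  linarith

/-! ### Denominators of fixed points -/

/-- `HasDen E z`: an odd multiple `k * z`, with `0 < k ≤ 2 ^ E`, lies in `2 ^ (-2E) ℤ`. This holds
for the boundary points of common fixed sets of homeomorphisms satisfying `Lev E`. -/
def HasDen (E : ℕ) (z : ℝ) : Prop :=
  ∃ k : ℤ, Odd k ∧ 0 < k ∧ k ≤ 2 ^ E ∧ (k : ℝ) * z ∈ Dy (2 * E)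

theorem hasDen_of_mem_Dy {E : ℕ} {z : ℝ} (hz : z ∈ Dy (2 * E)) : HasDen E z :=
  ⟨1, odd_one, one_pos, one_le_pow₀ (by norm_num), by simpa using hz⟩

/-- As the multiplier is odd, it cannot cancel powers of two in the denominator of a dyadic point. -/
theorem HasDen.mem_Dy {E N : ℕ} {z : ℝ} (h : HasDen E z) (hz : z ∈ Dy N) : z ∈ Dy (2 * E) := by
  rcases le_total N (2 * E) with hN | hN
  · exact Dy_mono hN hz
  obtain ⟨k, hk, -, -, m, hm⟩ := h
  obtain ⟨m', hm'⟩ := hz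
  obtain ⟨j, rfl⟩ := Nat.exists_eq_add_of_le hN
  have h1 : (k : ℝ) * m' = m * 2 ^ j := by
    rw [← hm, ← hm', pow_add]; ring
  have h2 : k * m' = m * 2 ^ j := by exact_mod_cast h1
  have h3 : (2 : ℤ) ^ j ∣ m' := by
    have : IsCoprime ((2 : ℤ) ^ j) k := by
      apply IsCoprime.pow_left
      rw [Int.isCoprime_iff_gcd_eq_one]
      exact (Int.isCoprime_iff_gcd_eq_one.1 (Int.isCoprime_two_left.2 hk))
    exact this.dvd_of_dvd_mul_left ⟨m, by rw [h2, mul_comm]⟩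
  obtain ⟨c, rfl⟩ := h3
  refine ⟨c, ?_⟩
  have h4 : (2 : ℝ) ^ j ≠ 0 := by positivity
  apply mul_right_cancel₀ h4
  push_cast at hm'
  rw [mul_assoc, ← pow_add, hm']
  ring

theorem HasDen.gap {E L : ℕ} {z c : ℝ} (h : HasDen E z) (hc : c ∈ Dy L) (hL : 2 * E ≤ L)
    (hcz : c ≠ z) : 1 / 2 ^ (L + E) ≤ |c - z| := by
  obtain ⟨k, -, hk0, hk, hkz⟩ := h
  have hk0' : (0 : ℝ) < k := by exact_mod_cast hk0
  have hk' : (k : ℝ) ≤ 2 ^ E := by exact_mod_cast hk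
  have h1 : (k : ℝ) * (c - z) ∈ Dy L := by
    rw [mul_sub]
    exact (Dy L).sub_mem (int_mul_mem_Dy k hc) (Dy_mono hL hkz)
  have h2 := Dy_abs_ge h1 (mul_ne_zero hk0'.ne' (sub_ne_zero.2 hcz))
  rw [abs_mul, abs_of_pos hk0'] at h2
  have h3 : (k : ℝ) * |c - z| ≤ 2 ^ E * |c - z| := mul_le_mul_of_nonneg_right hk' (abs_nonneg _)
  rw [pow_add, ← div_div, div_le_iff₀ (by positivity)]
  linarith

/-- Consequently the boundary points of a common fixed set do not accumulate. -/
theorem HasDen.sep {E : ℕ} {z c : ℝ} (h : HasDen E z) (hc : HasDen E c)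
    (hcz : c ≠ z) : 1 / 2 ^ (4 * E) ≤ |c - z| := by
  obtain ⟨k, -, hk0, hk, hkz⟩ := h
  obtain ⟨l, -, hl0, hl, hlc⟩ := hc
  have hk0' : (0 : ℝ) < k := by exact_mod_cast hk0
  have hk' : (k : ℝ) ≤ 2 ^ E := by exact_mod_cast hk
  have hl0' : (0 : ℝ) < l := by exact_mod_cast hl0
  have hl' : (l : ℝ) ≤ 2 ^ E := by exact_mod_cast hl
  have h1 : ((k : ℝ) * l) * (c - z) ∈ Dy (2 * E) := by
    have : ((k : ℝ) * l) * (c - z) = k * (l * c) - l * (k * z) := by ring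
    rw [this]
    exact (Dy _).sub_mem (int_mul_mem_Dy k hlc) (int_mul_mem_Dy l hkz)
  have h2 := Dy_abs_ge h1 (mul_ne_zero (mul_pos hk0' hl0').ne' (sub_ne_zero.2 hcz))
  rw [abs_mul, abs_of_pos (mul_pos hk0' hl0')] at h2
  have h3 : (k : ℝ) * l ≤ 2 ^ E * 2 ^ E := mul_le_mul hk' hl' hl0'.le (by positivity)
  have h4 := mul_le_mul_of_nonneg_right h3 (abs_nonneg (c - z))
  have h5 : (2 : ℝ) ^ (4 * E) = 2 ^ (2 * E) * (2 ^ E * 2 ^ E) := by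
    rw [← pow_add, ← pow_add]; congr 1; omega
  rw [h5, ← div_div, div_le_iff₀ (by positivity)]
  linarith

/-- Solving `f z = z` on an affine piece of slope `2 ^ n` with `n ≠ 0` gives the multiplier
`2 ^ |n| - 1`. -/
theorem Lev.hasDen {E : ℕ} {f : ℝ ≃o ℝ} (hf : Lev E f) {e : ℝ} (he : e ∈ Dy E) {n : ℤ}
    {s : Set ℝ} (hn : |n| ≤ E) (hA : AffOn f n s) (hes : e ∈ s)
    (hn0 : n ≠ 0) {z : ℝ} (hz : z ∈ s) (hfz : f z = z) : HasDen E z := by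
  have h1 := hA e hes z hz
  rw [hfz] at h1
  have hfe := hf.2 e he
  have hj0 : 1 ≤ n.natAbs := Nat.one_le_iff_ne_zero.2 (Int.natAbs_ne_zero.2 hn0)
  have hj1 : n.natAbs ≤ E := by have := abs_le.1 hn; omega
  have he2 : e ∈ Dy (2 * E) := Dy_mono (by omega) he
  refine ⟨2 ^ n.natAbs - 1, ?_, ?_, ?_, ?_⟩
  · exact (even_two.pow_of_ne_zero (by omega)).sub_odd odd_one
  · have : (1 : ℤ) < 2 ^ n.natAbs := one_lt_pow₀ (by norm_num) (by omega)
    linarith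
  · have : (2 : ℤ) ^ n.natAbs ≤ 2 ^ E := pow_le_pow_right₀ (by norm_num) hj1
    linarith
  · rcases lt_or_gt_of_ne hn0 with hneg | hpos
    · have h2 : (2 : ℝ) ^ n.natAbs * 2 ^ n = 1 := by
        rw [← zpow_natCast, ← zpow_add₀ two_ne_zero]
        have : (n.natAbs : ℤ) + n = 0 := by omega
        rw [this, zpow_zero]
      have h3 : ((2 ^ n.natAbs - 1 : ℤ) : ℝ) * z = ((2 ^ n.natAbs : ℤ) : ℝ) * f e - e := by
        push_cast
        linear_combination (2 ^ n.natAbs : ℝ) * h1 + (z - e) * h2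
      rw [h3]
      exact (Dy _).sub_mem (int_mul_mem_Dy _ hfe) he2
    · have h2 : (2 : ℝ) ^ n.natAbs = 2 ^ n := by
        rw [← zpow_natCast]
        congr 1
        omega
      have h3 : ((2 ^ n.natAbs - 1 : ℤ) : ℝ) * z = ((2 ^ n.natAbs : ℤ) : ℝ) * e - f e := by
        push_cast
        rw [h2]
        linear_combination -h1
      rw [h3]
      exact (Dy _).sub_mem (int_mul_mem_Dy _ he2) hfe

/-- The set of common fixed points of a family of homeomorphisms. -/
def FixSet (T : Set (ℝ ≃o ℝ)) : Set ℝ := {t | ∀ f ∈ T, f t = t}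

theorem mem_FixSet {T : Set (ℝ ≃o ℝ)} {t : ℝ} : t ∈ FixSet T ↔ ∀ f ∈ T, f t = t := Iff.rfl

theorem isClosed_FixSet (T : Set (ℝ ≃o ℝ)) : IsClosed (FixSet T) := by
  have : FixSet T = ⋂ f ∈ T, {t | f t = t} := by
    ext t
    simp [FixSet]
  rw [this]
  exact isClosed_biInter fun f _ => isClosed_eq f.continuous continuous_id

theorem hasDen_of_notMem_interior {E : ℕ} {T : Set (ℝ ≃o ℝ)} (hT : ∀ f ∈ T, Lev E f) {z : ℝ}
    (hz : z ∈ FixSet T) (hzi : z ∉ interior (FixSet T)) : HasDen E z := by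
  by_cases hzE : z ∈ Dy E
  · exact hasDen_of_mem_Dy (Dy_mono (by omega) hzE)
  obtain ⟨e, he, h1, h2⟩ := exists_Dy_floor_of_not_mem hzE
  by_contra hcon
  apply hzi
  rw [mem_interior]
  refine ⟨Ioo e (e + 1 / 2 ^ E), ?_, isOpen_Ioo, h1, h2⟩
  intro t ht f hf
  obtain ⟨n, hn, hA⟩ := (hT f hf).cell he
  have hzc : z ∈ Icc e (e + 1 / 2 ^ E) := ⟨h1.le, h2.le⟩
  have hn0 : n = 0 := by
    by_contra hn0
    exact hcon ((hT f hf).hasDen he hn hA ⟨le_rfl, by simp⟩ hn0 hzc (hz f hf))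
  subst hn0
  exact hA.eq_self hzc (hz f hf) ⟨ht.1.le, ht.2.le⟩

/-- Away from the grid, the interior of the common fixed set is closed. -/
theorem mem_interior_FixSet_of_closure {E : ℕ} {T : Set (ℝ ≃o ℝ)} (hT : ∀ f ∈ T, Lev E f) {z : ℝ}
    (hz : z ∈ closure (interior (FixSet T))) (hzE : z ∉ Dy E) : z ∈ interior (FixSet T) := by
  obtain ⟨e, he, h1, h2⟩ := exists_Dy_floor_of_not_mem hzE
  obtain ⟨w, ⟨hw1, hw2⟩, hwi⟩ := mem_closure_iff.1 hz (Ioo e (e + 1 / 2 ^ E)) isOpen_Ioo ⟨h1, h2⟩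
  obtain ⟨ε, hε, hball⟩ := Metric.isOpen_iff.1 isOpen_interior w hwi
  obtain ⟨w', hw'1, hw'2⟩ := exists_between (lt_min (by linarith : w < w + ε) hw2)
  have hw'F : w' ∈ FixSet T := by
    apply interior_subset
    apply hball
    rw [Metric.mem_ball, Real.dist_eq, abs_of_pos (by linarith)]
    linarith [hw'2.trans_le (min_le_left _ _)]
  have hwF : w ∈ FixSet T := interior_subset hwi
  rw [mem_interior]
  refine ⟨Ioo e (e + 1 / 2 ^ E), ?_, isOpen_Ioo, h1, h2⟩
  intro t ht f hf
  obtain ⟨n, hn, hA⟩ := (hT f hf).cell he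
  have hw1' : w ∈ Icc e (e + 1 / 2 ^ E) := ⟨hw1.le, hw2.le⟩
  have hw2' : w' ∈ Icc e (e + 1 / 2 ^ E) :=
    ⟨by linarith, (hw'2.trans_le (min_le_right _ _)).le⟩
  have hn0 := hA.eq_zero_of_fixed hw1' hw2' (hwF f hf) (hw'F f hf) hw'1.ne
  subst hn0
  exact hA.eq_self hw1' (hwF f hf) ⟨ht.1.le, ht.2.le⟩

/-! ### Displacement -/

theorem half_le_abs_two_zpow_sub_one {n : ℤ} (hn : n ≠ 0) : (1 : ℝ) / 2 ≤ |(2 : ℝ) ^ n - 1| := by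
  rcases lt_or_gt_of_ne hn with h | h
  · have h1 : (2 : ℝ) ^ n ≤ 2 ^ (-1 : ℤ) := zpow_le_zpow_right₀ (by norm_num) (by omega)
    rw [abs_sub_comm]
    refine le_trans ?_ (le_abs_self _)
    rw [zpow_neg_one] at h1
    linarith
  · have h1 : (2 : ℝ) ^ (1 : ℤ) ≤ 2 ^ n := zpow_le_zpow_right₀ (by norm_num) (by omega)
    refine le_trans ?_ (le_abs_self _)
    rw [zpow_one] at h1
    linarith

theorem AffOn.half_abs_sub_le {f : ℝ → ℝ} {n : ℤ} {s : Set ℝ} (h : AffOn f n s) (hn : n ≠ 0)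
    {z t : ℝ} (hz : z ∈ s) (ht : t ∈ s) (hfz : f z = z) : |t - z| / 2 ≤ |f t - t| := by
  have h1 := h z hz t ht
  have h2 : f t - t = (2 ^ n - 1) * (t - z) := by
    rw [hfz] at h1
    linear_combination h1
  rw [h2, abs_mul]
  have := mul_le_mul_of_nonneg_right (half_le_abs_two_zpow_sub_one hn) (abs_nonneg (t - z))
  linarith

/-- Every point is moved by a definite amount, or by half its distance to a common fixed point. -/
theorem exists_displacement {E : ℕ} {T : Set (ℝ ≃o ℝ)} (hT : ∀ f ∈ T, Lev E f) (t : ℝ) :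
    (∃ f ∈ T, 1 / 2 ^ (4 * E + 2) ≤ |f t - t|) ∨
      ∃ z ∈ FixSet T, t = z ∨ ∃ f ∈ T, |t - z| / 2 ≤ |f t - t| := by
  obtain ⟨e, he, h1, h2⟩ := exists_Dy_floor E t
  set e' := e + 1 / 2 ^ E with he'
  have he'D : e' ∈ Dy E := (Dy E).add_mem he (one_div_mem_Dy E)
  have hee' : e < e' := by rw [he']; simp
  have htc : t ∈ Icc e e' := ⟨h1, h2.le⟩
  have hle : (1 : ℝ) / 2 ^ (4 * E + 2) ≤ 1 / 2 ^ (2 * E) :=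
    one_div_le_one_div_of_le (by positivity) (pow_le_pow_right₀ (by norm_num) (by omega))
  by_cases hzero : ∀ f ∈ T, ∃ z ∈ Icc e e', f z = z
  · by_cases hall : t ∈ FixSet T
    · exact Or.inr ⟨t, hall, Or.inl rfl⟩
    obtain ⟨f, hf, hft⟩ : ∃ f ∈ T, f t ≠ t := by
      simpa [mem_FixSet] using hall
    obtain ⟨n, hn, hA⟩ := (hT f hf).cell he
    obtain ⟨z, hz, hfz⟩ := hzero f hf
    have hn0 : n ≠ 0 := by
      rintro rfl
      exact hft (hA.eq_self hz hfz htc)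
    by_cases hzF : z ∈ FixSet T
    · exact Or.inr ⟨z, hzF, Or.inr ⟨f, hf, hA.half_abs_sub_le hn0 hz htc hfz⟩⟩
    obtain ⟨g, hg, hgz⟩ : ∃ g ∈ T, g z ≠ z := by
      simpa [mem_FixSet] using hzF
    obtain ⟨m, hm, hB⟩ := (hT g hg).cell he
    obtain ⟨w, hw, hgw⟩ := hzero g hg
    have hm0 : m ≠ 0 := by
      rintro rfl
      exact hgz (hB.eq_self hw hgw hz)
    have hwz : w ≠ z := by
      rintro rfl
      exact hgz hgw
    have hsep := ((hT f hf).hasDen he hn hA ⟨le_rfl, hee'.le⟩ hn0 hz hfz).sep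
      ((hT g hg).hasDen he hm hB ⟨le_rfl, hee'.le⟩ hm0 hw hgw) hwz
    have htri : |w - z| ≤ |t - z| + |t - w| := by
      have := abs_sub_le w t z
      rw [abs_sub_comm w t] at this
      linarith
    have hq : (1 : ℝ) / 2 ^ (4 * E + 2) = 1 / 2 ^ (4 * E) / 4 := by
      rw [pow_add]; field_simp; norm_num
    left
    rcases le_total |t - z| |t - w| with h | h
    · exact ⟨g, hg, le_trans (by linarith) (hB.half_abs_sub_le hm0 hw htc hgw)⟩
    · exact ⟨f, hf, le_trans (by linarith) (hA.half_abs_sub_le hn0 hz htc hfz)⟩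
  · push Not at hzero
    obtain ⟨f, hf, hne⟩ := hzero
    left
    refine ⟨f, hf, hle.trans ?_⟩
    obtain ⟨n, hn, hA⟩ := (hT f hf).cell he
    have hint : ∀ x ∈ Dy E, f x - x ∈ Dy (2 * E) := fun x hx =>
      (Dy _).sub_mem ((hT f hf).2 x hx) (Dy_mono (by omega) hx)
    have ge := Dy_abs_ge (hint e he) (sub_ne_zero.2 (hne e ⟨le_rfl, hee'.le⟩))
    have ge' := Dy_abs_ge (hint e' he'D) (sub_ne_zero.2 (hne e' ⟨hee'.le, le_rfl⟩))
    have hcont : ContinuousOn (fun x => f x - x) (Icc e e') :=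
      (f.continuous.sub continuous_id).continuousOn
    -- the displacement is an affine function on the cell
    have hl := hA e ⟨le_rfl, hee'.le⟩ t htc
    have hr := hA t htc e' ⟨hee'.le, le_rfl⟩
    have h3 : 0 ≤ t - e := by linarith
    have h4 : 0 ≤ e' - t := by linarith
    rcases lt_or_ge (f e - e) 0 with he0 | he0
    · rcases lt_or_ge (f e' - e') 0 with he0' | he0'
      · rw [abs_of_neg he0] at ge
        rw [abs_of_neg he0'] at ge'
        rw [abs_sub_comm]
        refine le_trans ?_ (le_abs_self _)
        rcases le_total ((2 : ℝ) ^ n) 1 with h | h <;> nlinarith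
      · obtain ⟨z, hz, hz0⟩ := intermediate_value_Icc hee'.le hcont ⟨he0.le, he0'⟩
        exact absurd (sub_eq_zero.1 hz0) (hne z hz)
    · rcases lt_or_ge (f e' - e') 0 with he0' | he0'
      · obtain ⟨z, hz, hz0⟩ := intermediate_value_Icc' hee'.le hcont ⟨he0'.le, he0⟩
        exact absurd (sub_eq_zero.1 hz0) (hne z hz)
      · rw [abs_of_nonneg he0] at ge
        rw [abs_of_nonneg he0'] at ge'
        refine le_trans ?_ (le_abs_self _)
        rcases le_total ((2 : ℝ) ^ n) 1 with h | h <;> nlinarith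

/-! ### Local slopes -/

/-- Near `t` the function `f` is affine of slope `2 ^ n`. -/
def LAff (f : ℝ → ℝ) (n : ℤ) (t : ℝ) : Prop := ∀ᶠ x in 𝓝 t, f x - f t = 2 ^ n * (x - t)

/-- To the right of `t` the function `f` is affine of slope `2 ^ n`. -/
def RSl (f : ℝ → ℝ) (n : ℤ) (t : ℝ) : Prop := ∀ᶠ x in 𝓝[>] t, f x - f t = 2 ^ n * (x - t)

/-- To the left of `t` the function `f` is affine of slope `2 ^ n`. -/
def LSl (f : ℝ → ℝ) (n : ℤ) (t : ℝ) : Prop := ∀ᶠ x in 𝓝[<] t, f x - f t = 2 ^ n * (x - t)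

theorem lAff_iff {f : ℝ → ℝ} {n : ℤ} {t : ℝ} : LAff f n t ↔ LSl f n t ∧ RSl f n t := by
  unfold LAff LSl RSl
  rw [← nhdsLT_sup_nhdsGE, eventually_sup, ← nhdsGT_sup_nhdsWithin_singleton, eventually_sup]
  simp

theorem AffOn.rSl {f : ℝ → ℝ} {n : ℤ} {a b : ℝ} (h : AffOn f n (Icc a b)) (hab : a < b) :
    RSl f n a := by
  filter_upwards [Ioo_mem_nhdsGT hab] with x hx
  exact h a ⟨le_rfl, hab.le⟩ x ⟨hx.1.le, hx.2.le⟩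

theorem AffOn.lSl {f : ℝ → ℝ} {n : ℤ} {a b : ℝ} (h : AffOn f n (Icc a b)) (hab : a < b) :
    LSl f n b := by
  filter_upwards [Ioo_mem_nhdsLT hab] with x hx
  exact h b ⟨hab.le, le_rfl⟩ x ⟨hx.1.le, hx.2.le⟩

theorem AffOn.lAff {f : ℝ → ℝ} {n : ℤ} {s : Set ℝ} (h : AffOn f n s) {t : ℝ} (ht : s ∈ 𝓝 t) :
    LAff f n t := by
  filter_upwards [ht] with x hx
  exact h t (mem_of_mem_nhds ht) x hx

theorem RSl.exists_affOn {f : ℝ → ℝ} {n : ℤ} {a : ℝ} (h : RSl f n a) {c : ℝ} (hc : a < c) :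
    ∃ z, a < z ∧ z ≤ c ∧ AffOn f n (Icc a z) := by
  obtain ⟨u, hu, hu'⟩ := mem_nhdsGT_iff_exists_Ioc_subset.1 h
  have hu1 : a < u := hu
  refine ⟨min u c, lt_min hu1 hc, min_le_right _ _, ?_⟩
  have key : ∀ x ∈ Icc a (min u c), f x - f a = 2 ^ n * (x - a) := by
    intro x hx
    rcases eq_or_lt_of_le hx.1 with rfl | h1
    · simp
    · exact hu' ⟨h1, hx.2.trans (min_le_left _ _)⟩
  intro x hx y hy
  linear_combination key y hy - key x hx

theorem LSl.exists_affOn {f : ℝ → ℝ} {n : ℤ} {a : ℝ} (h : LSl f n a) {c : ℝ} (hc : c < a) :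
    ∃ z, c ≤ z ∧ z < a ∧ AffOn f n (Icc z a) := by
  obtain ⟨u, hu, hu'⟩ := mem_nhdsLT_iff_exists_Ico_subset.1 h
  have hu1 : u < a := hu
  refine ⟨max u c, le_max_right _ _, max_lt hu1 hc, ?_⟩
  have key : ∀ x ∈ Icc (max u c) a, f x - f a = 2 ^ n * (x - a) := by
    intro x hx
    rcases eq_or_lt_of_le hx.2 with rfl | h1
    · simp
    · exact hu' ⟨(le_max_left _ _).trans hx.1, h1⟩
  intro x hx y hy
  linear_combination key y hy - key x hx

theorem RSl.unique {f : ℝ → ℝ} {n m : ℤ} {a : ℝ} (h : RSl f n a) (h' : RSl f m a) : n = m := by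
  obtain ⟨z, hz, -, hA⟩ := h.exists_affOn (c := a + 1) (by linarith)
  obtain ⟨w, hw, -, hB⟩ := h'.exists_affOn (c := a + 1) (by linarith)
  exact hA.unique_Icc hB (by simp [hz, hw])

theorem LSl.unique {f : ℝ → ℝ} {n m : ℤ} {a : ℝ} (h : LSl f n a) (h' : LSl f m a) : n = m := by
  obtain ⟨z, -, hz, hA⟩ := h.exists_affOn (c := a - 1) (by linarith)
  obtain ⟨w, -, hw, hB⟩ := h'.exists_affOn (c := a - 1) (by linarith)
  exact hA.unique_Icc hB (by simp [hz, hw])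

theorem LAff.unique {f : ℝ → ℝ} {n m : ℤ} {a : ℝ} (h : LAff f n a) (h' : LAff f m a) : n = m :=
  (lAff_iff.1 h).1.unique (lAff_iff.1 h').1

theorem Lev.exists_rSl {N : ℕ} {f : ℝ ≃o ℝ} (hf : Lev N f) (t : ℝ) : ∃ n : ℤ, |n| ≤ N ∧ RSl f n t := by
  obtain ⟨e, he, h1, h2⟩ := exists_Dy_floor N t
  obtain ⟨n, hn, hA⟩ := hf.cell he
  exact ⟨n, hn, (hA.mono (Icc_subset_Icc_left h1)).rSl h2⟩

theorem Lev.exists_lSl {N : ℕ} {f : ℝ ≃o ℝ} (hf : Lev N f) (t : ℝ) : ∃ n : ℤ, |n| ≤ N ∧ LSl f n t := by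
  obtain ⟨e, he, h1, h2⟩ := exists_Dy_ceil N t
  obtain ⟨n, hn, hA⟩ := hf.cell ((Dy N).sub_mem he (one_div_mem_Dy N))
  rw [sub_add_cancel] at hA
  exact ⟨n, hn, (hA.mono (Icc_subset_Icc_right h2)).lSl h1⟩

theorem Lev.exists_lAff {N : ℕ} {f : ℝ ≃o ℝ} (hf : Lev N f) {t : ℝ} (ht : t ∉ Dy N) :
    ∃ n : ℤ, |n| ≤ N ∧ LAff f n t := by
  obtain ⟨e, he, h1, h2⟩ := exists_Dy_floor_of_not_mem ht
  obtain ⟨n, hn, hA⟩ := hf.cell he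
  exact ⟨n, hn, hA.lAff (Icc_mem_nhds h1 h2)⟩

/-- `Fine B g t`: near `t` the homeomorphism `g` is affine with slope exponent in `[-B, B]`, unless
`t` or `g t` is dyadic with denominator at most `2 ^ B`. -/
def Fine (B : ℕ) (g : ℝ ≃o ℝ) (t : ℝ) : Prop :=
  t ∈ Dy B ∨ g t ∈ Dy B ∨ ∃ n : ℤ, |n| ≤ B ∧ LAff g n t

theorem Fine.mono {B C : ℕ} {g : ℝ ≃o ℝ} {t : ℝ} (h : Fine B g t) (hBC : B ≤ C) : Fine C g t := by
  rcases h with h | h | ⟨n, hn, h⟩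
  · exact Or.inl (Dy_mono hBC h)
  · exact Or.inr (Or.inl (Dy_mono hBC h))
  · exact Or.inr (Or.inr ⟨n, hn.trans (by exact_mod_cast hBC), h⟩)

theorem LAff.congr {f g : ℝ → ℝ} {n : ℤ} {t : ℝ} (h : LAff f n t) (hfg : g =ᶠ[𝓝 t] f) :
    LAff g n t := by
  filter_upwards [h, hfg] with x hx hx'
  rw [hx', hfg.self_of_nhds, hx]

theorem Fine.congr {B : ℕ} {f g : ℝ ≃o ℝ} {t : ℝ} (h : Fine B f t) (hfg : ⇑g =ᶠ[𝓝 t] f) :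
    Fine B g t := by
  rcases h with h | h | ⟨n, hn, h⟩
  · exact Or.inl h
  · exact Or.inr (Or.inl (by rwa [hfg.self_of_nhds]))
  · exact Or.inr (Or.inr ⟨n, hn, h.congr hfg⟩)

theorem Lev.fine {B : ℕ} {g : ℝ ≃o ℝ} (hg : Lev B g) (t : ℝ) : Fine B g t := by
  by_cases ht : t ∈ Dy B
  · exact Or.inl ht
  · exact Or.inr (Or.inr (hg.exists_lAff ht))

theorem LAff.inv {g : ℝ ≃o ℝ} {n : ℤ} {t : ℝ} (h : LAff g n t) :
    LAff (g⁻¹ : ℝ ≃o ℝ) (-n) (g t) := by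
  have h1 : Tendsto (g⁻¹ : ℝ ≃o ℝ) (𝓝 (g t)) (𝓝 t) := by
    have := (g⁻¹ : ℝ ≃o ℝ).continuous.tendsto (g t)
    rwa [RelIso.inv_apply_self] at this
  filter_upwards [h1.eventually h] with x hx
  rw [RelIso.apply_inv_self] at hx
  rw [RelIso.inv_apply_self, hx, ← mul_assoc, ← zpow_add₀ two_ne_zero]
  simp

theorem Fine.inv {B : ℕ} {g : ℝ ≃o ℝ} {t : ℝ} (h : Fine B g t) : Fine B g⁻¹ (g t) := by
  rcases h with h | h | ⟨n, hn, h⟩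
  · exact Or.inr (Or.inl (by rwa [RelIso.inv_apply_self]))
  · exact Or.inl h
  · exact Or.inr (Or.inr ⟨-n, by rwa [abs_neg], h.inv⟩)

/-- Every interval contains a point that is not dyadic and has nondyadic image. -/
theorem exists_generic (g : ℝ ≃o ℝ) {a b : ℝ} (hab : a < b) :
    ∃ t ∈ Ioo a b, ∀ N, t ∉ Dy N ∧ g t ∉ Dy N := by
  have hc : (⋃ N, ((Dy N : Set ℝ) ∪ g ⁻¹' (Dy N))).Countable :=
    countable_iUnion fun N => (countable_Dy N).union ((countable_Dy N).preimage g.injective)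
  obtain ⟨t, ht, ht'⟩ := (hc.dense_compl ℝ).exists_between hab
  refine ⟨t, ht', fun N => ⟨fun h => ht ?_, fun h => ht ?_⟩⟩
  · exact mem_iUnion.2 ⟨N, Or.inl h⟩
  · exact mem_iUnion.2 ⟨N, Or.inr h⟩

/-- An affine piece of `g` that contains an interval of `Fine` points has a bounded slope. -/
theorem AffOn.abs_le_of_fine {B : ℕ} {g : ℝ ≃o ℝ} {n : ℤ} {a b : ℝ} (hab : a < b)
    (h : AffOn g n (Icc a b)) (hF : ∀ t ∈ Ioo a b, Fine B g t) : |n| ≤ B := by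
  obtain ⟨t, ht, hgen⟩ := exists_generic g hab
  rcases hF t ht with h' | h' | ⟨m, hm, h'⟩
  · exact absurd h' (hgen B).1
  · exact absurd h' (hgen B).2
  · rwa [(h.lAff (Icc_mem_nhds ht.1 ht.2)).unique h']

theorem LSl.abs_le_of_fine {B : ℕ} {g : ℝ ≃o ℝ} {n : ℤ} {a b : ℝ} (hab : a < b)
    (h : LSl g n b) (hF : ∀ t ∈ Ioo a b, Fine B g t) : |n| ≤ B := by
  obtain ⟨z, hz, hzb, hA⟩ := h.exists_affOn hab
  exact hA.abs_le_of_fine hzb fun t ht => hF t ⟨hz.trans_lt ht.1, ht.2⟩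

/-! ### Pairs of tuples and a conjugator between them -/

/-- `P` is a set of pairs `(u, v)`, closed under inversion, whose members satisfy `Lev E`, and `g` is
a homeomorphism with dyadic breakpoints such that `g⁻¹ * u * g = v` for every pair. -/
structure ConjData (E : ℕ) (P : Set ((ℝ ≃o ℝ) × (ℝ ≃o ℝ))) (g : ℝ ≃o ℝ) : Prop where
  lev1 : ∀ q ∈ P, Lev E q.1
  lev2 : ∀ q ∈ P, Lev E q.2
  inv_pair : ∀ q ∈ P, q⁻¹ ∈ P
  conj : ∀ q ∈ P, ∀ t, q.1 (g t) = g (q.2 t)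
  mem : g ∈ levGroup

/-- `(a, b)` is a component of the complement of the common fixed set of the second members of the
pairs in `P`. -/
structure IsComp (P : Set ((ℝ ≃o ℝ) × (ℝ ≃o ℝ))) (a b : ℝ) : Prop where
  lt : a < b
  fix_left : ∀ q ∈ P, q.2 a = a
  fix_right : ∀ q ∈ P, q.2 b = b
  moves : ∀ t ∈ Ioo a b, ∃ q ∈ P, q.2 t ≠ t

variable {E : ℕ} {P : Set ((ℝ ≃o ℝ) × (ℝ ≃o ℝ))} {g : ℝ ≃o ℝ}

/-- Exchanging the two tuples replaces the conjugator by its inverse. -/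
theorem ConjData.symm (h : ConjData E P g) : ConjData E (Prod.swap ⁻¹' P) g⁻¹ where
  lev1 q hq := h.lev2 _ hq
  lev2 q hq := h.lev1 _ hq
  inv_pair q hq := h.inv_pair _ hq
  conj q hq t := by
    apply g.injective
    have := h.conj _ hq ((g⁻¹ : ℝ ≃o ℝ) t)
    simp only [Prod.fst_swap, Prod.snd_swap, RelIso.apply_inv_self] at this ⊢
    exact this.symm
  mem := inv_mem h.mem

theorem IsComp.symm {a b : ℝ} (hc : IsComp P a b) (h : ConjData E P g) :
    IsComp (Prod.swap ⁻¹' P) (g a) (g b) where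
  lt := g.lt_iff_lt.2 hc.lt
  fix_left q hq := by rw [← Prod.fst_swap, h.conj _ hq, hc.fix_left _ hq]
  fix_right q hq := by rw [← Prod.fst_swap, h.conj _ hq, hc.fix_right _ hq]
  moves t ht := by
    obtain ⟨s, rfl⟩ := g.surjective t
    obtain ⟨q, hq, hqs⟩ := hc.moves s ⟨g.lt_iff_lt.1 ht.1, g.lt_iff_lt.1 ht.2⟩
    refine ⟨q.swap, hq, ?_⟩
    rw [Prod.snd_swap, h.conj q hq]
    exact fun h => hqs (g.injective h)

/-! ### Reflection of the line -/

/-- The conjugate of `f` by the reflection `t ↦ -t`. -/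
def reflect (f : ℝ ≃o ℝ) : ℝ ≃o ℝ where
  toFun t := -f (-t)
  invFun t := -f.symm (-t)
  left_inv t := by simp
  right_inv t := by simp
  map_rel_iff' := by simp

theorem reflect_apply (f : ℝ ≃o ℝ) (t : ℝ) : reflect f t = -f (-t) := rfl

theorem reflect_reflect (f : ℝ ≃o ℝ) : reflect (reflect f) = f := by
  ext t
  simp [reflect_apply]

theorem AffOn.reflect {f : ℝ ≃o ℝ} {n : ℤ} {s : Set ℝ} (h : AffOn f n s) :
    AffOn (reflect f) n {t | -t ∈ s} := by
  intro x hx y hy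
  have := h _ hx _ hy
  rw [reflect_apply, reflect_apply]
  linear_combination -this

theorem Lev.reflect {N : ℕ} {f : ℝ ≃o ℝ} (hf : Lev N f) : Lev N (reflect f) := by
  refine ⟨fun a b hab hD => ?_, fun x hx => (Dy _).neg_mem (hf.2 _ ((Dy _).neg_mem hx))⟩
  obtain ⟨n, hn, hA⟩ := hf.1 (-b) (-a) (by linarith) fun x hx hxN =>
    hD (-x) ⟨by linarith [hx.2], by linarith [hx.1]⟩ ((Dy _).neg_mem hxN)
  refine ⟨n, hn, hA.reflect.mono fun x hx => ?_⟩
  exact ⟨by linarith [hx.2], by linarith [hx.1]⟩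

theorem LAff.reflect {f : ℝ ≃o ℝ} {n : ℤ} {t : ℝ} (h : LAff f n t) :
    LAff (reflect f) n (-t) := by
  have h1 : Tendsto (fun x : ℝ => -x) (𝓝 (-t)) (𝓝 t) := by
    have := (continuous_neg (G := ℝ)).tendsto (-t)
    rwa [neg_neg] at this
  filter_upwards [h1.eventually h] with x hx
  rw [reflect_apply, reflect_apply, neg_neg]
  linear_combination -hx

theorem LSl.reflect {f : ℝ ≃o ℝ} {n : ℤ} {t : ℝ} (h : LSl f n t) :
    RSl (reflect f) n (-t) := by
  obtain ⟨z, -, hz, hA⟩ := h.exists_affOn (c := t - 1) (by linarith)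
  refine (hA.reflect.mono ?_).rSl (b := -z) (by linarith)
  intro x hx
  exact ⟨by linarith [hx.2], by linarith [hx.1]⟩

theorem Fine.reflect {B : ℕ} {f : ℝ ≃o ℝ} {t : ℝ} (h : Fine B f t) :
    Fine B (reflect f) (-t) := by
  rcases h with h | h | ⟨n, hn, h⟩
  · exact Or.inl ((Dy _).neg_mem h)
  · refine Or.inr (Or.inl ?_)
    rw [reflect_apply, neg_neg]
    exact (Dy _).neg_mem h
  · exact Or.inr (Or.inr ⟨n, hn, h.reflect⟩)

/-- The set of pairs whose reflections lie in `P`. -/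
def reflectPairs (P : Set ((ℝ ≃o ℝ) × (ℝ ≃o ℝ))) : Set ((ℝ ≃o ℝ) × (ℝ ≃o ℝ)) :=
  {q | (reflect q.1, reflect q.2) ∈ P}

theorem ConjData.reflect (h : ConjData E P g) : ConjData E (reflectPairs P) (reflect g) where
  lev1 q hq := by simpa [reflect_reflect] using (h.lev1 _ hq).reflect
  lev2 q hq := by simpa [reflect_reflect] using (h.lev2 _ hq).reflect
  inv_pair q hq := h.inv_pair _ hq
  conj q hq t := by
    have := h.conj _ hq (-t)
    simp only [reflect_apply, neg_neg] at this ⊢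
    linarith
  mem := by
    obtain ⟨N, hN⟩ := h.mem
    exact ⟨N, hN.reflect⟩

theorem mem_fix_reflect {t : ℝ} :
    (∀ q ∈ reflectPairs P, q.2 t = t) ↔ ∀ q ∈ P, q.2 (-t) = -t := by
  constructor
  · intro h q hq
    have := h (_root_.reflect q.1, _root_.reflect q.2)
      (by simpa [reflectPairs, reflect_reflect] using hq)
    rw [reflect_apply] at this
    linarith
  · intro h q hq
    have := h _ hq
    simpa [reflect_apply] using this

theorem IsComp.reflect {a b : ℝ} (hc : IsComp P a b) : IsComp (reflectPairs P) (-b) (-a) where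
  lt := neg_lt_neg hc.lt
  fix_left := mem_fix_reflect.2 (by simpa using hc.fix_right)
  fix_right := mem_fix_reflect.2 (by simpa using hc.fix_left)
  moves t ht := by
    obtain ⟨q, hq, h⟩ := hc.moves (-t) ⟨by linarith [ht.2], by linarith [ht.1]⟩
    by_contra! hcon
    exact h (mem_fix_reflect.1 hcon q hq)

/-! ### Conjugators on a component -/

theorem IsComp.hasDen_left {a b : ℝ} (hc : IsComp P a b) (h : ConjData E P g) : HasDen E a := by
  have hT : ∀ f ∈ Prod.snd '' P, Lev E f := by
    rintro _ ⟨q, hq, rfl⟩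
    exact h.lev2 q hq
  refine hasDen_of_notMem_interior hT ?_ ?_
  · rintro _ ⟨q, hq, rfl⟩
    exact hc.fix_left q hq
  · intro hi
    obtain ⟨ε, hε, hball⟩ := Metric.isOpen_iff.1 isOpen_interior a hi
    obtain ⟨t, ht1, ht2⟩ := exists_between (lt_min hc.lt (by linarith : a < a + ε))
    obtain ⟨q, hq, hqt⟩ := hc.moves t ⟨ht1, ht2.trans_le (min_le_left _ _)⟩
    refine hqt (interior_subset (hball ?_) _ ⟨q, hq, rfl⟩)
    rw [Metric.mem_ball, Real.dist_eq, abs_of_pos (by linarith)]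
    linarith [ht2.trans_le (min_le_right _ _)]

theorem HasDen.notMem_Dy_right {L : ℕ} {a : ℝ} (h : HasDen E a) (hL : 2 * E ≤ L) :
    ∀ x ∈ Ioo a (a + 1 / 2 ^ (L + E)), x ∉ Dy L := by
  intro x hx hxD
  have := h.gap hxD hL hx.1.ne'
  rw [abs_of_pos (by linarith [hx.1])] at this
  linarith [hx.2]

theorem HasDen.notMem_Dy_left {L : ℕ} {a : ℝ} (h : HasDen E a) (hL : 2 * E ≤ L) :
    ∀ x ∈ Ioo (a - 1 / 2 ^ (L + E)) a, x ∉ Dy L := by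
  intro x hx hxD
  have := h.gap hxD hL hx.2.ne
  rw [abs_of_neg (by linarith [hx.2])] at this
  linarith [hx.1]

/-- Some pair contracts towards the left end of a component. -/
theorem IsComp.exists_contracting {a b : ℝ} (hc : IsComp P a b) (h : ConjData E P g) {z : ℝ}
    (haz : a < z) (hz : ∀ x ∈ Ioo a z, x ∉ Dy E) :
    ∃ q ∈ P, ∃ m : ℕ, 1 ≤ m ∧ m ≤ E ∧ AffOn q.2 (-m) (Icc a z) := by
  obtain ⟨t, ht1, ht2⟩ := exists_between (lt_min hc.lt haz)
  obtain ⟨q, hq, hqt⟩ := hc.moves t ⟨ht1, ht2.trans_le (min_le_left _ _)⟩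
  obtain ⟨n, hn, hA⟩ := (h.lev2 q hq).1 a z haz hz
  have hfa := hc.fix_left q hq
  have hn0 : n ≠ 0 := by
    rintro rfl
    exact hqt (hA.eq_self ⟨le_rfl, haz.le⟩ hfa ⟨ht1.le, (ht2.trans_le (min_le_right _ _)).le⟩)
  have hn' := abs_le.1 hn
  rcases lt_or_gt_of_ne hn0 with hneg | hpos
  · refine ⟨q, hq, n.natAbs, by omega, by omega, ?_⟩
    rwa [show -(n.natAbs : ℤ) = n by omega]
  · refine ⟨q⁻¹, h.inv_pair q hq, n.natAbs, by omega, by omega, ?_⟩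
    rw [show (n.natAbs : ℤ) = n by omega]
    refine hA.inv fun x hx => ?_
    constructor
    · rw [← q.2.le_iff_le, RelIso.apply_inv_self, hfa]
      exact hx.1
    · rw [← q.2.le_iff_le, RelIso.apply_inv_self]
      have h1 := hA a ⟨le_rfl, haz.le⟩ z ⟨haz.le, le_rfl⟩
      rw [hfa] at h1
      have h2 : (1 : ℝ) ≤ 2 ^ n := one_le_zpow₀ (by norm_num) hpos.le
      nlinarith [hx.2]

/-- If `v` contracts `[a, z]` linearly to `a` and `u` is linear on the image of `[a, z]`, then a
homeomorphism `g` with `u * g = g * v` that is linear to the right of `a` is linear on `[a, z]`: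
the contraction spreads the germ of `g` at `a` over all of `[a, z]`. -/
theorem affOn_of_contracting {u v : ℝ ≃o ℝ} {a z : ℝ} (haz : a < z) {m : ℕ}
    (hm : 1 ≤ m) (hv : AffOn v (-m) (Icc a z)) (hva : v a = a) {k : ℤ}
    (hu : AffOn u k (Icc (g a) (g z))) (huv : ∀ t, u (g t) = g (v t)) {n : ℤ} (hn : RSl g n a) :
    AffOn g n (Icc a z) := by
  obtain ⟨ε, hε, hεz, hA⟩ := hn.exists_affOn haz
  have ha : a ∈ Icc a z := ⟨le_rfl, haz.le⟩
  have hga : g a ∈ Icc (g a) (g z) := ⟨le_rfl, g.le_iff_le.2 haz.le⟩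
  have huga : u (g a) = g a := by rw [huv, hva]
  have hvt : ∀ t ∈ Icc a z, v t - a = 2 ^ (-m : ℤ) * (t - a) := by
    intro t ht
    have := hv a ha t ht
    rwa [hva] at this
  have hlt1 : (2 : ℝ) ^ (-m : ℤ) ≤ 1 / 2 := by
    have : (2 : ℝ) ^ (-m : ℤ) ≤ 2 ^ (-1 : ℤ) := zpow_le_zpow_right₀ (by norm_num) (by omega)
    rw [zpow_neg_one] at this
    linarith
  have hpos : (0 : ℝ) < 2 ^ (-m : ℤ) := by positivity
  have hvI : ∀ t ∈ Icc a z, v t ∈ Icc a z := by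
    intro t ht
    have := hvt t ht
    have h0 : 0 ≤ t - a := sub_nonneg.2 ht.1
    constructor
    · nlinarith
    · nlinarith [ht.2]
  have hut : ∀ t ∈ Icc a z, u (g t) - g a = 2 ^ k * (g t - g a) := by
    intro t ht
    have := hu (g a) hga (g t) ⟨g.le_iff_le.2 ht.1, g.le_iff_le.2 ht.2⟩
    rwa [huga] at this
  -- comparing germs at `a` shows that `u` and `v` have the same slope
  have hk : (2 : ℝ) ^ k = 2 ^ (-m : ℤ) := by
    have hεI : ε ∈ Icc a z := ⟨hε.le, hεz⟩
    have h1 := hut ε hεI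
    have h2 := hA a ⟨le_rfl, hε.le⟩ ε ⟨hε.le, le_rfl⟩
    have hvε := hvt ε hεI
    have h0 : 0 < ε - a := sub_pos.2 hε
    have h3 := hA a ⟨le_rfl, hε.le⟩ (v ε) ⟨(hvI ε hεI).1, by nlinarith⟩
    rw [huv, h3, h2, hvε] at h1
    have h4 : (2 : ℝ) ^ n * (ε - a) ≠ 0 := by positivity
    apply mul_right_cancel₀ h4
    linear_combination -h1
  have key : ∀ j : ℕ, ∀ t ∈ Icc a z, (2 : ℝ)⁻¹ ^ j * (t - a) ≤ ε - a → g t - g a = 2 ^ n * (t - a) := by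
    intro j
    induction j with
    | zero =>
      intro t ht h
      rw [pow_zero, one_mul] at h
      exact hA a ⟨le_rfl, hε.le⟩ t ⟨ht.1, by linarith⟩
    | succ j ih =>
      intro t ht h
      have h0 : 0 ≤ t - a := sub_nonneg.2 ht.1
      have h1 : v t - a ≤ 2⁻¹ * (t - a) := by
        rw [hvt t ht]
        nlinarith
      have h2 := ih (v t) (hvI t ht) (by
        refine le_trans ?_ h
        rw [pow_succ, mul_assoc]
        exact mul_le_mul_of_nonneg_left h1 (by positivity))
      rw [← huv, hut t ht, hk, hvt t ht] at h2
      apply mul_left_cancel₀ hpos.ne'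
      rw [h2]
      ring
  have hall : ∀ t ∈ Icc a z, g t - g a = 2 ^ n * (t - a) := by
    intro t ht
    obtain ⟨j, hj⟩ := exists_pow_lt_of_lt_one (y := (2 : ℝ)⁻¹) (x := (ε - a) / (t - a + 1))
      (by have := ht.1; apply div_pos <;> linarith) (by norm_num)
    refine key j t ht ?_
    rw [lt_div_iff₀ (by linarith [ht.1])] at hj
    have : (0 : ℝ) < 2⁻¹ ^ j := by positivity
    nlinarith [ht.1]
  intro x hx y hy
  linear_combination hall y hy - hall x hx

/-- At the left end of a component, the conjugator is affine as far as neither `2 ^ (-E) ℤ` nor its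
preimage under `g` is met. -/
theorem IsComp.affOn_left {a b : ℝ} (hc : IsComp P a b) (h : ConjData E P g) {z : ℝ}
    (haz : a < z) (hz : ∀ x ∈ Ioo a z, x ∉ Dy E) (hgz : ∀ x ∈ Ioo (g a) (g z), x ∉ Dy E) {n : ℤ}
    (hn : RSl g n a) : AffOn g n (Icc a z) := by
  obtain ⟨q, hq, m, hm, -, hA⟩ := hc.exists_contracting h haz hz
  obtain ⟨k, -, hB⟩ := (h.lev1 q hq).1 (g a) (g z) (g.lt_iff_lt.2 haz) hgz
  exact affOn_of_contracting haz hm hA (hc.fix_left q hq) hB (h.conj q hq) hn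

theorem IsComp.affOn_right {a b : ℝ} (hc : IsComp P a b) (h : ConjData E P g) {z : ℝ}
    (hzb : z < b) (hz : ∀ x ∈ Ioo z b, x ∉ Dy E) (hgz : ∀ x ∈ Ioo (g z) (g b), x ∉ Dy E) {n : ℤ}
    (hn : LSl g n b) : AffOn g n (Icc z b) := by
  have := hc.reflect.affOn_left h.reflect (z := -z) (by linarith) (fun x hx hxE =>
    hz (-x) ⟨by linarith [hx.2], by linarith [hx.1]⟩ ((Dy E).neg_mem hxE)) (fun x hx hxE => by
      simp only [reflect_apply, neg_neg] at hx
      exact hgz (-x) ⟨by linarith [hx.2], by linarith [hx.1]⟩ ((Dy E).neg_mem hxE)) hn.reflect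
  have h2 := this.reflect
  rw [reflect_reflect] at h2
  exact h2.mono fun x hx => ⟨by linarith [hx.2], by linarith [hx.1]⟩

/-- Passing from `v t` to `t` increases the bound in `Fine` by a bounded amount. -/
theorem ConjData.fine_of_apply (h : ConjData E P g) {B : ℕ} (hB : 2 * E ≤ B)
    {q : (ℝ ≃o ℝ) × (ℝ ≃o ℝ)} (hq : q ∈ P) {t : ℝ} (ht : Fine B g (q.2 t)) :
    Fine (B + 2 * E) g t := by
  rcases ht with ht | ht | ⟨n, hn, ht⟩
  · exact Or.inl (Dy_mono (by omega) ((h.lev2 q hq).mem_of_image hB ht))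
  · rw [← h.conj q hq] at ht
    exact Or.inr (Or.inl (Dy_mono (by omega) ((h.lev1 q hq).mem_of_image hB ht)))
  by_cases htE : t ∈ Dy E
  · exact Or.inl (Dy_mono (by omega) htE)
  by_cases hgE : g t ∈ Dy E
  · exact Or.inr (Or.inl (Dy_mono (by omega) hgE))
  obtain ⟨k, hk, hkt⟩ := (h.lev2 q hq).exists_lAff htE
  obtain ⟨l, hl, hlt⟩ := (h.lev1 q hq).exists_lAff hgE
  refine Or.inr (Or.inr ⟨-l + n + k, ?_, ?_⟩)
  · have h1 := abs_add_three (-l) n k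
    rw [abs_neg] at h1
    push_cast
    linarith
  · filter_upwards [hkt, (q.2.continuous.tendsto t).eventually ht,
      (g.continuous.tendsto t).eventually hlt] with x h1 h2 h3
    rw [h.conj q hq, h.conj q hq, h2, h1] at h3
    rw [zpow_add₀ two_ne_zero, zpow_add₀ two_ne_zero, zpow_neg]
    have : (2 : ℝ) ^ l ≠ 0 := by positivity
    field_simp
    linear_combination -h3

/-- A point of a component away from its right end is moved to the left by a definite amount. -/
theorem IsComp.exists_left_step {a b : ℝ} (hc : IsComp P a b) (h : ConjData E P g) {A : ℕ}
    (hA : 4 * E + 1 ≤ A) {t : ℝ} (hat : a + 1 / 2 ^ A ≤ t) (htb : t ≤ b - 1 / 2 ^ A) :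
    ∃ q ∈ P, q.2 t ≤ t - 1 / 2 ^ (A + E + 1) := by
  have hT : ∀ f ∈ Prod.snd '' P, Lev E f := by
    rintro _ ⟨q, hq, rfl⟩
    exact h.lev2 q hq
  have hAp : (0 : ℝ) < 1 / 2 ^ A := by positivity
  have hstep : ∃ q ∈ P, 1 / 2 ^ (A + 1) ≤ |q.2 t - t| := by
    rcases exists_displacement hT t with ⟨_, ⟨q, hq, rfl⟩, h1⟩ | ⟨z, hz, h1⟩
    · exact ⟨q, hq, le_trans (one_div_le_one_div_of_le (by positivity)
        (pow_le_pow_right₀ (by norm_num) (by omega))) h1⟩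
    · have hzc : z ≤ a ∨ b ≤ z := by
        by_contra! hcon
        obtain ⟨q, hq, hqz⟩ := hc.moves z hcon
        exact hqz (hz _ ⟨q, hq, rfl⟩)
      have habs : 1 / 2 ^ A ≤ |t - z| := by
        rcases hzc with hza | hzb
        · exact le_trans (by linarith) (le_abs_self _)
        · rw [abs_sub_comm]
          exact le_trans (by linarith) (le_abs_self _)
      rcases h1 with rfl | ⟨_, ⟨q, hq, rfl⟩, h1⟩
      · rw [sub_self, abs_zero] at habs
        linarith
      · refine ⟨q, hq, le_trans ?_ h1⟩
        rw [pow_succ, ← div_div]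
        linarith
  obtain ⟨q, hq, hqt⟩ := hstep
  have h2E : (1 : ℝ) ≤ 2 ^ E := one_le_pow₀ (by norm_num)
  have hsplit : (1 : ℝ) / 2 ^ (A + 1) = 2 ^ E * (1 / 2 ^ (A + E + 1)) := by
    rw [show A + E + 1 = E + (A + 1) by omega, pow_add _ E]
    field_simp
  have hη : (0 : ℝ) < 1 / 2 ^ (A + E + 1) := by positivity
  rcases le_total (q.2 t) t with hle | hle
  · refine ⟨q, hq, ?_⟩
    rw [abs_of_nonpos (by linarith), hsplit] at hqt
    nlinarith
  · refine ⟨q⁻¹, h.inv_pair q hq, ?_⟩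
    rw [abs_of_nonneg (by linarith), hsplit] at hqt
    have hle' : (q.2⁻¹ : ℝ ≃o ℝ) t ≤ t := by
      rw [← q.2.le_iff_le, RelIso.apply_inv_self]
      exact hle
    have h1 := (h.lev2 q hq).sub_le hle'
    rw [RelIso.apply_inv_self] at h1
    have h2 := le_of_mul_le_mul_left (hqt.trans h1) (by positivity)
    change (q.2⁻¹ : ℝ ≃o ℝ) t ≤ _
    linarith

/-- The bound on a conjugator on a component in terms of its slope exponent `S` at an end of the
component. The power of two is the number of steps of length `2 ^ (-(A + E + 1))`, where
`A = 4 * E + 1 + S`, that cross an interval of length one, and each step costs `2 * E`. -/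
def compBound (E S : ℕ) : ℕ := S + 2 * E + 2 * E * 2 ^ (4 * E + 1 + S + E + 1)

/-- The bound on a component away from its right end: the points are moved to the left in steps of
definite length until they reach the interval on which the conjugator is affine. -/
theorem IsComp.fine_of_le {a b : ℝ} (hc : IsComp P a b) (h : ConjData E P g) (hab : b ≤ a + 1)
    {S : ℕ} {n : ℤ} (hn : RSl g n a) (hnS : |n| ≤ S) {t : ℝ} (hat : a < t)
    (htb : t ≤ b - 1 / 2 ^ (4 * E + 1 + S)) : Fine (compBound E S) g t := by
  set A := 4 * E + 1 + S with hA
  have hαβ : (1 : ℝ) / 2 ^ A * 2 ^ S < 1 / 2 ^ (2 * E + E) := by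
    rw [hA, pow_add _ _ S, div_mul_eq_mul_div, one_mul, mul_comm (2 ^ (4 * E + 1)),
      div_mul_cancel_left₀ (by positivity), inv_eq_one_div]
    exact one_div_lt_one_div_of_lt (by positivity) (pow_lt_pow_right₀ (by norm_num) (by omega))
  have hα : (0 : ℝ) < 1 / 2 ^ A := by positivity
  have h1S : (1 : ℝ) ≤ 2 ^ S := one_le_pow₀ (by norm_num)
  -- the conjugator is linear on `[a, z]`, which contains all points at distance `2 ^ (-A)` from
  -- `a`, because the slope at `a` is at most `2 ^ S`
  set z := min (a + 1 / 2 ^ (2 * E + E)) ((g⁻¹ : ℝ ≃o ℝ) (g a + 1 / 2 ^ (2 * E + E))) with hz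
  have hβ : (0 : ℝ) < 1 / 2 ^ (2 * E + E) := by positivity
  have hz2 : g z ≤ g a + 1 / 2 ^ (2 * E + E) := by
    have := g.le_iff_le.2 (min_le_right (a + 1 / 2 ^ (2 * E + E))
      ((g⁻¹ : ℝ ≃o ℝ) (g a + 1 / 2 ^ (2 * E + E))))
    rwa [RelIso.apply_inv_self] at this
  have haz : a < z := by
    refine lt_min (by linarith) ?_
    rw [← g.lt_iff_lt, RelIso.apply_inv_self]
    linarith
  have hzA : AffOn g n (Icc a z) := by
    refine hc.affOn_left h haz (fun x hx hxE => ?_) (fun x hx hxE => ?_) hn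
    · exact (hc.hasDen_left h).notMem_Dy_right le_rfl x ⟨hx.1, hx.2.trans_le (min_le_left _ _)⟩
        (Dy_mono (by omega) hxE)
    · exact ((hc.symm h).hasDen_left h.symm).notMem_Dy_right le_rfl x
        ⟨hx.1, hx.2.trans_le hz2⟩ (Dy_mono (by omega) hxE)
  have haz' : a + 1 / 2 ^ A < z := by
    by_contra! hcon
    have hzeq : z = (g⁻¹ : ℝ ≃o ℝ) (g a + 1 / 2 ^ (2 * E + E)) := by
      refine (min_choice _ _).resolve_left fun h' => ?_
      have h3 : z = a + 1 / 2 ^ (2 * E + E) := h'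
      nlinarith
    have h3 := hzA a ⟨le_rfl, haz.le⟩ z ⟨haz.le, le_rfl⟩
    rw [hzeq, RelIso.apply_inv_self, ← hzeq] at h3
    have h4 : (2 : ℝ) ^ n ≤ 2 ^ S := by
      rw [← zpow_natCast]
      exact zpow_le_zpow_right₀ (by norm_num) (abs_le.1 hnS).2
    have h5 : (2 : ℝ) ^ n * (z - a) ≤ 2 ^ S * (1 / 2 ^ A) :=
      mul_le_mul h4 (by linarith) (by linarith) (by positivity)
    linarith
  -- induction on the number of steps
  have key : ∀ j : ℕ, ∀ t, a < t → t ≤ b - 1 / 2 ^ A →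
      t < a + 1 / 2 ^ A + j * (1 / 2 ^ (A + E + 1)) → Fine (S + 2 * E + 2 * E * j) g t := by
    intro j
    induction j with
    | zero =>
      intro t ht _ ht2
      simp only [Nat.cast_zero, zero_mul, add_zero] at ht2
      refine Or.inr (Or.inr ⟨n, hnS.trans (by push_cast; linarith),
        hzA.lAff (Icc_mem_nhds ht (ht2.trans haz'))⟩)
    | succ j ih =>
      intro t ht htb ht2
      rcases lt_or_ge t (a + 1 / 2 ^ A) with hlt | hge
      · have h0 : (0 : ℝ) ≤ j * (1 / 2 ^ (A + E + 1)) := by positivity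
        exact (ih t ht htb (by linarith)).mono (by
          have : 2 * E * j ≤ 2 * E * (j + 1) := Nat.mul_le_mul_left _ (by omega)
          omega)
      · obtain ⟨q, hq, hqt⟩ := hc.exists_left_step h (by omega) hge htb
        have h0 : (0 : ℝ) < 1 / 2 ^ (A + E + 1) := by positivity
        push_cast at ht2
        have hqa : a < q.2 t := by
          have := q.2.lt_iff_lt.2 ht
          rwa [hc.fix_left q hq] at this
        have := ih (q.2 t) hqa (by linarith) (by linarith)
        have h4 := h.fine_of_apply (by rw [add_assoc]; exact le_add_left (Nat.le_add_right _ _)) hq this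
        exact h4.mono (by rw [Nat.mul_succ]; omega)
  have := key (2 ^ (A + E + 1)) t hat htb (by
    have h3 : ((2 ^ (A + E + 1) : ℕ) : ℝ) * (1 / 2 ^ (A + E + 1)) = 1 := by
      push_cast
      field_simp
    rw [h3]
    linarith)
  exact this

theorem fine_of_fine_inv {B : ℕ} {t : ℝ} (h : Fine B g⁻¹ (g t)) : Fine B g t := by
  have := h.inv
  rwa [inv_inv, RelIso.inv_apply_self] at this

theorem RSl.inv {n : ℤ} {t : ℝ} (h : RSl g n t) : RSl (g⁻¹ : ℝ ≃o ℝ) (-n) (g t) := by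
  obtain ⟨z, hz, -, hA⟩ := h.exists_affOn (c := t + 1) (by linarith)
  have : AffOn (g⁻¹ : ℝ ≃o ℝ) (-n) (Icc (g t) (g z)) := by
    refine hA.inv fun x hx => ?_
    constructor
    · rw [← g.le_iff_le, RelIso.apply_inv_self]; exact hx.1
    · rw [← g.le_iff_le, RelIso.apply_inv_self]; exact hx.2
  exact this.rSl (g.lt_iff_lt.2 hz)

theorem exists_lSl (hg : g ∈ levGroup) (t : ℝ) : ∃ n, LSl g n t := by
  obtain ⟨N, hN⟩ := hg
  obtain ⟨n, -, h⟩ := hN.exists_lSl t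
  exact ⟨n, h⟩

theorem exists_rSl (hg : g ∈ levGroup) (t : ℝ) : ∃ n, RSl g n t := by
  obtain ⟨N, hN⟩ := hg
  obtain ⟨n, -, h⟩ := hN.exists_rSl t
  exact ⟨n, h⟩

/-- On a component, a conjugator is controlled by its slope at the left end. Points `t` such that `t`
or `g t` is not too close to the right end are covered by `IsComp.fine_of_le` for `g` or `g⁻¹`; on the
remaining interval the conjugator is affine. -/
theorem IsComp.fine {a b : ℝ} (hc : IsComp P a b) (h : ConjData E P g) (hab : b ≤ a + 1)
    (hgab : g b ≤ g a + 1) {S : ℕ} {n : ℤ} (hn : RSl g n a) (hnS : |n| ≤ S) :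
    ∀ t ∈ Ioo a b, Fine (compBound E S) g t := by
  set α : ℝ := 1 / 2 ^ (4 * E + 1 + S) with hα
  have hy : ∀ t ∈ Ioo a b, t ≤ b - α → Fine (compBound E S) g t := fun t ht ht' =>
    hc.fine_of_le h hab hn hnS ht.1 ht'
  have hx : ∀ t ∈ Ioo a b, g t ≤ g b - α → Fine (compBound E S) g t := fun t ht ht' =>
    fine_of_fine_inv ((hc.symm h).fine_of_le h.symm hgab hn.inv
      (by rwa [abs_neg]) (g.lt_iff_lt.2 ht.1) ht')
  obtain ⟨k, hk⟩ := exists_lSl h.mem b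
  set β : ℝ := 1 / 2 ^ (2 * E + E) with hβ
  have hβ0 : 0 < β := by positivity
  have hα0 : 0 < α := by positivity
  have hαβ : α < β :=
    one_div_lt_one_div_of_lt (by positivity) (pow_lt_pow_right₀ (by norm_num) (by omega))
  set z := max (b - β) ((g⁻¹ : ℝ ≃o ℝ) (g b - β)) with hz
  have hzb : z < b := by
    refine max_lt (by linarith) ?_
    rw [← g.lt_iff_lt, RelIso.apply_inv_self]
    linarith
  have hgz : g b - β ≤ g z := by
    have := g.le_iff_le.2 (le_max_right (b - β) ((g⁻¹ : ℝ ≃o ℝ) (g b - β)))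
    rwa [RelIso.apply_inv_self] at this
  -- near the right end of the component the conjugator is linear as well
  have hb : HasDen E b := by
    have := hc.reflect.hasDen_left h.reflect
    obtain ⟨l, h1, h2, h3, h4⟩ := this
    exact ⟨l, h1, h2, h3, by simpa using (Dy (2 * E)).neg_mem h4⟩
  have hgb : HasDen E (g b) := by
    have := (hc.symm h).reflect.hasDen_left h.symm.reflect
    obtain ⟨l, h1, h2, h3, h4⟩ := this
    exact ⟨l, h1, h2, h3, by simpa using (Dy (2 * E)).neg_mem h4⟩
  have hA : AffOn g k (Icc z b) := by
    refine hc.affOn_right h hzb (fun x hx hxE => ?_) (fun x hx hxE => ?_) hk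
    · exact hb.notMem_Dy_left le_rfl x ⟨(le_max_left _ _).trans_lt hx.1, hx.2⟩
        (Dy_mono (by omega) hxE)
    · exact hgb.notMem_Dy_left le_rfl x ⟨hgz.trans_lt hx.1, hx.2⟩ (Dy_mono (by omega) hxE)
  -- this linear piece overlaps with the part that has been controlled already
  have hzz : max z a < max (b - α) ((g⁻¹ : ℝ ≃o ℝ) (g b - α)) ∨ z < a := by
    by_cases hza : z < a
    · exact Or.inr hza
    refine Or.inl ?_
    rw [max_eq_left (not_lt.1 hza)]
    refine max_lt_max (by linarith) ?_
    exact (g⁻¹ : ℝ ≃o ℝ).lt_iff_lt.2 (by linarith)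
  have hub : max (b - α) ((g⁻¹ : ℝ ≃o ℝ) (g b - α)) < b := by
    refine max_lt (by linarith) ?_
    rw [← g.lt_iff_lt, RelIso.apply_inv_self]
    linarith
  have hkS : |k| ≤ compBound E S := by
    rcases hzz with hzz | hzz
    · refine (hA.mono (Icc_subset_Icc (le_max_left z a) hub.le)).abs_le_of_fine hzz fun t ht => ?_
      have htI : t ∈ Ioo a b := ⟨(le_max_right _ _).trans_lt ht.1, ht.2.trans hub⟩
      rcases lt_max_iff.1 ht.2 with ht' | ht'
      · exact hy t htI ht'.le
      · refine hx t htI ?_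
        rw [← g.lt_iff_lt, RelIso.apply_inv_self] at ht'
        exact ht'.le
    · have : k = n := (hA.mono (Icc_subset_Icc_left hzz.le)).rSl hc.lt |>.unique hn
      rw [this]
      refine hnS.trans ?_
      unfold compBound
      push_cast
      have : (0 : ℤ) ≤ 2 * E * 2 ^ (4 * E + 1 + S + E + 1) := by positivity
      omega
  intro t ht
  by_cases h1 : t ≤ b - α
  · exact hy t ht h1
  by_cases h2 : g t ≤ g b - α
  · exact hx t ht h2
  push Not at h1 h2
  refine Or.inr (Or.inr ⟨k, hkS, hA.lAff (Icc_mem_nhds (max_lt (by linarith) ?_) ht.2)⟩)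
  rw [← g.lt_iff_lt, RelIso.apply_inv_self]
  linarith

/-! ### Conjugators with a large slope force commutativity -/

/-- If the slope of a conjugator at an end of a component exceeds this bound in absolute value, then
the homeomorphisms commute on the component. Here `2 ^ (41 * E + 2)` is the number of steps that
certain points of the image component, moved by at least `2 ^ (-(41 * E + 2))` in each step, need to
cross it, and each step costs at most `E` in the exponent of the slope. -/
def rigidBound (E : ℕ) : ℕ := E * 2 ^ (41 * E + 2)

/-- The commutator of two pairs. -/
def pairCommutator (q₁ q₂ : (ℝ ≃o ℝ) × (ℝ ≃o ℝ)) : (ℝ ≃o ℝ) × (ℝ ≃o ℝ) :=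
  q₁⁻¹ * (q₂⁻¹ * (q₁ * q₂))

theorem pairCommutator_snd_apply (q₁ q₂ : (ℝ ≃o ℝ) × (ℝ ≃o ℝ)) (t : ℝ) :
    (pairCommutator q₁ q₂).2 t = t ↔ q₁.2 (q₂.2 t) = q₂.2 (q₁.2 t) := by
  change (q₁.2⁻¹ : ℝ ≃o ℝ) ((q₂.2⁻¹ : ℝ ≃o ℝ) (q₁.2 (q₂.2 t))) = t ↔ _
  rw [← q₁.2.injective.eq_iff, RelIso.apply_inv_self, ← q₂.2.injective.eq_iff,
    RelIso.apply_inv_self]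

theorem pairCommutator_fst_apply (q₁ q₂ : (ℝ ≃o ℝ) × (ℝ ≃o ℝ)) (t : ℝ) :
    (pairCommutator q₁ q₂).1 t = t ↔ q₁.1 (q₂.1 t) = q₂.1 (q₁.1 t) :=
  pairCommutator_snd_apply q₁.swap q₂.swap t

theorem ConjData.lev_commutator (h : ConjData E P g) {q₁ q₂ : (ℝ ≃o ℝ) × (ℝ ≃o ℝ)} (h₁ : q₁ ∈ P)
    (h₂ : q₂ ∈ P) : Lev (40 * E) (pairCommutator q₁ q₂).2 := by
  have := (h.lev2 _ (h.inv_pair _ h₁)).mul ((h.lev2 _ (h.inv_pair _ h₂)).mul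
    ((h.lev2 _ h₁).mul (h.lev2 _ h₂)))
  exact this.mono (by omega)

theorem ConjData.conj_commutator (h : ConjData E P g) {q₁ q₂ : (ℝ ≃o ℝ) × (ℝ ≃o ℝ)} (h₁ : q₁ ∈ P)
    (h₂ : q₂ ∈ P) (t : ℝ) : (pairCommutator q₁ q₂).1 (g t) = g ((pairCommutator q₁ q₂).2 t) := by
  change (q₁⁻¹).1 ((q₂⁻¹).1 (q₁.1 (q₂.1 (g t)))) = g ((q₁⁻¹).2 ((q₂⁻¹).2 (q₁.2 (q₂.2 t))))
  rw [h.conj _ h₂, h.conj _ h₁, h.conj _ (h.inv_pair _ h₂), h.conj _ (h.inv_pair _ h₁)]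

/-- Germs of linear maps commute, so commutators are trivial near the left end of a component. -/
theorem IsComp.commutator_eq_near {a b : ℝ} (hc : IsComp P a b) (h : ConjData E P g)
    {q₁ q₂ : (ℝ ≃o ℝ) × (ℝ ≃o ℝ)} (h₁ : q₁ ∈ P) (h₂ : q₂ ∈ P) :
    ∀ t ∈ Icc a (a + 1 / 2 ^ (40 * E + E)), (pairCommutator q₁ q₂).2 t = t := by
  set δ : ℝ := 1 / 2 ^ (40 * E + E) with hδ
  have hδ0 : 0 < δ := by positivity
  have hav := (hc.hasDen_left h).notMem_Dy_right (L := 40 * E) (by omega)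
  have havE : ∀ x ∈ Ioo a (a + δ), x ∉ Dy E := fun x hx hxE => hav x hx (Dy_mono (by omega) hxE)
  obtain ⟨n₁, hn₁, hA₁⟩ := (h.lev2 _ h₁).1 a (a + δ) (by linarith) havE
  obtain ⟨n₂, hn₂, hA₂⟩ := (h.lev2 _ h₂).1 a (a + δ) (by linarith) havE
  obtain ⟨n, -, hA⟩ := (h.lev_commutator h₁ h₂).1 a (a + δ) (by linarith) hav
  have ha : a ∈ Icc a (a + δ) := ⟨le_rfl, by linarith⟩
  have hfa₁ := hc.fix_left _ h₁
  have hfa₂ := hc.fix_left _ h₂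
  have hle : ∀ k : ℤ, |k| ≤ E → (2 : ℝ) ^ k ≤ 2 ^ E := fun k hk => by
    rw [← zpow_natCast]
    exact zpow_le_zpow_right₀ (by norm_num) (abs_le.1 hk).2
  have h1E : (1 : ℝ) ≤ 2 ^ E := one_le_pow₀ (by norm_num)
  -- a point so close to `a` that its images stay in the linear region
  set s := a + δ / 2 ^ E with hs
  have hs0 : 0 < δ / 2 ^ E := by positivity
  have hsδ : δ / 2 ^ E ≤ δ := div_le_self hδ0.le h1E
  have hsI : s ∈ Icc a (a + δ) := ⟨by linarith, by linarith⟩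
  have him : ∀ k : ℤ, |k| ≤ E → a + 2 ^ k * (s - a) ∈ Icc a (a + δ) := by
    intro k hk
    have h0 : (0 : ℝ) < 2 ^ k := by positivity
    have h3 : s - a = δ / 2 ^ E := by rw [hs]; ring
    have h4 : (2 : ℝ) ^ E * (δ / 2 ^ E) = δ := by field_simp
    rw [h3]
    constructor
    · have := mul_pos h0 hs0
      linarith
    · have := mul_le_mul_of_nonneg_right (hle k hk) hs0.le
      linarith
  have e₁ : q₁.2 s = a + 2 ^ n₁ * (s - a) := by
    have := hA₁ a ha s hsI
    rw [hfa₁] at this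
    linarith
  have e₂ : q₂.2 s = a + 2 ^ n₂ * (s - a) := by
    have := hA₂ a ha s hsI
    rw [hfa₂] at this
    linarith
  have e₁₂ := hA₁ a ha _ (him n₂ hn₂)
  have e₂₁ := hA₂ a ha _ (him n₁ hn₁)
  rw [hfa₁, ← e₂] at e₁₂
  rw [hfa₂, ← e₁] at e₂₁
  have hfs : (pairCommutator q₁ q₂).2 s = s := by
    rw [pairCommutator_snd_apply]
    rw [e₂] at e₁₂ ⊢
    rw [e₁] at e₂₁ ⊢
    linear_combination e₁₂ - e₂₁
  have hfa : (pairCommutator q₁ q₂).2 a = a := by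
    rw [pairCommutator_snd_apply, hfa₁, hfa₂, hfa₁]
  have hn0 := hA.eq_zero_of_fixed ha hsI hfa hfs (by rw [hs]; linarith)
  subst hn0
  exact fun t ht => hA.eq_self ha hfa ht

/-- If a conjugator `g` stretches a lot at the left end of a component, then the homeomorphisms
commute on the component: `g` transports the small interval on which all commutators are trivial to
an interval that nearly reaches the first fixed point `r` of some contracting `u`. The commutators
are then trivial up to `r`, which makes `r` a common fixed point. -/
theorem IsComp.commute_of_slope_gt {a b : ℝ} (hc : IsComp P a b) (h : ConjData E P g)
    (hgab : g b ≤ g a + 1) {n : ℤ} (hn : RSl g n a) (hbig : (rigidBound E : ℤ) < n) :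
    ∀ q₁ ∈ P, ∀ q₂ ∈ P, ∀ t ∈ Icc a b, q₁.2 (q₂.2 t) = q₂.2 (q₁.2 t) := by
  have hcx := hc.symm h
  set δ : ℝ := 1 / 2 ^ (40 * E + E) with hδ
  have hδ0 : 0 < δ := by positivity
  have hn0 : 0 ≤ n := by
    have : (0 : ℤ) ≤ rigidBound E := by positivity
    omega
  have hav : ∀ x ∈ Ioo a (a + δ), x ∉ Dy E := fun x hx hxE =>
    (hc.hasDen_left h).notMem_Dy_right (L := 40 * E) (by omega) x hx (Dy_mono (by omega) hxE)
  have hgav : ∀ x ∈ Ioo (g a) (g a + δ), x ∉ Dy E := fun x hx hxE =>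
    (hcx.hasDen_left h.symm).notMem_Dy_right (L := 40 * E) (by omega) x hx
      (Dy_mono (by omega) hxE)
  obtain ⟨q, hq, m, hm1, hmE, hv⟩ := hc.exists_contracting h (by linarith : a < a + δ) hav
  have hva := hc.fix_left q hq
  have ha : a ∈ Icc a (a + δ) := ⟨le_rfl, by linarith⟩
  -- `g` is linear on `[a, z]`, and `g z` is at distance `δ` from `g a`
  obtain ⟨z, hgz⟩ := g.surjective (g a + δ)
  have haz : a < z := by rw [← g.lt_iff_lt, hgz]; linarith
  have hgA : AffOn g n (Icc a (min z (a + δ))) := by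
    refine hc.affOn_left h (lt_min haz (by linarith)) (fun x hx => hav x ⟨hx.1, ?_⟩)
      (fun x hx => hgav x ⟨hx.1, ?_⟩) hn
    · exact hx.2.trans_le (min_le_right _ _)
    · rw [← hgz]
      exact hx.2.trans_le (g.le_iff_le.2 (min_le_left _ _))
  have hzδ : z ≤ a + δ := by
    by_contra! hcon
    rw [min_eq_right hcon.le] at hgA
    have h1 := hgA a ha (a + δ) ⟨by linarith, le_rfl⟩
    have h2 : (1 : ℝ) ≤ 2 ^ n := one_le_zpow₀ (by norm_num) hn0
    have h3 := g.lt_iff_lt.2 hcon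
    rw [hgz] at h3
    nlinarith
  rw [min_eq_left hzδ] at hgA
  have hzeq : δ = 2 ^ n * (z - a) := by
    have := hgA a ⟨le_rfl, haz.le⟩ z ⟨haz.le, le_rfl⟩
    rw [hgz] at this
    linarith
  -- the first fixed point `r` of `u = q.1`
  have hvlt : ∀ t ∈ Ioc a (a + δ), q.2 t < t := by
    intro t ht
    have h1 := hv a ha t ⟨ht.1.le, ht.2⟩
    have h2 : (2 : ℝ) ^ (-m : ℤ) ≤ 2 ^ (-1 : ℤ) := zpow_le_zpow_right₀ (by norm_num) (by omega)
    rw [hva] at h1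
    rw [zpow_neg_one] at h2
    nlinarith [ht.1]
  have hult : ∀ s ∈ Ioc (g a) (g (a + δ)), q.1 s < s := by
    intro s hs
    obtain ⟨t, rfl⟩ := g.surjective s
    rw [h.conj q hq]
    exact g.lt_iff_lt.2 (hvlt t ⟨g.lt_iff_lt.1 hs.1, g.le_iff_le.1 hs.2⟩)
  have hδc : g a + δ ≤ g (a + δ) := by rw [← hgz]; exact g.le_iff_le.2 hzδ
  have hFcl : IsClosed {s | g a + δ ≤ s ∧ q.1 s = s} :=
    (isClosed_le continuous_const continuous_id).inter
      (isClosed_eq q.1.continuous continuous_id)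
  have hgb : q.1 (g b) = g b := by rw [h.conj q hq, hc.fix_right q hq]
  have hFb : g b ∈ {s | g a + δ ≤ s ∧ q.1 s = s} := by
    refine ⟨?_, hgb⟩
    by_contra! hcon
    exact (hult (g b) ⟨g.lt_iff_lt.2 hc.lt, hcon.le.trans hδc⟩).ne hgb
  have hFbdd : BddBelow {s | g a + δ ≤ s ∧ q.1 s = s} := ⟨g a + δ, fun s hs => hs.1⟩
  obtain ⟨r, hr⟩ : ∃ r, r = sInf {s | g a + δ ≤ s ∧ q.1 s = s} := ⟨_, rfl⟩
  have hrF := hFcl.csInf_mem ⟨_, hFb⟩ hFbdd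
  rw [← hr] at hrF
  obtain ⟨hr1, hr2⟩ := hrF
  have hrb : r ≤ g b := by rw [hr]; exact csInf_le hFbdd hFb
  have hrfirst : ∀ s ∈ Ioo (g a) r, q.1 s ≠ s := by
    intro s hs hqs
    rcases lt_or_ge s (g a + δ) with h1 | h1
    · exact (hult s ⟨hs.1, h1.le.trans hδc⟩).ne hqs
    · exact absurd (csInf_le hFbdd ⟨h1, hqs⟩) (by rw [← hr]; exact not_le.2 hs.2)
  -- the interval with trivial commutators is stretched until it nearly reaches `r`
  have hreach : r - δ / 2 ≤ g (a + δ) := by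
    by_contra! hcon
    set η : ℝ := 1 / 2 ^ (41 * E + 2) with hη
    have hstep : ∀ s, g a + δ ≤ s → s ≤ r - δ / 2 → q.1 s < s → q.1 s ≤ s - η := by
      intro s hs1 hs2 hs3
      have hT : ∀ f ∈ ({q.1} : Set (ℝ ≃o ℝ)), Lev E f := by
        rintro _ rfl
        exact h.lev1 q hq
      have hηδ : η = δ / 2 / 2 := by
        rw [hη, hδ, pow_add, show 40 * E + E = 41 * E by ring]
        field_simp
      rcases exists_displacement hT s with ⟨_, rfl, h1⟩ | ⟨w, hw, h1⟩
      · have h2 : η ≤ 1 / 2 ^ (4 * E + 2) := one_div_le_one_div_of_le (by positivity)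
          (pow_le_pow_right₀ (by norm_num) (by omega))
        rw [abs_of_neg (by linarith)] at h1
        linarith
      · have hqw := hw _ rfl
        rcases h1 with rfl | ⟨_, rfl, h1⟩
        · exact absurd hqw hs3.ne
        · have h2 : δ / 2 ≤ |s - w| := by
            rcases le_or_gt w (g a) with h3 | h3
            · exact le_trans (by linarith) (le_abs_self _)
            · have : r ≤ w := by
                by_contra! h4
                exact hrfirst w ⟨h3, h4⟩ hqw
              rw [abs_sub_comm]
              exact le_trans (by linarith) (le_abs_self _)
          rw [abs_of_neg (by linarith : q.1 s - s < 0)] at h1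
          linarith
    -- the orbit of `a + δ` under `q.2` stays in `[z, a + δ]` for the given number of steps, because
    -- the slope of `g` makes `z` extremely close to `a`
    have hmem : ∀ j : ℕ, j ≤ 2 ^ (41 * E + 2) → a + δ * 2 ^ (-(m * j : ℕ) : ℤ) ∈ Icc z (a + δ) := by
      intro j hj
      constructor
      · have h1 : z - a = δ * 2 ^ (-n) := by
          rw [hzeq, zpow_neg]
          field_simp
        have h2 : m * j ≤ rigidBound E := Nat.mul_le_mul hmE hj
        have h3 : (2 : ℝ) ^ (-n) ≤ 2 ^ (-(m * j : ℕ) : ℤ) :=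
          zpow_le_zpow_right₀ (by norm_num) (by omega)
        have := mul_le_mul_of_nonneg_left h3 hδ0.le
        linarith
      · have : (2 : ℝ) ^ (-(m * j : ℕ) : ℤ) ≤ 1 := zpow_le_one_of_nonpos₀ (by norm_num) (by omega)
        have := mul_le_mul_of_nonneg_left this hδ0.le
        linarith
    have key : ∀ j : ℕ, j ≤ 2 ^ (41 * E + 2) →
        g (a + δ * 2 ^ (-(m * j : ℕ) : ℤ)) ≤ g (a + δ) - j * η := by
      intro j
      induction j with
      | zero => simp
      | succ j ih =>
        intro hj
        obtain ⟨hz1, hz2⟩ := hmem j (by omega)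
        have ih := ih (by omega)
        set t := a + δ * 2 ^ (-(m * j : ℕ) : ℤ) with ht
        have hvt : q.2 t = a + δ * 2 ^ (-(m * (j + 1) : ℕ) : ℤ) := by
          have := hv a ha t ⟨haz.le.trans hz1, hz2⟩
          rw [hva, ht] at this
          have h2 : (2 : ℝ) ^ (-(m * (j + 1) : ℕ) : ℤ) = 2 ^ (-m : ℤ) * 2 ^ (-(m * j : ℕ) : ℤ) := by
            rw [← zpow_add₀ two_ne_zero]
            congr 1
            push_cast
            ring
          rw [h2]
          linear_combination this
        rw [← hvt, ← h.conj q hq]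
        have hgt : g a + δ ≤ g t := by rw [← hgz]; exact g.le_iff_le.2 hz1
        have h3 : 0 ≤ (j : ℝ) * η := by positivity
        have := hstep (g t) hgt (by linarith) (hult _ ⟨by linarith, g.le_iff_le.2 hz2⟩)
        push_cast
        linarith
    have h1 := key _ le_rfl
    have h2 : ((2 ^ (41 * E + 2) : ℕ) : ℝ) * η = 1 := by
      rw [hη]
      push_cast
      field_simp
    rw [h2] at h1
    have h3 := g.le_iff_le.2 ((hmem _ le_rfl).1)
    rw [hgz] at h3
    linarith
  -- hence the commutators are trivial up to `r`
  have hrden : HasDen E r := by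
    have hT : ∀ f ∈ ({q.1} : Set (ℝ ≃o ℝ)), Lev E f := by
      rintro _ rfl
      exact h.lev1 q hq
    refine hasDen_of_notMem_interior hT (by rintro _ rfl; exact hr2) fun hi => ?_
    obtain ⟨ε, hε, hball⟩ := Metric.isOpen_iff.1 isOpen_interior r hi
    obtain ⟨t, ht1, ht2⟩ := exists_between (max_lt (by linarith : g a < r) (by linarith : r - ε < r))
    have ht3 := (le_max_left _ _).trans_lt ht1
    have ht4 := (le_max_right _ _).trans_lt ht1
    refine hrfirst t ⟨ht3, ht2⟩ (interior_subset (hball ?_) _ rfl)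
    rw [Metric.mem_ball, Real.dist_eq, abs_of_neg (by linarith)]
    linarith
  have hcomm : ∀ q₁ ∈ P, ∀ q₂ ∈ P, ∀ s ∈ Icc (g a) r, q₁.1 (q₂.1 s) = q₂.1 (q₁.1 s) := by
    intro q₁ h₁ q₂ h₂
    have hid : ∀ s ∈ Icc (g a) (g (a + δ)), (pairCommutator q₁ q₂).1 s = s := by
      intro s hs
      obtain ⟨t, rfl⟩ := g.surjective s
      rw [h.conj_commutator h₁ h₂, hc.commutator_eq_near h h₁ h₂]
      exact ⟨g.le_iff_le.1 hs.1, g.le_iff_le.1 hs.2⟩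
    obtain ⟨k, -, hA⟩ := (h.symm.lev_commutator (q₁ := q₁.swap) (q₂ := q₂.swap) h₁ h₂).1
      (r - δ) r (by linarith) (hrden.notMem_Dy_left (L := 40 * E) (by omega))
    change AffOn (pairCommutator q₁ q₂).1 k _ at hA
    intro s hs
    rw [← pairCommutator_fst_apply]
    rcases le_or_gt s (g (a + δ)) with h1 | h1
    · exact hid s ⟨hs.1, h1⟩
    · have hw1 : r - δ ∈ Icc (r - δ) r := ⟨le_rfl, by linarith⟩
      have hw2 : r - δ / 2 ∈ Icc (r - δ) r := ⟨by linarith, by linarith⟩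
      have hf1 := hid (r - δ) ⟨by linarith, by linarith⟩
      have hf2 := hid (r - δ / 2) ⟨by linarith, by linarith⟩
      have hk0 := hA.eq_zero_of_fixed hw1 hw2 hf1 hf2 (by linarith)
      subst hk0
      exact hA.eq_self hw1 hf1 ⟨by linarith, hs.2⟩
  -- so that `r` is the right end of the component
  -- (an image of `r` to the left of `r` would be an earlier fixed point of `u`)
  have hrge : ∀ q₂ ∈ P, r ≤ q₂.1 r := by
    intro q₂ h₂
    by_contra! hcon
    have h1 := hcomm q hq q₂ h₂ r ⟨by linarith, le_rfl⟩
    rw [hr2] at h1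
    refine hrfirst _ ⟨?_, hcon⟩ h1
    have := q₂.1.lt_iff_lt.2 (by linarith : g a < r)
    rwa [h.conj q₂ h₂, hc.fix_left q₂ h₂] at this
  have hrfix : ∀ q₂ ∈ P, q₂.1 r = r := by
    intro q₂ h₂
    refine le_antisymm ?_ (hrge q₂ h₂)
    have h1 := q₂.1.le_iff_le.2 (hrge _ (h.inv_pair q₂ h₂))
    rwa [show q₂.1 ((q₂⁻¹).1 r) = r from RelIso.apply_inv_self _ _] at h1
  have hreq : r = g b := by
    by_contra hne
    obtain ⟨q₂, h₂, hq₂⟩ := hcx.moves r ⟨by linarith, lt_of_le_of_ne hrb hne⟩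
    exact hq₂ (hrfix q₂.swap h₂)
  intro q₁ h₁ q₂ h₂ t ht
  have := hcomm q₁ h₁ q₂ h₂ (g t) ⟨g.le_iff_le.2 ht.1, by rw [hreq]; exact g.le_iff_le.2 ht.2⟩
  rw [h.conj q₂ h₂, h.conj q₁ h₁, h.conj q₁ h₁, h.conj q₂ h₂] at this
  exact g.injective this

/-- A very small slope is a large slope of the inverse conjugator. -/
theorem IsComp.commute_of_abs_slope_gt {a b : ℝ} (hc : IsComp P a b) (h : ConjData E P g)
    (hab : b ≤ a + 1) (hgab : g b ≤ g a + 1) {n : ℤ} (hn : RSl g n a)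
    (hbig : (rigidBound E : ℤ) < |n|) :
    ∀ q₁ ∈ P, ∀ q₂ ∈ P, ∀ t ∈ Icc a b, q₁.2 (q₂.2 t) = q₂.2 (q₁.2 t) := by
  rcases le_total 0 n with h0 | h0
  · rw [abs_of_nonneg h0] at hbig
    exact hc.commute_of_slope_gt h hgab hn hbig
  · rw [abs_of_nonpos h0] at hbig
    have := (hc.symm h).commute_of_slope_gt h.symm (by simpa [RelIso.inv_apply_self] using hab)
      hn.inv hbig
    intro q₁ h₁ q₂ h₂ t ht
    have h1 := this q₁.swap h₁ q₂.swap h₂ (g t) ⟨g.le_iff_le.2 ht.1, g.le_iff_le.2 ht.2⟩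
    simp only [Prod.snd_swap] at h1
    rw [h.conj q₂ h₂, h.conj q₁ h₁, h.conj q₁ h₁, h.conj q₂ h₂] at h1
    exact g.injective h1

/-! ### Gluing homeomorphisms -/

/-- The homeomorphism that agrees with `f` to the left of `c` and with `g` to the right of `c`. -/
noncomputable def glue (f g : ℝ ≃o ℝ) (c : ℝ) (h : f c = g c) : ℝ ≃o ℝ :=
  StrictMono.orderIsoOfSurjective (fun t => if t ≤ c then f t else g t)
    (by
      intro x y hxy
      simp only
      split_ifs with h1 h2 h2
      · exact f.lt_iff_lt.2 hxy
      · exact (f.le_iff_le.2 h1).trans_lt (h ▸ g.lt_iff_lt.2 (not_le.1 h2))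
      · exact absurd (hxy.le.trans h2) h1
      · exact g.lt_iff_lt.2 hxy)
    (by
      intro y
      rcases le_or_gt y (f c) with hy | hy
      · refine ⟨f.symm y, ?_⟩
        have : f.symm y ≤ c := by rw [← f.le_iff_le, f.apply_symm_apply]; exact hy
        simp [this]
      · refine ⟨g.symm y, ?_⟩
        have : c < g.symm y := by rw [← g.lt_iff_lt, g.apply_symm_apply, ← h]; exact hy
        simp [not_le.2 this])

theorem glue_apply_of_le {f g : ℝ ≃o ℝ} {c : ℝ} (h : f c = g c) {t : ℝ} (ht : t ≤ c) :
    glue f g c h t = f t := if_pos ht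

theorem glue_apply_of_ge {f g : ℝ ≃o ℝ} {c : ℝ} (h : f c = g c) {t : ℝ} (ht : c ≤ t) :
    glue f g c h t = g t := by
  rcases eq_or_lt_of_le ht with rfl | ht
  · rw [glue_apply_of_le h le_rfl, h]
  · exact if_neg (not_le.2 ht)

theorem Lev.glue {N : ℕ} {f g : ℝ ≃o ℝ} {c : ℝ} (h : f c = g c) (hf : Lev N f) (hg : Lev N g)
    (hc : c ∈ Dy N) : Lev N (glue f g c h) := by
  refine ⟨fun a b hab hD => ?_, fun x hx => ?_⟩
  · rcases le_or_gt b c with hbc | hbc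
    · obtain ⟨n, hn, hA⟩ := hf.1 a b hab hD
      exact ⟨n, hn, hA.congr fun x hx => glue_apply_of_le h (hx.2.trans hbc)⟩
    · have hca : c ≤ a := by
        by_contra! hcon
        exact hD c ⟨hcon, hbc⟩ hc
      obtain ⟨n, hn, hA⟩ := hg.1 a b hab hD
      exact ⟨n, hn, hA.congr fun x hx => glue_apply_of_ge h (hca.trans hx.1)⟩
  · rcases le_total x c with h1 | h1
    · rw [glue_apply_of_le h h1]; exact hf.2 x hx
    · rw [glue_apply_of_ge h h1]; exact hg.2 x hx

theorem glue_mem_levGroup {f g : ℝ ≃o ℝ} {c : ℝ} (h : f c = g c) (hf : f ∈ levGroup)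
    (hg : g ∈ levGroup) (hc : ∃ N, c ∈ Dy N) : glue f g c h ∈ levGroup := by
  obtain ⟨N, hf⟩ := hf
  obtain ⟨M, hg⟩ := hg
  obtain ⟨K, hc⟩ := hc
  exact ⟨N + M + K, Lev.glue h (hf.mono (by omega)) (hg.mono (by omega)) (Dy_mono (by omega) hc)⟩

/-- The homeomorphisms with dyadic breakpoints that are supported in `[d, d']` and commute with the
second members of the pairs in `P`. -/
def supportedCentralizer (P : Set ((ℝ ≃o ℝ) × (ℝ ≃o ℝ))) (d d' : ℝ) : Subgroup (ℝ ≃o ℝ) where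
  carrier := {h | h ∈ levGroup ∧ (∀ t, t ≤ d ∨ d' ≤ t → h t = t) ∧
    ∀ q ∈ P, ∀ t, h (q.2 t) = q.2 (h t)}
  mul_mem' := by
    rintro f g ⟨hf1, hf2, hf3⟩ ⟨hg1, hg2, hg3⟩
    refine ⟨mul_mem hf1 hg1, fun t ht => ?_, fun q hq t => ?_⟩
    · rw [RelIso.mul_apply, hg2 t ht, hf2 t ht]
    · rw [RelIso.mul_apply, RelIso.mul_apply, hg3 q hq, hf3 q hq]
  one_mem' := ⟨one_mem _, fun t _ => rfl, fun q _ t => rfl⟩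
  inv_mem' := by
    rintro f ⟨hf1, hf2, hf3⟩
    refine ⟨inv_mem hf1, fun t ht => ?_, fun q hq t => ?_⟩
    · rw [← f.injective.eq_iff, RelIso.apply_inv_self, hf2 t ht]
    · rw [← f.injective.eq_iff, RelIso.apply_inv_self, hf3 q hq, RelIso.apply_inv_self]

/-- A homeomorphism that preserves `[d, d']` and commutes with the second members of the pairs there
can be cut off outside `[d, d']` by the identity. -/
theorem exists_restrict {f : ℝ ≃o ℝ} (hf : f ∈ levGroup) {d d' : ℝ} (hdd : d < d') (hd : f d = d)
    (hd' : f d' = d') (hdD : ∃ N, d ∈ Dy N) (hdD' : ∃ N, d' ∈ Dy N)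
    (hP : ∀ q ∈ P, q.2 d = d) (hP' : ∀ q ∈ P, q.2 d' = d')
    (hcomm : ∀ q ∈ P, ∀ t ∈ Icc d d', f (q.2 t) = q.2 (f t)) :
    ∃ r ∈ supportedCentralizer P d d', ∀ t ∈ Icc d d', r t = f t := by
  have h1 : (1 : ℝ ≃o ℝ) d = f d := hd.symm
  have h2 : glue 1 f d h1 d' = (1 : ℝ ≃o ℝ) d' := by
    rw [glue_apply_of_ge h1 hdd.le, hd']; rfl
  have hin : ∀ t ∈ Icc d d', glue (glue 1 f d h1) 1 d' h2 t = f t := fun t ht => by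
    rw [glue_apply_of_le h2 ht.2, glue_apply_of_ge h1 ht.1]
  have hout : ∀ t, t ≤ d ∨ d' ≤ t → glue (glue 1 f d h1) 1 d' h2 t = t := by
    rintro t (ht | ht)
    · rw [glue_apply_of_le h2 (ht.trans hdd.le), glue_apply_of_le h1 ht]; rfl
    · rw [glue_apply_of_ge h2 ht]; rfl
  refine ⟨glue (glue 1 f d h1) 1 d' h2, ⟨?_, hout, fun q hq t => ?_⟩, hin⟩
  · exact glue_mem_levGroup h2 (glue_mem_levGroup h1 (one_mem _) hf hdD) (one_mem _) hdD'
  · rcases le_or_gt t d with ht | ht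
    · rw [hout t (Or.inl ht), hout _ (Or.inl ?_)]
      have := q.2.le_iff_le.2 ht
      rwa [hP q hq] at this
    rcases le_or_gt d' t with ht' | ht'
    · rw [hout t (Or.inr ht'), hout _ (Or.inr ?_)]
      have := q.2.le_iff_le.2 ht'
      rwa [hP' q hq] at this
    · have e1 := q.2.le_iff_le.2 ht.le
      have e2 := q.2.le_iff_le.2 ht'.le
      rw [hP q hq] at e1
      rw [hP' q hq] at e2
      rw [hin t ⟨ht.le, ht'.le⟩, hin _ ⟨e1, e2⟩, hcomm q hq t ⟨ht.le, ht'.le⟩]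

/-- Multiplying a conjugator by an element of the centralizer yields a conjugator. -/
theorem ConjData.mul (h : ConjData E P g) {d d' : ℝ} {f : ℝ ≃o ℝ}
    (hf : f ∈ supportedCentralizer P d d') : ConjData E P (g * f) where
  lev1 := h.lev1
  lev2 := h.lev2
  inv_pair := h.inv_pair
  conj q hq t := by
    rw [RelIso.mul_apply, RelIso.mul_apply, h.conj q hq, hf.2.2 q hq]
  mem := mul_mem h.mem hf.1

theorem RSl.mul {f g : ℝ ≃o ℝ} {n m : ℤ} {t : ℝ} (hf : RSl f n (g t)) (hg : RSl g m t) :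
    RSl (f * g : ℝ ≃o ℝ) (n + m) t := by
  have h1 : Tendsto g (𝓝[>] t) (𝓝[>] (g t)) := by
    refine tendsto_nhdsWithin_iff.2 ⟨(g.continuous.tendsto t).mono_left nhdsWithin_le_nhds, ?_⟩
    filter_upwards [self_mem_nhdsWithin] with x hx
    exact g.lt_iff_lt.2 hx
  filter_upwards [h1.eventually hf, hg] with x hx hx'
  rw [RelIso.mul_apply, RelIso.mul_apply, hx, hx', zpow_add₀ two_ne_zero, mul_assoc]

theorem RSl.zpow {f : ℝ ≃o ℝ} {n : ℤ} {t : ℝ} (hf : RSl f n t) (hft : f t = t) (c : ℤ) :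
    RSl (f ^ c : ℝ ≃o ℝ) (n * c) t := by
  have hinv : RSl (f⁻¹ : ℝ ≃o ℝ) (-n) t := by
    have := hf.inv
    rwa [hft] at this
  have hft' : (f⁻¹ : ℝ ≃o ℝ) t = t := by
    rw [← f.injective.eq_iff, RelIso.apply_inv_self, hft]
  have hpow : ∀ (f : ℝ ≃o ℝ) (n : ℤ), RSl f n t → f t = t → ∀ k : ℕ,
      RSl (f ^ k : ℝ ≃o ℝ) (n * k) t := by
    intro f n hf hft k
    induction k with
    | zero => exact Eventually.of_forall fun x => by simp
    | succ k ih =>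
      rw [pow_succ]
      have h1 : RSl (f ^ k : ℝ ≃o ℝ) (n * k) (f t) := by rwa [hft]
      have := h1.mul hf
      rwa [show n * (k : ℕ) + n = n * (k + 1 : ℕ) by push_cast; ring] at this
  obtain ⟨k, rfl | rfl⟩ := c.eq_nat_or_neg
  · simpa using hpow f n hf hft k
  · have := hpow _ _ hinv hft' k
    rw [inv_pow] at this
    rw [zpow_neg, zpow_natCast]
    rwa [show n * -(k : ℤ) = -n * k by ring]

/-! ### Chains of components separated by nondyadic points -/

/-- A block is an interval with common fixed dyadic ends, such that all common fixed points in its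
interior are nondyadic. A piecewise linear conjugator with dyadic breakpoints has the same slope on
both sides of such an interior fixed point. -/
structure IsBlock (E : ℕ) (P : Set ((ℝ ≃o ℝ) × (ℝ ≃o ℝ))) (d d' : ℝ) : Prop where
  lt : d < d'
  fix_left : ∀ q ∈ P, q.2 d = d
  fix_right : ∀ q ∈ P, q.2 d' = d'
  mem_left : d ∈ Dy (2 * E)
  mem_right : d' ∈ Dy (2 * E)
  nondyadic : ∀ t ∈ Ioo d d', (∀ q ∈ P, q.2 t = t) → ∀ N, t ∉ Dy N

theorem IsBlock.reflect {d d' : ℝ} (hB : IsBlock E P d d') :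
    IsBlock E (reflectPairs P) (-d') (-d) where
  lt := neg_lt_neg hB.lt
  fix_left := mem_fix_reflect.2 (by simpa using hB.fix_right)
  fix_right := mem_fix_reflect.2 (by simpa using hB.fix_left)
  mem_left := (Dy _).neg_mem hB.mem_right
  mem_right := (Dy _).neg_mem hB.mem_left
  nondyadic t ht hfix N hN := hB.nondyadic (-t) ⟨by linarith [ht.2], by linarith [ht.1]⟩
    (mem_fix_reflect.1 hfix) N ((Dy N).neg_mem hN)

theorem exists_dyadic_between {a b : ℝ} (hab : a < b) : ∃ N, ∃ t ∈ Dy N, a < t ∧ t < b := by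
  obtain ⟨N, hN⟩ := exists_pow_lt_of_lt_one (y := (2 : ℝ)⁻¹) (x := b - a) (by linarith) (by norm_num)
  obtain ⟨e, he, h1, h2⟩ := exists_Dy_floor N a
  refine ⟨N, e + 1 / 2 ^ N, (Dy N).add_mem he (one_div_mem_Dy N), h2, ?_⟩
  rw [inv_pow] at hN
  rw [one_div]
  linarith

/-- The interior of a block contains no interval of common fixed points, since it would contain
dyadic points. -/
theorem IsBlock.hasDen {d d' : ℝ} (hB : IsBlock E P d d') (h : ConjData E P g) {z : ℝ}
    (hz : z ∈ Icc d d') (hfix : ∀ q ∈ P, q.2 z = z) : HasDen E z := by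
  rcases eq_or_lt_of_le hz.1 with rfl | h1
  · exact hasDen_of_mem_Dy hB.mem_left
  rcases eq_or_lt_of_le hz.2 with rfl | h2
  · exact hasDen_of_mem_Dy hB.mem_right
  have hT : ∀ f ∈ Prod.snd '' P, Lev E f := by
    rintro _ ⟨q, hq, rfl⟩
    exact h.lev2 q hq
  refine hasDen_of_notMem_interior hT ?_ ?_
  · rintro _ ⟨q, hq, rfl⟩
    exact hfix q hq
  · intro hi
    obtain ⟨ε, hε, hball⟩ := Metric.isOpen_iff.1 isOpen_interior z hi
    obtain ⟨N, t, htN, ht1, ht2⟩ := exists_dyadic_between (lt_min h2 (by linarith : z < z + ε))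
    refine hB.nondyadic t ⟨h1.trans ht1, ht2.trans_le (min_le_left _ _)⟩ (fun q hq => ?_) N htN
    refine interior_subset (hball ?_) _ ⟨q, hq, rfl⟩
    rw [Metric.mem_ball, Real.dist_eq, abs_of_pos (by linarith)]
    linarith [ht2.trans_le (min_le_right _ _)]

/-- The component of a point that is not fixed. -/
theorem exists_isComp {x y t : ℝ} (hx : ∀ q ∈ P, q.2 x = x) (hy : ∀ q ∈ P, q.2 y = y)
    (hxt : x ≤ t) (hty : t ≤ y) (ht : ∃ q ∈ P, q.2 t ≠ t) :
    ∃ a b, x ≤ a ∧ a < t ∧ t < b ∧ b ≤ y ∧ IsComp P a b := by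
  have hcl : IsClosed {z | ∀ q ∈ P, q.2 z = z} := by
    have := isClosed_FixSet (Prod.snd '' P)
    convert this using 1
    ext z
    exact ⟨fun h f hf => by obtain ⟨q, hq, rfl⟩ := hf; exact h q hq, fun h q hq => h _ ⟨q, hq, rfl⟩⟩
  set F := {z | ∀ q ∈ P, q.2 z = z} with hF
  have hl : IsCompact (F ∩ Icc x t) := isCompact_Icc.inter_left hcl
  have hr : IsCompact (F ∩ Icc t y) := isCompact_Icc.inter_left hcl
  have hl1 := hl.sSup_mem ⟨x, hx, le_rfl, hxt⟩
  have hr1 := hr.sInf_mem ⟨y, hy, hty, le_rfl⟩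
  have htF : t ∉ F := by
    obtain ⟨q, hq, hqt⟩ := ht
    exact fun h => hqt (h q hq)
  have h1 : sSup (F ∩ Icc x t) < t := lt_of_le_of_ne hl1.2.2 fun h => htF (h ▸ hl1.1)
  have h2 : t < sInf (F ∩ Icc t y) := lt_of_le_of_ne hr1.2.1 fun h => htF (h ▸ hr1.1)
  refine ⟨_, _, hl1.2.1, h1, h2, hr1.2.2, h1.trans h2, hl1.1, hr1.1, fun z hz => ?_⟩
  by_contra! hcon
  rcases le_total z t with hzt | hzt
  · exact absurd (le_csSup hl.bddAbove ⟨hcon, hl1.2.1.trans hz.1.le, hzt⟩) (not_le.2 hz.1)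
  · exact absurd (csInf_le hr.bddBelow ⟨hcon, hzt, hz.2.le.trans hr1.2.2⟩) (not_le.2 hz.2)

/-- The component to the left of a fixed point in a block; it exists because the common fixed points
in a block are separated by `2 ^ (-4E)`. -/
theorem IsBlock.exists_isComp_left {d d' : ℝ} (hB : IsBlock E P d d') (h : ConjData E P g) {x s : ℝ}
    (hdx : d ≤ x) (hx : ∀ q ∈ P, q.2 x = x) (hxs : x < s) (hsd : s ≤ d') (hs : ∀ q ∈ P, q.2 s = s) :
    ∃ a, x ≤ a ∧ IsComp P a s := by
  have hγ : (0 : ℝ) < 1 / 2 ^ (4 * E) := by positivity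
  have hnf : ∀ t, s - 1 / 2 ^ (4 * E) < t → x ≤ t → t < s → ∃ q ∈ P, q.2 t ≠ t := by
    intro t ht1 hxt ht2
    by_contra! hcon
    have := (hB.hasDen h ⟨hdx.trans hxs.le, hsd⟩ hs).sep
      (hB.hasDen h ⟨hdx.trans hxt, ht2.le.trans hsd⟩ hcon) ht2.ne
    rw [abs_of_neg (by linarith)] at this
    linarith
  obtain ⟨t, ht1, ht2⟩ := exists_between (max_lt hxs (by linarith : s - 1 / 2 ^ (4 * E) < s))
  have ht3 := (le_max_left _ _).trans_lt ht1
  have ht4 := (le_max_right _ _).trans_lt ht1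
  obtain ⟨a, b, h1, h2, h3, h4, hc⟩ := exists_isComp hx hs ht3.le ht2.le (hnf t ht4 ht3.le ht2)
  have hbs : b = s := by
    by_contra hne
    obtain ⟨q, hq, hqb⟩ := hnf b (by linarith) (by linarith) (lt_of_le_of_ne h4 hne)
    exact hqb (hc.fix_right q hq)
  subst hbs
  exact ⟨a, h1, hc⟩

theorem IsBlock.exists_isComp_first {d d' : ℝ} (hB : IsBlock E P d d') (h : ConjData E P g) :
    ∃ b, IsComp P d b := by
  obtain ⟨a, h1, hc⟩ := hB.reflect.exists_isComp_left h.reflect (x := -d') (s := -d) le_rfl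
    hB.reflect.fix_left hB.reflect.lt le_rfl hB.reflect.fix_right
  refine ⟨-a, ?_⟩
  have := hc.reflect
  rw [neg_neg] at this
  have hPP : reflectPairs (reflectPairs P) = P := by
    ext q
    simp [reflectPairs, reflect_reflect]
  rwa [hPP] at this

/-- The bound for a conjugator on a block in terms of its slope exponent at some fixed point. The
iteration runs over the components of the block, each of which has length at least `2 ^ (-4E)`. -/
def blockBound (E S : ℕ) : ℕ := (compBound E)^[2 ^ (4 * E)] S

theorem le_compBound (E S : ℕ) : S ≤ compBound E S := by
  unfold compBound
  omega

theorem le_compBound_iterate (E S j : ℕ) : S ≤ (compBound E)^[j] S :=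
  Function.id_le_iterate_of_id_le (fun S => le_compBound E S) j S

theorem exists_lAff_of_nondyadic (hg : g ∈ levGroup) {t : ℝ} (ht : ∀ N, t ∉ Dy N) :
    ∃ k, LAff g k t := by
  obtain ⟨N, hN⟩ := hg
  obtain ⟨k, -, hk⟩ := hN.exists_lAff (ht N)
  exact ⟨k, hk⟩

/-- Within a block, a bound on the slope at a fixed point propagates to the right. -/
theorem IsBlock.fine_right {d d' : ℝ} (hB : IsBlock E P d d') (h : ConjData E P g)
    (hdd : d' ≤ d + 1) (hgd : g d' ≤ g d + 1) {s₀ : ℝ} (hs₀ : s₀ ∈ Ico d d')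
    (hfix : ∀ q ∈ P, q.2 s₀ = s₀) {S : ℕ} {n : ℤ} (hn : RSl g n s₀) (hnS : |n| ≤ S) :
    ∀ t ∈ Ioo s₀ d', Fine (blockBound E S) g t := by
  -- induction over the common fixed points `s` to the right of `s₀`
  have key : ∀ j : ℕ, ∀ s, s₀ < s → s ≤ d' → s ≤ s₀ + j * (1 / 2 ^ (4 * E)) →
      (∀ q ∈ P, q.2 s = s) → ∀ t ∈ Ioo s₀ s, Fine ((compBound E)^[j] S) g t := by
    intro j
    induction j with
    | zero =>
      intro s h1 _ h2
      simp at h2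
      linarith
    | succ j ih =>
      intro s h1 hsd h2 hs t ht
      obtain ⟨a, ha, hc⟩ := hB.exists_isComp_left h hs₀.1 hfix h1 hsd hs
      have hga := g.le_iff_le.2 (hs₀.1.trans ha)
      have hgs := g.le_iff_le.2 hsd
      have hcf : ∀ k : ℤ, RSl g k a → |k| ≤ ((compBound E)^[j] S : ℕ) →
          ∀ t ∈ Ioo a s, Fine ((compBound E)^[j + 1] S) g t := by
        intro k hk hkS
        rw [Function.iterate_succ_apply']
        exact hc.fine h (by linarith [hs₀.1]) (by linarith) hk hkS
      rcases eq_or_lt_of_le ha with rfl | ha'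
      · exact hcf n hn (hnS.trans (by exact_mod_cast le_compBound_iterate E S j)) t ht
      · have hsep := (hB.hasDen h ⟨hs₀.1.trans h1.le, hsd⟩ hs).sep
          (hB.hasDen h ⟨hs₀.1.trans ha, hc.lt.le.trans hsd⟩ hc.fix_left) hc.lt.ne
        rw [abs_of_neg (sub_neg.2 hc.lt)] at hsep
        push_cast at h2
        have hF := ih a ha' (hc.lt.le.trans hsd) (by linarith) hc.fix_left
        -- the conjugator has the same slope on both sides of the nondyadic point `a`
        obtain ⟨k, hk⟩ := exists_lAff_of_nondyadic h.mem
          (hB.nondyadic a ⟨hs₀.1.trans_lt ha', hc.lt.trans_le hsd⟩ hc.fix_left)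
        have hkS := (lAff_iff.1 hk).1.abs_le_of_fine ha' hF
        have hmono : (compBound E)^[j] S ≤ (compBound E)^[j + 1] S := by
          rw [Function.iterate_succ_apply']
          exact le_compBound _ _
        rcases lt_trichotomy t a with hta | rfl | hta
        · exact (hF t ⟨ht.1, hta⟩).mono hmono
        · exact Or.inr (Or.inr ⟨k, hkS.trans (by exact_mod_cast hmono), hk⟩)
        · exact hcf k (lAff_iff.1 hk).2 hkS t ⟨hta, ht.2⟩
  refine key _ d' hs₀.2 le_rfl ?_ hB.fix_right
  have : ((2 ^ (4 * E) : ℕ) : ℝ) * (1 / 2 ^ (4 * E)) = 1 := by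
    push_cast
    field_simp
  rw [this]
  linarith [hs₀.1]

theorem IsBlock.fine_left {d d' : ℝ} (hB : IsBlock E P d d') (h : ConjData E P g)
    (hdd : d' ≤ d + 1) (hgd : g d' ≤ g d + 1) {s₀ : ℝ} (hs₀ : s₀ ∈ Ioc d d')
    (hfix : ∀ q ∈ P, q.2 s₀ = s₀) {S : ℕ} {n : ℤ} (hn : LSl g n s₀) (hnS : |n| ≤ S) :
    ∀ t ∈ Ioo d s₀, Fine (blockBound E S) g t := by
  intro t ht
  have := hB.reflect.fine_right h.reflect (s₀ := -s₀) (by linarith)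
    (by simp only [reflect_apply, neg_neg]; linarith) ⟨neg_le_neg hs₀.2, neg_lt_neg hs₀.1⟩
    (mem_fix_reflect.2 (by simpa using hfix)) hn.reflect hnS (-t)
    ⟨neg_lt_neg ht.2, neg_lt_neg ht.1⟩
  have h2 := this.reflect
  rwa [reflect_reflect, neg_neg] at h2

/-- On a block, a conjugator can be modified by an element of the centralizer so that it satisfies a
bound depending only on `E`. If the slope at some fixed point is small, the conjugator itself is
bounded. Otherwise everything commutes on the block, and powers of the restriction of some `v` can be
used to reduce the slope at the left end of the block. -/
theorem IsBlock.exists_fine {d d' : ℝ} (hB : IsBlock E P d d') (h : ConjData E P g)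
    (hdd : d' ≤ d + 1) (hgd : g d' ≤ g d + 1) :
    ∃ f ∈ supportedCentralizer P d d',
      ∀ t ∈ Ioo d d', Fine (blockBound E (rigidBound E + E)) (g * f) t := by
  by_cases hsmall : ∃ s₀ ∈ Ico d d', (∀ q ∈ P, q.2 s₀ = s₀) ∧
      ∃ n : ℤ, RSl g n s₀ ∧ |n| ≤ (rigidBound E : ℤ)
  · obtain ⟨s₀, hs₀, hfix, n, hn, hnS⟩ := hsmall
    refine ⟨1, one_mem _, ?_⟩
    rw [mul_one]
    have hnS' : |n| ≤ ((rigidBound E + E : ℕ) : ℤ) := by push_cast; omega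
    have hR := hB.fine_right h hdd hgd hs₀ hfix hn hnS'
    rcases eq_or_lt_of_le hs₀.1 with h0 | h0
    · rwa [h0]
    obtain ⟨k, hk⟩ := exists_lAff_of_nondyadic h.mem (hB.nondyadic s₀ ⟨h0, hs₀.2⟩ hfix)
    have hkn : k = n := (lAff_iff.1 hk).2.unique hn
    subst hkn
    have hL := hB.fine_left h hdd hgd ⟨h0, hs₀.2.le⟩ hfix (lAff_iff.1 hk).1 hnS'
    intro t ht
    rcases lt_trichotomy t s₀ with hts | rfl | hts
    · exact hL t ⟨ht.1, hts⟩
    · exact Or.inr (Or.inr ⟨k, hnS'.trans (by exact_mod_cast le_compBound_iterate _ _ _), hk⟩)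
    · exact hR t ⟨hts, ht.2⟩
  -- now the slopes at all fixed points are large
  push Not at hsmall
  have hcomm : ∀ q₁ ∈ P, ∀ q₂ ∈ P, ∀ t ∈ Icc d d', q₁.2 (q₂.2 t) = q₂.2 (q₁.2 t) := by
    intro q₁ h₁ q₂ h₂ t ht
    by_cases htf : ∃ q ∈ P, q.2 t ≠ t
    · obtain ⟨a, b, ha, hat, htb, hb, hc⟩ := exists_isComp hB.fix_left hB.fix_right ht.1 ht.2 htf
      have hga := g.le_iff_le.2 ha
      have hgb := g.le_iff_le.2 hb
      obtain ⟨n, hn⟩ := exists_rSl h.mem a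
      exact hc.commute_of_abs_slope_gt h (by linarith) (by linarith) hn
        (hsmall a ⟨ha, hc.lt.trans_le hb⟩ hc.fix_left n hn) q₁ h₁ q₂ h₂ t ⟨hat.le, htb.le⟩
    · push Not at htf
      rw [htf q₁ h₁, htf q₂ h₂, htf q₁ h₁]
  obtain ⟨b, hc⟩ := hB.exists_isComp_first h
  obtain ⟨q, hq, m, hm1, hmE, hA⟩ := hc.exists_contracting h
    (z := d + 1 / 2 ^ (2 * E + E)) (by simp) fun x hx hxE =>
      (hc.hasDen_left h).notMem_Dy_right le_rfl x hx (Dy_mono (by omega) hxE)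
  have hqmem : q.2 ∈ levGroup := ⟨E, h.lev2 q hq⟩
  obtain ⟨f₀, hf₀, hf₀q⟩ := exists_restrict (P := P) hqmem hB.lt (hB.fix_left q hq)
    (hB.fix_right q hq) ⟨_, hB.mem_left⟩ ⟨_, hB.mem_right⟩ hB.fix_left hB.fix_right
    (fun q₂ h₂ t ht => hcomm q hq q₂ h₂ t ht)
  have hf₀d : f₀ d = d := hf₀.2.1 d (Or.inl le_rfl)
  have hf₀s : RSl f₀ (-m) d := by
    have h1 : RSl q.2 (-m) d := hA.rSl (by simp)
    filter_upwards [h1, Ioo_mem_nhdsGT hB.lt] with x hx hx'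
    rw [hf₀q x ⟨hx'.1.le, hx'.2.le⟩, hf₀q d ⟨le_rfl, hB.lt.le⟩]
    exact hx
  -- `f₀` has slope exponent `-m` at `d`, so that the exponent of `g` becomes `n % m`
  obtain ⟨n, hn⟩ := exists_rSl h.mem d
  have hmem := zpow_mem hf₀ (n / m)
  refine ⟨f₀ ^ (n / m), hmem, ?_⟩
  have hd1 := hmem.2.1 d (Or.inl le_rfl)
  have hd2 := hmem.2.1 d' (Or.inr le_rfl)
  have hsl : RSl (g * f₀ ^ (n / (m : ℤ)) : ℝ ≃o ℝ) (n % m) d := by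
    have h1 : RSl g n ((f₀ ^ (n / (m : ℤ)) : ℝ ≃o ℝ) d) := by rwa [hd1]
    have h2 := h1.mul (hf₀s.zpow hf₀d (n / m))
    rwa [show n + -(m : ℤ) * (n / m) = n % m by rw [Int.emod_def]; ring] at h2
  have hm0 : (0 : ℤ) < m := by exact_mod_cast hm1
  have hmod : |n % (m : ℤ)| ≤ ((rigidBound E + E : ℕ) : ℤ) := by
    rw [abs_of_nonneg (Int.emod_nonneg _ hm0.ne')]
    have := Int.emod_lt_of_pos n hm0
    push_cast
    omega
  exact hB.fine_right (h.mul hmem) hdd (by rw [RelIso.mul_apply, RelIso.mul_apply, hd1, hd2]; exact hgd)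
    ⟨le_rfl, hB.lt⟩ hB.fix_left hsl hmod

/-! ### Standard maps between dyadic intervals -/

/-- The map `t ↦ 2 ^ n * t + c`. -/
noncomputable def affIso (n : ℤ) (c : ℝ) : ℝ ≃o ℝ where
  toFun t := 2 ^ n * t + c
  invFun t := 2 ^ (-n) * (t - c)
  left_inv t := by
    simp only [add_sub_cancel_right]
    rw [← mul_assoc, ← zpow_add₀ two_ne_zero]
    simp
  right_inv t := by
    change 2 ^ n * (2 ^ (-n) * (t - c)) + c = t
    rw [← mul_assoc, ← zpow_add₀ two_ne_zero]
    simp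
  map_rel_iff' {x y} := by
    have : (0 : ℝ) < 2 ^ n := by positivity
    simp [this]

theorem affIso_apply (n : ℤ) (c t : ℝ) : affIso n c t = 2 ^ n * t + c := rfl

theorem lev_affIso {N : ℕ} {n : ℤ} (hn : |n| ≤ N) {c : ℝ} (hc : c ∈ Dy (2 * N)) :
    Lev N (affIso n c) := by
  refine ⟨fun a b _ _ => ⟨n, hn, fun x _ y _ => ?_⟩, fun x hx => ?_⟩
  · rw [affIso_apply, affIso_apply]; ring
  · rw [affIso_apply]
    refine (Dy _).add_mem ?_ hc
    rw [two_mul]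
    exact two_zpow_mul_mem_Dy hx (abs_le.1 hn).1

theorem stretch_glue_zero : (1 : ℝ ≃o ℝ) 0 = affIso 1 0 0 := by
  rw [affIso_apply, mul_zero, add_zero]
  rfl

theorem stretch_glue_end (K : ℕ) :
    glue 1 (affIso 1 0) 0 stretch_glue_zero (1 / 2 ^ K) = affIso 0 (1 / 2 ^ K) (1 / 2 ^ K) := by
  rw [glue_apply_of_ge _ (by positivity), affIso_apply, affIso_apply]
  simp
  ring

/-- The map that stretches `[0, 2 ^ (-K)]` to twice its length. -/
noncomputable def stretch (K : ℕ) : ℝ ≃o ℝ :=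
  glue (glue 1 (affIso 1 0) 0 stretch_glue_zero) (affIso 0 (1 / 2 ^ K)) (1 / 2 ^ K)
    (stretch_glue_end K)

theorem lev_stretch (K : ℕ) : Lev (K + 1) (stretch K) := by
  refine Lev.glue _ (Lev.glue _ (Lev.one.mono (Nat.zero_le _)) (lev_affIso ?_ (zero_mem _))
    (zero_mem _)) (lev_affIso ?_ (Dy_mono (by omega) (one_div_mem_Dy K)))
    (Dy_mono (by omega) (one_div_mem_Dy K))
  · push_cast
    rw [abs_one]
    omega
  · push_cast
    rw [abs_zero]
    omega

theorem stretch_zero (K : ℕ) : stretch K 0 = 0 := by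
  unfold stretch
  rw [glue_apply_of_le _ (by positivity), glue_apply_of_le _ le_rfl]
  rfl

theorem stretch_of_ge {K : ℕ} {t : ℝ} (ht : 1 / 2 ^ K ≤ t) : stretch K t = t + 1 / 2 ^ K := by
  unfold stretch
  rw [glue_apply_of_ge _ ht, affIso_apply]
  simp

theorem stretch_pow_zero (K m : ℕ) : (stretch K ^ m : ℝ ≃o ℝ) 0 = 0 := by
  induction m with
  | zero => rfl
  | succ m ih => rw [pow_succ, RelIso.mul_apply, stretch_zero, ih]

theorem stretch_pow_apply (K m : ℕ) :
    (stretch K ^ m : ℝ ≃o ℝ) (1 / 2 ^ K) = (m + 1) * (1 / 2 ^ K) := by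
  induction m with
  | zero => simp
  | succ m ih =>
    rw [pow_succ', RelIso.mul_apply, ih, stretch_of_ge]
    · push_cast; ring
    · have : (0 : ℝ) ≤ m * (1 / 2 ^ K) := by positivity
      linarith

theorem lev_stretch_pow (K m : ℕ) : Lev (3 * m * (K + 1)) (stretch K ^ m) := by
  induction m with
  | zero => simpa using Lev.one
  | succ m ih =>
    rw [pow_succ]
    exact (ih.mul (lev_stretch K)).mono (by ring_nf; omega)

/-- The bound for the standard maps between intervals with ends in `2 ^ (-K) ℤ`, which are composed
of two translations and two powers of `stretch K` with exponents at most `2 ^ K` in absolute value. -/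
def stdBound (K : ℕ) : ℕ := 21 * (3 * 2 ^ K * (K + 1)) + 28 * K

/-- Two intervals with ends in `2 ^ (-K) ℤ` are related by a bounded homeomorphism: powers of
`stretch K` map the interval `[0, 2 ^ (-K)]` to its multiples. -/
theorem exists_std {K : ℕ} {x x' y y' : ℝ} (hx : x ∈ Dy K) (hx' : x' ∈ Dy K) (hy : y ∈ Dy K)
    (hy' : y' ∈ Dy K) (hxx : x < x') (hyy : y < y') (hx1 : x' ≤ x + 1) (hy1 : y' ≤ y + 1) :
    ∃ f, Lev (stdBound K) f ∧ f x = y ∧ f x' = y' := by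
  have hlen : ∀ {x x' : ℝ}, x ∈ Dy K → x' ∈ Dy K → x < x' → x' ≤ x + 1 →
      ∃ i : ℕ, i ≤ 2 ^ K ∧ x' = x + (i + 1) * (1 / 2 ^ K) := by
    intro x x' hx hx' hxx hx1
    obtain ⟨m, hm⟩ := (Dy K).sub_mem hx' hx
    have h2 : (0 : ℝ) < 2 ^ K := by positivity
    have hm0 : 0 < m := by
      have : (0 : ℝ) < m := by rw [← hm]; exact mul_pos (by linarith) h2
      exact_mod_cast this
    have hm1 : m ≤ 2 ^ K := by
      have : (m : ℝ) ≤ 2 ^ K := by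
        rw [← hm]
        have := mul_le_mul_of_nonneg_right (by linarith : x' - x ≤ 1) h2.le
        linarith
      exact_mod_cast this
    refine ⟨(m - 1).toNat, ?_, ?_⟩
    · have : ((m - 1).toNat : ℤ) ≤ 2 ^ K := by omega
      exact_mod_cast this
    · have h3 : (((m - 1).toNat : ℤ) : ℝ) = m - 1 := by
        rw [Int.toNat_of_nonneg (by omega)]
        push_cast
        rfl
      have h4 : (((m - 1).toNat : ℕ) : ℝ) = m - 1 := by exact_mod_cast h3
      rw [h4, sub_add_cancel, ← hm]
      field_simp
      ring
  obtain ⟨i, hi, rfl⟩ := hlen hx hx' hxx hx1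
  obtain ⟨j, hj, rfl⟩ := hlen hy hy' hyy hy1
  refine ⟨affIso 0 y * (stretch K ^ j * ((stretch K ^ i)⁻¹ * affIso 0 (-x))), ?_, ?_, ?_⟩
  · have hL : ∀ m, m ≤ 2 ^ K → Lev (3 * 2 ^ K * (K + 1)) (stretch K ^ m) := fun m hm =>
      (lev_stretch_pow K m).mono (Nat.mul_le_mul_right _ (Nat.mul_le_mul_left _ hm))
    have ht : ∀ c ∈ Dy K, Lev K (affIso 0 c) := fun c hc =>
      lev_affIso (by simp) (Dy_mono (by omega) hc)
    have := (ht y hy).mul ((hL j hj).mul ((hL i hi).inv.mul (ht (-x) ((Dy K).neg_mem hx))))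
    exact this.mono (by unfold stdBound; omega)
  · have h1 : ((stretch K ^ i)⁻¹ : ℝ ≃o ℝ) 0 = 0 := by
      rw [← (stretch K ^ i).injective.eq_iff, RelIso.apply_inv_self, stretch_pow_zero]
    have h2 : affIso 0 (-x) x = 0 := by simp [affIso_apply]
    simp only [RelIso.mul_apply]
    rw [h2, h1, stretch_pow_zero, affIso_apply]
    simp
  · have h2 : affIso 0 (-x) (x + (i + 1) * (1 / 2 ^ K)) = (i + 1) * (1 / 2 ^ K) := by
      simp [affIso_apply]
    have h1 : ((stretch K ^ i)⁻¹ : ℝ ≃o ℝ) ((i + 1) * (1 / 2 ^ K)) = 1 / 2 ^ K := by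
      rw [← (stretch K ^ i).injective.eq_iff, RelIso.apply_inv_self, stretch_pow_apply]
    simp only [RelIso.mul_apply]
    rw [h2, h1, stretch_pow_apply, affIso_apply, zpow_zero]
    ring

/-- On an interval of common fixed points a conjugator can be replaced by a standard map. -/
theorem ConjData.exists_fine_of_fixed (h : ConjData E P g) {K : ℕ} {d d' : ℝ} (hdd : d < d')
    (hd : d ∈ Dy K) (hd' : d' ∈ Dy K) (hgd : g d ∈ Dy K) (hgd' : g d' ∈ Dy K) (h1 : d' ≤ d + 1)
    (h2 : g d' ≤ g d + 1) (hfix : ∀ t ∈ Icc d d', ∀ q ∈ P, q.2 t = t) :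
    ∃ f ∈ supportedCentralizer P d d', ∀ t ∈ Ioo d d', Fine (stdBound K) (g * f) t := by
  obtain ⟨s, hs, hsd, hsd'⟩ := exists_std hd hd' hgd hgd' hdd (g.lt_iff_lt.2 hdd) h1 h2
  have e1 : (g⁻¹ * s : ℝ ≃o ℝ) d = d := by rw [RelIso.mul_apply, hsd, RelIso.inv_apply_self]
  have e2 : (g⁻¹ * s : ℝ ≃o ℝ) d' = d' := by rw [RelIso.mul_apply, hsd', RelIso.inv_apply_self]
  obtain ⟨f, hf, hfs⟩ := exists_restrict (P := P) (mul_mem (inv_mem h.mem) ⟨_, hs⟩) hdd e1 e2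
    ⟨_, hd⟩ ⟨_, hd'⟩ (hfix d ⟨le_rfl, hdd.le⟩) (hfix d' ⟨hdd.le, le_rfl⟩) (fun q hq t ht => by
      rw [hfix t ht q hq, hfix _ ⟨?_, ?_⟩ q hq]
      · have := (g⁻¹ * s : ℝ ≃o ℝ).le_iff_le.2 ht.1
        rwa [e1] at this
      · have := (g⁻¹ * s : ℝ ≃o ℝ).le_iff_le.2 ht.2
        rwa [e2] at this)
  refine ⟨f, hf, fun t ht => (hs.fine t).congr ?_⟩
  filter_upwards [Ioo_mem_nhds ht.1 ht.2] with x hx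
  rw [RelIso.mul_apply, hfs x ⟨hx.1.le, hx.2.le⟩, RelIso.mul_apply, RelIso.apply_inv_self]

/-! ### Assembling the blocks -/

theorem finite_Dy_Icc (N : ℕ) : ((Dy N : Set ℝ) ∩ Icc 0 1).Finite := by
  have : (Dy N : Set ℝ) ∩ Icc 0 1 ⊆ (fun m : ℕ => (m : ℝ) / 2 ^ N) '' (Finset.range (2 ^ N + 1)) := by
    rintro x ⟨⟨m, hm⟩, h0, h1⟩
    have h2 : (0 : ℝ) < 2 ^ N := by positivity
    have hm0 : 0 ≤ m := by
      have : (0 : ℝ) ≤ m := by rw [← hm]; positivity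
      exact_mod_cast this
    have hm1 : m ≤ 2 ^ N := by
      have : (m : ℝ) ≤ 2 ^ N := by rw [← hm]; nlinarith
      exact_mod_cast this
    lift m to ℕ using hm0
    refine ⟨m, ?_, ?_⟩
    · simp only [Finset.coe_range, mem_Iio]
      have : m ≤ 2 ^ N := by exact_mod_cast hm1
      omega
    · simp only
      rw [div_eq_iff h2.ne', hm]
      rfl
  exact (((Finset.range (2 ^ N + 1)).finite_toSet).image _).subset this

theorem supportedCentralizer_mono {d d' e e' : ℝ} (h1 : e ≤ d) (h2 : d' ≤ e') :
    supportedCentralizer P d d' ≤ supportedCentralizer P e e' := by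
  rintro f ⟨hf1, hf2, hf3⟩
  exact ⟨hf1, fun t ht => hf2 t (ht.imp (fun h => h.trans h1) fun h => h2.trans h), hf3⟩

/-- The bound on the conjugator at single points: the summands serve for blocks, for intervals of
common fixed points, and for the points between them. -/
def fineBound (E : ℕ) : ℕ := blockBound E (rigidBound E + E) + stdBound (2 * E) + 2 * E

theorem snd_fix_iff {t : ℝ} : t ∈ FixSet (Prod.snd '' P) ↔ ∀ q ∈ P, q.2 t = t :=
  ⟨fun h q hq => h _ ⟨q, hq, rfl⟩, fun h f hf => by obtain ⟨q, hq, rfl⟩ := hf; exact h q hq⟩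

theorem ConjData.snd_lev (h : ConjData E P g) : ∀ f ∈ Prod.snd '' P, Lev E f := by
  rintro _ ⟨q, hq, rfl⟩
  exact h.lev2 q hq

/-- Dyadic boundary points of the common fixed set are mapped to points with bounded denominators. -/
theorem ConjData.apply_mem_Dy (h : ConjData E P g) {t : ℝ} (ht : t ∈ FixSet (Prod.snd '' P))
    (hti : t ∉ interior (FixSet (Prod.snd '' P))) {N : ℕ} (hN : t ∈ Dy N) : g t ∈ Dy (2 * E) := by
  rw [snd_fix_iff] at ht
  have hsw : ∀ s, (g s ∈ FixSet (Prod.snd '' (Prod.swap ⁻¹' P))) ↔ s ∈ FixSet (Prod.snd '' P) := by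
    intro s
    rw [snd_fix_iff, snd_fix_iff]
    constructor
    · intro h' q hq
      have := h' q.swap hq
      rw [Prod.snd_swap, h.conj q hq] at this
      exact g.injective this
    · intro h' q hq
      have := h' q.swap hq
      rw [← Prod.fst_swap, h.conj _ hq, this]
  have hden : HasDen E (g t) := by
    refine hasDen_of_notMem_interior h.symm.snd_lev ((hsw t).2 (snd_fix_iff.2 ht)) fun hi => hti ?_
    rw [mem_interior]
    refine ⟨g ⁻¹' interior (FixSet (Prod.snd '' (Prod.swap ⁻¹' P))), fun s hs => ?_,
      isOpen_interior.preimage g.continuous, hi⟩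
    exact (hsw s).1 (interior_subset hs)
  obtain ⟨M, hM⟩ := (dyadic_apply_iff h.mem).2 ⟨N, hN⟩
  exact hden.mem_Dy hM

/-- A conjugator can be modified by an element of the centralizer so that it satisfies a bound
depending only on `E` between any two consecutive points among `0`, `1` and the dyadic boundary points
of the common fixed set. -/
theorem ConjData.exists_fine_between (h : ConjData E P g) (hP0 : ∀ q ∈ P, q.2 0 = 0)
    (hP1 : ∀ q ∈ P, q.2 1 = 1) (hg0 : g 0 = 0) (hg1 : g 1 = 1) {W : Set ℝ}
    (hW : W = {t | t = 0 ∨ t = 1 ∨ t ∈ Dy (2 * E) ∧ t ∈ FixSet (Prod.snd '' P) ∧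
      t ∉ interior (FixSet (Prod.snd '' P))}) {d d' : ℝ} (hd : d ∈ W) (hd' : d' ∈ W)
    (hd0 : 0 ≤ d) (hd1 : d' ≤ 1) (hdd : d < d') (hbet : ∀ t ∈ Ioo d d', t ∉ W) :
    ∃ f ∈ supportedCentralizer P d d', ∀ t ∈ Ioo d d', Fine (fineBound E) (g * f) t := by
  have hWfix : ∀ t ∈ W, t ∈ FixSet (Prod.snd '' P) := by
    rw [hW]
    rintro t (rfl | rfl | ht)
    · exact snd_fix_iff.2 hP0
    · exact snd_fix_iff.2 hP1
    · exact ht.2.1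
  have h01 : ∀ N, (1 : ℝ) ∈ Dy N := fun N => by simpa using intCast_mem_Dy 1 N
  have hWD : ∀ t ∈ W, t ∈ Dy (2 * E) := by
    rw [hW]
    rintro t (rfl | rfl | ht)
    · exact zero_mem _
    · exact h01 _
    · exact ht.1
  have hWg : ∀ t ∈ W, g t ∈ Dy (2 * E) := by
    rw [hW]
    rintro t (rfl | rfl | ht)
    · rw [hg0]; exact zero_mem _
    · rw [hg1]; exact h01 _
    · exact h.apply_mem_Dy ht.2.1 ht.2.2 ht.1
  have hgd0 : 0 ≤ g d := by rw [← hg0]; exact g.le_iff_le.2 hd0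
  have hgd1 : g d' ≤ 1 := by rw [← hg1]; exact g.le_iff_le.2 hd1
  by_cases hint : ∃ t ∈ Ioo d d', t ∈ interior (FixSet (Prod.snd '' P))
  · -- the interval consists of common fixed points
    have hsub : Ioo d d' ⊆ interior (FixSet (Prod.snd '' P)) := by
      refine isPreconnected_Ioo.subset_of_closure_inter_subset isOpen_interior hint ?_
      rintro t ⟨htc, ht⟩
      by_contra hti
      have htE : t ∈ Dy E := by
        by_contra htE
        exact hti (mem_interior_FixSet_of_closure h.snd_lev htc htE)
      refine hbet t ht ?_
      rw [hW]
      exact Or.inr (Or.inr ⟨Dy_mono (by omega) htE,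
        (isClosed_FixSet _).closure_subset_iff.2 interior_subset htc, hti⟩)
    obtain ⟨f, hf, hF⟩ := h.exists_fine_of_fixed hdd (hWD d hd) (hWD d' hd') (hWg d hd) (hWg d' hd')
      (by linarith) (by linarith) (fun t ht => by
        rcases eq_or_lt_of_le ht.1 with rfl | h1
        · exact snd_fix_iff.1 (hWfix _ hd)
        rcases eq_or_lt_of_le ht.2 with rfl | h2
        · exact snd_fix_iff.1 (hWfix _ hd')
        exact snd_fix_iff.1 (interior_subset (hsub ⟨h1, h2⟩)))
    exact ⟨f, hf, fun t ht => (hF t ht).mono (by unfold fineBound; omega)⟩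
  · push Not at hint
    have hB : IsBlock E P d d' := by
      refine ⟨hdd, snd_fix_iff.1 (hWfix d hd), snd_fix_iff.1 (hWfix d' hd'), hWD d hd, hWD d' hd',
        fun t ht hfix N hN => hbet t ht ?_⟩
      rw [← snd_fix_iff] at hfix
      rw [hW]
      exact Or.inr (Or.inr ⟨(hasDen_of_notMem_interior h.snd_lev hfix (hint t ht)).mem_Dy hN, hfix,
        hint t ht⟩)
    obtain ⟨f, hf, hF⟩ := hB.exists_fine h (by linarith) (by linarith)
    exact ⟨f, hf, fun t ht => (hF t ht).mono (by unfold fineBound; omega)⟩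

/-- A conjugator can be modified by an element of the centralizer so that it satisfies a bound
depending only on `E`. The intervals are treated one after the other from left to right. -/
theorem ConjData.exists_fine (h : ConjData E P g) (hP0 : ∀ q ∈ P, q.2 0 = 0)
    (hP1 : ∀ q ∈ P, q.2 1 = 1) (hg0 : g 0 = 0) (hg1 : g 1 = 1) :
    ∃ f ∈ supportedCentralizer P 0 1, ∀ t ∈ Ioo 0 1, Fine (fineBound E) (g * f) t := by
  obtain ⟨W, hW⟩ : ∃ W : Set ℝ, W = {t | t = 0 ∨ t = 1 ∨ t ∈ Dy (2 * E) ∧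
    t ∈ FixSet (Prod.snd '' P) ∧ t ∉ interior (FixSet (Prod.snd '' P))} := ⟨_, rfl⟩
  have h0W : (0 : ℝ) ∈ W := by rw [hW]; exact Or.inl rfl
  have h1W : (1 : ℝ) ∈ W := by rw [hW]; exact Or.inr (Or.inl rfl)
  have hWD : ∀ t ∈ W, t ∈ Dy (2 * E) := by
    rw [hW]
    rintro t (rfl | rfl | ht)
    · exact zero_mem _
    · simpa using intCast_mem_Dy 1 (2 * E)
    · exact ht.1
  have hfin : (W ∩ Icc 0 1).Finite :=
    (finite_Dy_Icc (2 * E)).subset fun t ht => ⟨hWD t ht.1, ht.2⟩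
  have key : ∀ n : ℕ, ∀ w ∈ W, 0 ≤ w → w ≤ 1 → (hfin.toFinset.filter (· < w)).card ≤ n →
      ∃ f ∈ supportedCentralizer P 0 w, ∀ t ∈ Ioo 0 w, Fine (fineBound E) (g * f) t := by
    intro n
    induction n with
    | zero =>
      intro w hw hw0 hw1 hcard
      have hw00 : w = 0 := by
        by_contra hne
        have : 0 ∈ hfin.toFinset.filter (· < w) := by
          simp only [Finset.mem_filter, Finite.mem_toFinset]
          exact ⟨⟨h0W, le_rfl, zero_le_one⟩, lt_of_le_of_ne hw0 (Ne.symm hne)⟩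
        have := Finset.card_pos.2 ⟨_, this⟩
        omega
      subst hw00
      exact ⟨1, one_mem _, fun t ht => absurd ht.1 (not_lt.2 ht.2.le)⟩
    | succ n ih =>
      intro w hw hw0 hw1 hcard
      rcases eq_or_lt_of_le hw0 with rfl | hw0
      · exact ⟨1, one_mem _, fun t ht => absurd ht.1 (not_lt.2 ht.2.le)⟩
      have hne : (hfin.toFinset.filter (· < w)).Nonempty := by
        refine ⟨0, ?_⟩
        simp only [Finset.mem_filter, Finite.mem_toFinset]
        exact ⟨⟨h0W, le_rfl, zero_le_one⟩, hw0⟩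
      obtain ⟨d, hd, hmax⟩ : ∃ d ∈ hfin.toFinset.filter (· < w),
          ∀ x ∈ hfin.toFinset.filter (· < w), x ≤ d :=
        ⟨_, Finset.max'_mem _ hne, Finset.le_max' _⟩
      have hd' := hd
      simp only [Finset.mem_filter, Finite.mem_toFinset] at hd'
      obtain ⟨⟨hdW, hd0, hd1⟩, hdw⟩ := hd'
      have hlt : (hfin.toFinset.filter (· < d)).card < (hfin.toFinset.filter (· < w)).card := by
        apply Finset.card_lt_card
        refine ⟨fun x hx => ?_, fun hsub => ?_⟩
        · rw [Finset.mem_filter] at hx ⊢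
          exact ⟨hx.1, hx.2.trans hdw⟩
        · exact absurd (Finset.mem_filter.1 (hsub hd)).2 (lt_irrefl _)
      obtain ⟨f, hf, hF⟩ := ih d hdW hd0 hd1 (by omega)
      have hf0 := hf.2.1 0 (Or.inl le_rfl)
      have hf1 := hf.2.1 1 (Or.inr hd1)
      obtain ⟨f', hf', hF'⟩ := (h.mul hf).exists_fine_between hP0 hP1
        (by rw [RelIso.mul_apply, hf0, hg0]) (by rw [RelIso.mul_apply, hf1, hg1]) hW hdW hw hd0 hw1
        hdw (fun t ht htW => by
          have := hmax t (by
            simp only [Finset.mem_filter, Finite.mem_toFinset]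
            exact ⟨⟨htW, hd0.trans ht.1.le, ht.2.le.trans hw1⟩, ht.2⟩)
          exact absurd ht.1 (not_lt.2 this))
      refine ⟨f * f', mul_mem (supportedCentralizer_mono le_rfl hdw.le hf)
        (supportedCentralizer_mono hd0 le_rfl hf'), fun t ht => ?_⟩
      rw [← mul_assoc]
      rcases lt_trichotomy t d with htd | rfl | htd
      · refine (hF t ⟨ht.1, htd⟩).congr ?_
        filter_upwards [Iio_mem_nhds htd] with x hx
        rw [RelIso.mul_apply, hf'.2.1 x (Or.inl (le_of_lt hx))]
      · exact Or.inl (Dy_mono (by unfold fineBound; omega) (hWD t hdW))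
      · exact hF' t ⟨htd, ht.2⟩
  exact key _ 1 h1W zero_le_one le_rfl le_rfl

/-! ### From pointwise bounds to a global bound -/

theorem LAff.hasDerivAt {f : ℝ → ℝ} {n : ℤ} {t : ℝ} (h : LAff f n t) :
    HasDerivAt f (2 ^ n) t := by
  have h1 : HasDerivAt (fun x => f t + 2 ^ n * (x - t)) (2 ^ n) t := by
    simpa using (((hasDerivAt_id t).sub_const t).const_mul ((2 : ℝ) ^ n)).const_add (f t)
  refine h1.congr_of_eventuallyEq ?_
  filter_upwards [h] with x hx
  linarith

theorem LAff.eventually {f : ℝ → ℝ} {n : ℤ} {t : ℝ} (h : LAff f n t) :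
    ∀ᶠ x in 𝓝 t, LAff f n x := by
  filter_upwards [eventually_eventually_nhds.2 h] with x hx
  have hxx := hx.self_of_nhds
  filter_upwards [hx] with y hy
  linear_combination hy - hxx

/-- A homeomorphism that is locally affine on an interval is affine there. -/
theorem exists_affOn_of_forall_lAff {a b : ℝ} (hab : a < b) {B : ℕ}
    (h : ∀ t ∈ Ioo a b, ∃ n : ℤ, |n| ≤ B ∧ LAff g n t) :
    ∃ n : ℤ, |n| ≤ B ∧ AffOn g n (Icc a b) := by
  obtain ⟨c, hc⟩ := exists_between hab
  obtain ⟨n, hn, hcn⟩ := h c hc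
  refine ⟨n, hn, ?_⟩
  have hopen : IsOpen {t | LAff g n t} := by
    rw [isOpen_iff_mem_nhds]
    exact fun t ht => LAff.eventually ht
  have hsub : Ioo a b ⊆ {t | LAff g n t} := by
    refine isPreconnected_Ioo.subset_of_closure_inter_subset hopen ⟨c, hc, hcn⟩ ?_
    rintro t ⟨htc, ht⟩
    obtain ⟨m, -, hm⟩ := h t ht
    obtain ⟨x, hx1, hx2⟩ := mem_closure_iff_nhds.1 htc _ hm.eventually
    have : m = n := LAff.unique hx1 hx2
    rwa [this] at hm
  have key : ∀ x ∈ Icc a b, ∀ y ∈ Icc a b, x < y → g y - g x = 2 ^ n * (y - x) := by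
    intro x hx y hy hxy
    obtain ⟨z, hz, hz'⟩ := exists_hasDerivAt_eq_slope g (fun _ => (2 : ℝ) ^ n) hxy
      g.continuous.continuousOn
      fun t ht => LAff.hasDerivAt (hsub ⟨hx.1.trans_lt ht.1, ht.2.trans_le hy.2⟩)
    rw [hz', div_mul_cancel₀]
    linarith
  intro x hx y hy
  rcases lt_trichotomy x y with hxy | rfl | hxy
  · exact key x hx y hy hxy
  · simp
  · linear_combination -key y hy x hx hxy

/-- The bound `N` in `Lev N g` for a homeomorphism `g` of `[0, 1]` all of whose points satisfy
`Fine B g`. There are at most `2 * (2 ^ B + 1)` exceptional points, and each costs `B`. -/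
def levBound (B : ℕ) : ℕ := B + 2 * (2 ^ B + 1) * B

/-- If each breakpoint of `g` or its image has a denominator at most `2 ^ B`, and if the slopes are
bounded, then the denominators of both coordinates can be bounded successively from left to right. -/
theorem lev_of_fine {B : ℕ} (h0 : ∀ t, t ≤ 0 → g t = t) (h1 : ∀ t, 1 ≤ t → g t = t)
    (hF : ∀ t ∈ Ioo 0 1, Fine B g t) : Lev (levBound B) g := by
  classical
  have hg0 := h0 0 le_rfl
  have hg1 := h1 1 le_rfl
  set A : Finset ℝ := (Finset.range (2 ^ B + 1)).image fun m : ℕ => (m : ℝ) / 2 ^ B with hA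
  have hAmem : ∀ x ∈ Dy B, x ∈ Icc (0 : ℝ) 1 → x ∈ A := by
    rintro x ⟨m, hm⟩ ⟨hx0, hx1⟩
    have h2 : (0 : ℝ) < 2 ^ B := by positivity
    have hm0 : 0 ≤ m := by
      have : (0 : ℝ) ≤ m := by rw [← hm]; positivity
      exact_mod_cast this
    have hm1 : m ≤ 2 ^ B := by
      have : (m : ℝ) ≤ 2 ^ B := by rw [← hm]; nlinarith
      exact_mod_cast this
    lift m to ℕ using hm0
    refine Finset.mem_image.2 ⟨m, Finset.mem_range.2 ?_, ?_⟩
    · have : m ≤ 2 ^ B := by exact_mod_cast hm1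
      omega
    · rw [div_eq_iff h2.ne', hm]
      rfl
  have hADy : ∀ x ∈ A, x ∈ Dy B := by
    intro x hx
    obtain ⟨m, -, rfl⟩ := Finset.mem_image.1 hx
    have := div_two_pow_mem_Dy (m : ℤ) B
    rwa [Int.cast_natCast] at this
  set X : Finset ℝ := A ∪ A.image g.symm with hX
  have hXcard : X.card ≤ 2 * (2 ^ B + 1) := by
    have hAc : A.card ≤ 2 ^ B + 1 := by
      simpa using Finset.card_image_le (s := Finset.range (2 ^ B + 1))
        (f := fun m : ℕ => (m : ℝ) / 2 ^ B)
    have := Finset.card_union_le A (A.image g.symm)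
    have := Finset.card_image_le (s := A) (f := g.symm)
    rw [hX]
    omega
  have hXDy : ∀ x ∈ X, x ∈ Dy B ∨ g x ∈ Dy B := by
    intro x hx
    rcases Finset.mem_union.1 hx with hx | hx
    · exact Or.inl (hADy x hx)
    · obtain ⟨y, hy, rfl⟩ := Finset.mem_image.1 hx
      exact Or.inr (by rw [g.apply_symm_apply]; exact hADy y hy)
  have hgI : ∀ x ∈ Icc (0 : ℝ) 1, g x ∈ Icc (0 : ℝ) 1 := fun x hx =>
    ⟨by rw [← hg0]; exact g.le_iff_le.2 hx.1, by rw [← hg1]; exact g.le_iff_le.2 hx.2⟩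
  have hXmem : ∀ x ∈ Icc (0 : ℝ) 1, x ∈ Dy B ∨ g x ∈ Dy B → x ∈ X := by
    rintro x hx (h | h)
    · exact Finset.mem_union_left _ (hAmem x h hx)
    · refine Finset.mem_union_right _ (Finset.mem_image.2 ⟨g x, hAmem _ h (hgI x hx), ?_⟩)
      rw [g.symm_apply_apply]
  have h0X : (0 : ℝ) ∈ X := hXmem 0 ⟨le_rfl, zero_le_one⟩ (Or.inl (zero_mem _))
  have hpiece : ∀ a b : ℝ, 0 ≤ a → b ≤ 1 → a < b → (∀ x ∈ Ioo a b, x ∉ X) →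
      ∃ n : ℤ, |n| ≤ B ∧ AffOn g n (Icc a b) := by
    intro a b ha hb hab hXab
    refine exists_affOn_of_forall_lAff hab fun t ht => ?_
    have ht01 : t ∈ Ioo (0 : ℝ) 1 := ⟨ha.trans_lt ht.1, ht.2.trans_le hb⟩
    have htX := fun h => hXab t ht (hXmem t ⟨ht01.1.le, ht01.2.le⟩ h)
    rcases hF t ht01 with h | h | h
    · exact absurd (Or.inl h) htX
    · exact absurd (Or.inr h) htX
    · exact h
  -- the exceptional point preceding `t`
  have hpred : ∀ t : ℝ, 0 < t → t ≤ 1 → ∃ s ∈ X, 0 ≤ s ∧ s < t ∧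
      (X.filter (· < s)).card < (X.filter (· < t)).card ∧
      ∃ n : ℤ, |n| ≤ B ∧ AffOn g n (Icc s t) := by
    intro t ht0 ht1
    have hne : (X.filter (· < t)).Nonempty := ⟨0, Finset.mem_filter.2 ⟨h0X, ht0⟩⟩
    obtain ⟨s, hs, hmax⟩ : ∃ s ∈ X.filter (· < t), ∀ x ∈ X.filter (· < t), x ≤ s :=
      ⟨_, Finset.max'_mem _ hne, Finset.le_max' _⟩
    obtain ⟨hsX, hst⟩ := Finset.mem_filter.1 hs
    have hs0 : 0 ≤ s := hmax 0 (Finset.mem_filter.2 ⟨h0X, ht0⟩)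
    refine ⟨s, hsX, hs0, hst, ?_, hpiece s t hs0 ht1 hst fun x hx hxX => ?_⟩
    · apply Finset.card_lt_card
      refine ⟨fun x hx => ?_, fun hsub => ?_⟩
      · rw [Finset.mem_filter] at hx ⊢
        exact ⟨hx.1, hx.2.trans hst⟩
      · exact absurd (Finset.mem_filter.1 (hsub hs)).2 (lt_irrefl _)
    · exact absurd (hmax x (Finset.mem_filter.2 ⟨hxX, hx.2⟩)) (not_le.2 hx.1)
  -- induction on the number of exceptional points to the left of `t`
  have key : ∀ r : ℕ, ∀ t ∈ X, 0 ≤ t → t ≤ 1 → (X.filter (· < t)).card ≤ r →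
      t ∈ Dy (B + r * B) ∧ g t ∈ Dy (B + r * B) := by
    intro r
    induction r with
    | zero =>
      intro t ht ht0 ht1 hcard
      rcases eq_or_lt_of_le ht0 with rfl | ht0
      · rw [hg0]; exact ⟨zero_mem _, zero_mem _⟩
      · have h0t : (0 : ℝ) ∈ X.filter (· < t) := Finset.mem_filter.2 ⟨h0X, ht0⟩
        have := Finset.card_pos.2 ⟨0, h0t⟩
        omega
    | succ r ih =>
      intro t ht ht0 ht1 hcard
      rcases eq_or_lt_of_le ht0 with rfl | ht0
      · rw [hg0]; exact ⟨zero_mem _, zero_mem _⟩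
      obtain ⟨s, hs, hs0, hst, hc, n, hn, hAff⟩ := hpred t ht0 ht1
      obtain ⟨hs1, hs2⟩ := ih s hs hs0 (hst.le.trans ht1) (by omega)
      have hst' := hAff s ⟨le_rfl, hst.le⟩ t ⟨hst.le, le_rfl⟩
      have hn' := abs_le.1 hn
      have hle : B + (r + 1) * B = B + r * B + B := by ring
      rw [hle]
      rcases hXDy t ht with h | h
      · refine ⟨Dy_mono (by omega) h, ?_⟩
        have h3 : g t = 2 ^ n * (t - s) + g s := by linarith
        rw [h3]
        exact (Dy _).add_mem (two_zpow_mul_mem_Dy ((Dy _).sub_mem (Dy_mono (by omega) h) hs1)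
          (by omega)) (Dy_mono (by omega) hs2)
      · refine ⟨?_, Dy_mono (by omega) h⟩
        have h3 : t = 2 ^ (-n) * (g t - g s) + s := by
          rw [hst', ← mul_assoc, ← zpow_add₀ two_ne_zero]
          simp
        rw [h3]
        exact (Dy _).add_mem (two_zpow_mul_mem_Dy ((Dy _).sub_mem (Dy_mono (by omega) h) hs2)
          (by omega)) (Dy_mono (by omega) hs1)
  have hXlev : ∀ t ∈ X, 0 ≤ t → t ≤ 1 → t ∈ Dy (levBound B) ∧ g t ∈ Dy (levBound B) := by
    intro t ht ht0 ht1
    exact key _ t ht ht0 ht1 ((Finset.card_filter_le _ _).trans hXcard)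
  have hBl : B ≤ levBound B := by unfold levBound; omega
  refine ⟨fun a b hab hD => ?_, fun x hx => ?_⟩
  · have h0ab : (0 : ℝ) ∉ Ioo a b := fun h => hD 0 h (zero_mem _)
    have h1ab : (1 : ℝ) ∉ Ioo a b := fun h => hD 1 h (by simpa using intCast_mem_Dy 1 _)
    rcases le_or_gt b 0 with hb | hb
    · refine ⟨0, by simp, fun x hx y hy => ?_⟩
      rw [h0 x (hx.2.trans hb), h0 y (hy.2.trans hb)]
      simp
    rcases le_or_gt 1 a with ha | ha
    · refine ⟨0, by simp, fun x hx y hy => ?_⟩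
      rw [h1 x (ha.trans hx.1), h1 y (ha.trans hy.1)]
      simp
    have ha0 : 0 ≤ a := by
      by_contra! hcon
      exact h0ab ⟨hcon, hb⟩
    have hb1 : b ≤ 1 := by
      by_contra! hcon
      exact h1ab ⟨ha, hcon⟩
    obtain ⟨n, hn, hAff⟩ := hpiece a b ha0 hb1 hab fun x hx hxX =>
      hD x hx (hXlev x hxX (ha0.trans hx.1.le) (hx.2.le.trans hb1)).1
    exact ⟨n, hn.trans (by exact_mod_cast hBl), hAff⟩
  · rcases le_or_gt x 0 with hx0 | hx0
    · rw [h0 x hx0]; exact Dy_mono (by omega) hx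
    rcases le_or_gt 1 x with hx1 | hx1
    · rw [h1 x hx1]; exact Dy_mono (by omega) hx
    obtain ⟨s, hs, hs0, hsx, -, n, hn, hAff⟩ := hpred x hx0 hx1.le
    obtain ⟨hs1, hs2⟩ := hXlev s hs hs0 (hsx.le.trans hx1.le)
    have h3 := hAff s ⟨le_rfl, hsx.le⟩ x ⟨hsx.le, le_rfl⟩
    have h4 : g x = 2 ^ n * (x - s) + g s := by linarith
    rw [h4, two_mul]
    refine (Dy _).add_mem (two_zpow_mul_mem_Dy ((Dy _).sub_mem hx hs1) ?_)
      (Dy_mono (by omega) hs2)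
    have := (abs_le.1 hn).1
    omega

/-- The bound on the breakpoints and slopes of some conjugator, if there is one. -/
def conjBound (E : ℕ) : ℕ := levBound (fineBound E)

/-- If two tuples are conjugate by a homeomorphism of `[0, 1]`, then they are conjugate by one with
bounded breakpoints and slopes. -/
theorem ConjData.exists_lev (h : ConjData E P g) (hP0 : ∀ q ∈ P, q.2 0 = 0)
    (hP1 : ∀ q ∈ P, q.2 1 = 1) (hg : ∀ t, t ≤ 0 ∨ 1 ≤ t → g t = t) :
    ∃ f, Lev (conjBound E) f ∧ (∀ t, t ≤ 0 ∨ 1 ≤ t → f t = t) ∧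
      ∀ q ∈ P, ∀ t, q.1 (f t) = f (q.2 t) := by
  obtain ⟨f, hf, hF⟩ := h.exists_fine hP0 hP1 (hg 0 (Or.inl le_rfl)) (hg 1 (Or.inr le_rfl))
  have hid : ∀ t, t ≤ 0 ∨ 1 ≤ t → (g * f : ℝ ≃o ℝ) t = t := fun t ht => by
    rw [RelIso.mul_apply, hf.2.1 t ht, hg t ht]
  exact ⟨g * f, lev_of_fine (fun t ht => hid t (Or.inl ht)) (fun t ht => hid t (Or.inr ht)) hF, hid,
    (h.mul hf).conj⟩

/-! ### Thompson's group as a group of homeomorphisms of the line -/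

theorem thompson_strictMono (f : ThompsonF) : StrictMono f.1 := f.2.1

/-- The extension of an element of `F` by the identity to a homeomorphism of the line. -/
noncomputable def extend (f : ThompsonF) : ℝ ≃o ℝ := by
  classical
  exact StrictMono.orderIsoOfSurjective
    (fun t => if h : t ∈ Icc (0 : ℝ) 1 then (f.1 ⟨t, h⟩ : ℝ) else t)
    (by
      intro x y hxy
      simp only
      split_ifs with h1 h2 h2
      · exact thompson_strictMono f (show (⟨x, h1⟩ : unitInterval) < ⟨y, h2⟩ from hxy)
      · have h3 : 1 < y := by
          by_contra! hcon
          exact h2 ⟨h1.1.trans hxy.le, hcon⟩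
        exact (f.1 ⟨x, h1⟩).2.2.trans_lt h3
      · have h3 : x < 0 := by
          by_contra! hcon
          exact h1 ⟨hcon, hxy.le.trans h2.2⟩
        exact h3.trans_le (f.1 ⟨y, h2⟩).2.1
      · exact hxy)
    (by
      intro y
      by_cases hy : y ∈ Icc (0 : ℝ) 1
      · refine ⟨f.1.symm ⟨y, hy⟩, ?_⟩
        have h1 : ((f.1.symm ⟨y, hy⟩ : unitInterval) : ℝ) ∈ Icc (0 : ℝ) 1 := (f.1.symm ⟨y, hy⟩).2
        simp only [Subtype.coe_eta, Homeomorph.apply_symm_apply]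
        exact dif_pos h1
      · exact ⟨y, dif_neg hy⟩)

theorem extend_coe (f : ThompsonF) (t : unitInterval) : extend f t = f.1 t := dif_pos t.2

theorem extend_of_notMem (f : ThompsonF) {t : ℝ} (ht : t ≤ 0 ∨ 1 ≤ t) : extend f t = t := by
  by_cases h : t ∈ Icc (0 : ℝ) 1
  · rcases ht with ht | ht
    · have : t = ((0 : unitInterval) : ℝ) := le_antisymm ht h.1
      rw [this, extend_coe, strictMono_homeo_zero (thompson_strictMono f)]
    · have : t = ((1 : unitInterval) : ℝ) := le_antisymm h.2 ht
      rw [this, extend_coe, strictMono_homeo_one (thompson_strictMono f)]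
  · exact dif_neg h

theorem extend_mul (f g : ThompsonF) : extend (f * g) = extend f * extend g := by
  ext t
  rw [RelIso.mul_apply]
  by_cases h : t ∈ Icc (0 : ℝ) 1
  · lift t to unitInterval using h
    rw [extend_coe, extend_coe, extend_coe]
    rfl
  · have ht : t ≤ 0 ∨ 1 ≤ t := by
      by_contra! hcon
      exact h ⟨hcon.1.le, hcon.2.le⟩
    rw [extend_of_notMem _ ht, extend_of_notMem _ ht, extend_of_notMem _ ht]

theorem extend_injective : Function.Injective extend := by
  intro f g h
  refine Subtype.ext (Homeomorph.ext fun t => Subtype.ext ?_)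
  rw [← extend_coe, ← extend_coe, h]

/-- Homeomorphisms of the line in `levGroup` that fix `0` and `1` restrict to elements of `F`. -/
theorem exists_thompson {φ : ℝ ≃o ℝ} (hφ : φ ∈ levGroup) (h0 : φ 0 = 0) (h1 : φ 1 = 1) :
    ∃ f : ThompsonF, ∀ t : unitInterval, (f.1 t : ℝ) = φ t := by
  have hI : ∀ t ∈ Icc (0 : ℝ) 1, φ t ∈ Icc (0 : ℝ) 1 := fun t ht =>
    ⟨by rw [← h0]; exact φ.le_iff_le.2 ht.1, by rw [← h1]; exact φ.le_iff_le.2 ht.2⟩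
  have hI' : ∀ t ∈ Icc (0 : ℝ) 1, φ.symm t ∈ Icc (0 : ℝ) 1 := fun t ht => by
    constructor
    · rw [← φ.le_iff_le, φ.apply_symm_apply, h0]; exact ht.1
    · rw [← φ.le_iff_le, φ.apply_symm_apply, h1]; exact ht.2
  let ψ : unitInterval ≃o unitInterval :=
    { toFun := fun t => ⟨φ t, hI t t.2⟩
      invFun := fun t => ⟨φ.symm t, hI' t t.2⟩
      left_inv := fun t => Subtype.ext (φ.symm_apply_apply _)
      right_inv := fun t => Subtype.ext (φ.apply_symm_apply _)
      map_rel_iff' := fun {x y} => by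
        change φ x ≤ φ y ↔ x ≤ y
        rw [φ.le_iff_le]
        exact Iff.rfl }
  obtain ⟨N, hN⟩ := hφ
  have hfin : {b : unitInterval | (b : ℝ) ∈ Dy N}.Finite :=
    Set.Finite.subset ((finite_Dy_Icc N).preimage (f := fun b : unitInterval => (b : ℝ))
      Subtype.val_injective.injOn) fun b hb => ⟨hb, b.2⟩
  refine ⟨⟨ψ.toHomeomorph, ψ.strictMono, hfin.toFinset, fun b hb => ?_, fun u v huv hav => ?_⟩,
    fun t => rfl⟩
  · exact isDyadic_iff.2 ⟨N, by simpa using hb⟩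
  · obtain ⟨n, -, hA⟩ := hN.1 u v huv (by
      intro x hx hxN
      exact hav ⟨x, u.2.1.trans hx.1.le, hx.2.le.trans v.2.2⟩ (by simpa using hxN) hx)
    refine ⟨n, φ u - 2 ^ n * u, fun t ht => ?_⟩
    have := hA u ⟨le_rfl, huv.le⟩ t ht
    change φ t = _
    linarith

/-! ### Codes of elements of Thompson's group -/

/-- The points `p` and `q` are consecutive members of the list `l`. -/
def CodeStep (l : List (ℕ × ℕ)) (p q : ℕ × ℕ) : Prop :=
  ∃ i, i + 1 < l.length ∧ l.getD i (0, 0) = p ∧ l.getD (i + 1) (0, 0) = q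

theorem isChain_iff_codeStep {R : ℕ × ℕ → ℕ × ℕ → Prop} {l : List (ℕ × ℕ)} :
    l.IsChain R ↔ ∀ p q, CodeStep l p q → R p q := by
  rw [List.isChain_iff_getElem]
  constructor
  · rintro h p q ⟨i, hi, rfl, rfl⟩
    rw [List.getD_eq_getElem _ _ (by omega), List.getD_eq_getElem _ _ hi]
    exact h i hi
  · intro h i hi
    refine h _ _ ⟨i, hi, ?_, ?_⟩
    · rw [List.getD_eq_getElem _ _ (by omega)]
    · rw [List.getD_eq_getElem _ _ hi]

theorem not_codeStep_singleton {a p q : ℕ × ℕ} : ¬CodeStep [a] p q := by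
  rintro ⟨i, hi, -⟩
  simp at hi

theorem codeStep_cons_cons {a b p q : ℕ × ℕ} {l : List (ℕ × ℕ)} :
    CodeStep (a :: b :: l) p q ↔ (a = p ∧ b = q) ∨ CodeStep (b :: l) p q := by
  constructor
  · rintro ⟨_ | i, hi, h1, h2⟩
    · exact Or.inl ⟨by simpa using h1, by simpa using h2⟩
    · exact Or.inr ⟨i, by simpa using hi, by simpa using h1, by simpa using h2⟩
  · rintro (⟨rfl, rfl⟩ | ⟨i, hi, h1, h2⟩)
    · exact ⟨0, by simp, by simp, by simp⟩
    · exact ⟨i + 1, by simpa using hi, by simpa using h1, by simpa using h2⟩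

theorem codeStep_le {φ : ℕ × ℕ → ℕ} : ∀ {l : List (ℕ × ℕ)} {a b : ℕ × ℕ},
    (∀ p q, CodeStep (a :: l) p q → φ p ≤ φ q) → (a :: l).getLast? = some b →
      φ a ≤ φ b ∧ ∀ p q, CodeStep (a :: l) p q → φ a ≤ φ p ∧ φ q ≤ φ b
  | [], a, b, _, hb => by
    obtain rfl : a = b := by simpa using hb
    exact ⟨le_rfl, fun p q h => absurd h not_codeStep_singleton⟩
  | a' :: l, a, b, h, hb => by
    have h1 := h a a' (codeStep_cons_cons.2 (Or.inl ⟨rfl, rfl⟩))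
    obtain ⟨h2, h3⟩ := codeStep_le (l := l) (a := a') (b := b)
      (fun p q hpq => h p q (codeStep_cons_cons.2 (Or.inr hpq))) (by simpa using hb)
    refine ⟨h1.trans h2, fun p q hpq => ?_⟩
    rcases codeStep_cons_cons.1 hpq with ⟨rfl, rfl⟩ | hpq
    · exact ⟨le_rfl, h2⟩
    · exact ⟨h1.trans (h3 p q hpq).1, (h3 p q hpq).2⟩

/-- The segments of a chain cover the interval between its first and its last point. -/
theorem exists_codeStep : ∀ {l : List (ℕ × ℕ)} {a b : ℕ × ℕ}, (a :: l).getLast? = some b →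
    ∀ {x : ℝ}, (a.1 : ℝ) < x → x ≤ b.1 → ∃ p q, CodeStep (a :: l) p q ∧ (p.1 : ℝ) < x ∧ x ≤ q.1
  | [], a, b, hb, x, h1, h2 => by
    obtain rfl : a = b := by simpa using hb
    linarith
  | a' :: l, a, b, hb, x, h1, h2 => by
    rcases le_or_gt x a'.1 with h | h
    · exact ⟨a, a', codeStep_cons_cons.2 (Or.inl ⟨rfl, rfl⟩), h1, h⟩
    · obtain ⟨p, q, hpq, h3⟩ := exists_codeStep (l := l) (a := a') (b := b) (by simpa using hb) h h2
      exact ⟨p, q, codeStep_cons_cons.2 (Or.inr hpq), h3⟩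

/-- The segments of a code that represents an element of `F`. The definition of a code does not demand
that the slopes are powers of two; this follows because a segment contains an interval without
breakpoints of `f`. -/
theorem PLCode.Represents.step {c : PLCode} {f : ThompsonF} (hc : c.Represents f) {p q : ℕ × ℕ}
    (h : CodeStep c.2 p q) : p.1 < q.1 ∧ q.1 ≤ 2 ^ c.1 ∧ p.2 < q.2 ∧ q.2 ≤ 2 ^ c.1 ∧
      ∃ n : ℤ, |n| ≤ c.1 ∧ (q.2 : ℝ) - p.2 = 2 ^ n * (q.1 - p.1) ∧
        extend f (p.1 / 2 ^ c.1) = p.2 / 2 ^ c.1 ∧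
        AffOn (extend f) n (Icc (p.1 / 2 ^ c.1) (q.1 / 2 ^ c.1)) := by
  obtain ⟨e, l⟩ := c
  obtain ⟨h0, h1, hch⟩ := hc
  rw [isChain_iff_codeStep] at hch
  simp only at h h0 h1 hch ⊢
  have h2e : (0 : ℝ) < 2 ^ e := by positivity
  have hle : q.1 ≤ 2 ^ e := by
    cases l with
    | nil => simp at h0
    | cons a l =>
      exact ((codeStep_le (φ := Prod.fst) (fun p q hpq => (hch p q hpq).1.le) h1).2 p q h).2
  obtain ⟨hpq, hrel⟩ := hch p q h
  have hle' : (q.1 : ℝ) ≤ 2 ^ e := by exact_mod_cast hle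
  have hpq' : (p.1 : ℝ) < q.1 := by exact_mod_cast hpq
  have hrel' : ∀ x : ℝ, (p.1 : ℝ) / 2 ^ e ≤ x → x ≤ q.1 / 2 ^ e →
      (2 ^ e * extend f x - p.2) * ((q.1 : ℝ) - p.1) = ((q.2 : ℝ) - p.2) * (2 ^ e * x - p.1) := by
    intro x hx1 hx2
    have hx0 : 0 ≤ x := le_trans (by positivity) hx1
    have hx3 : x ≤ 1 := hx2.trans ((div_le_one h2e).2 hle')
    rw [div_le_iff₀ h2e] at hx1
    rw [le_div_iff₀ h2e] at hx2
    have := hrel ⟨x, hx0, hx3⟩ (by simp only; linarith) (by simp only; linarith)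
    rwa [← extend_coe] at this
  have hpe : (p.1 : ℝ) / 2 ^ e ≤ q.1 / 2 ^ e := by gcongr
  have hd : (q.1 : ℝ) - p.1 ≠ 0 := (sub_pos.2 hpq').ne'
  have hfp : extend f (p.1 / 2 ^ e) = p.2 / 2 ^ e := by
    have := hrel' (p.1 / 2 ^ e) le_rfl hpe
    rw [mul_div_cancel₀ _ h2e.ne', sub_self, mul_zero] at this
    rw [eq_div_iff h2e.ne']
    linarith [(mul_eq_zero.1 this).resolve_right hd]
  have hfq : extend f (q.1 / 2 ^ e) = q.2 / 2 ^ e := by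
    have := hrel' (q.1 / 2 ^ e) hpe le_rfl
    rw [mul_div_cancel₀ _ h2e.ne'] at this
    rw [eq_div_iff h2e.ne']
    linarith [mul_right_cancel₀ hd this]
  have hlt : (p.1 : ℝ) / 2 ^ e < q.1 / 2 ^ e := by gcongr
  have hpq2 : p.2 < q.2 := by
    have := (extend f).lt_iff_lt.2 hlt
    rw [hfp, hfq, div_lt_div_iff_of_pos_right h2e] at this
    exact_mod_cast this
  have hq2 : q.2 ≤ 2 ^ e := by
    have := (extend f).le_iff_le.2 ((div_le_one h2e).2 hle')
    rw [hfq, extend_of_notMem f (Or.inr le_rfl), div_le_one h2e] at this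
    exact_mod_cast this
  -- the slope is a power of two because `f` has only finitely many breakpoints
  obtain ⟨n, hn⟩ : ∃ n : ℤ, (q.2 : ℝ) - p.2 = 2 ^ n * (q.1 - p.1) := by
    obtain ⟨B, -, hA⟩ := f.2.2
    have hBfin : ((fun b : unitInterval => (b : ℝ)) '' B).Finite := B.finite_toSet.image _
    obtain ⟨x, hx, hxB⟩ := (Ioo_infinite hlt).exists_notMem_finite hBfin
    have hopen : IsOpen (Ioo ((p.1 : ℝ) / 2 ^ e) (q.1 / 2 ^ e) \ (fun b : unitInterval => (b : ℝ)) '' B) :=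
      isOpen_Ioo.sdiff hBfin.isClosed
    obtain ⟨ε, hε, hball⟩ := Metric.isOpen_iff.1 hopen x ⟨hx, hxB⟩
    have hin : ∀ y, x ≤ y → y < x + ε → y ∈ Ioo ((p.1 : ℝ) / 2 ^ e) (q.1 / 2 ^ e) \
        (fun b : unitInterval => (b : ℝ)) '' B := by
      intro y h3 h4
      apply hball
      rw [Metric.mem_ball, Real.dist_eq, abs_of_nonneg (by linarith)]
      linarith
    have hp0 : (0 : ℝ) ≤ p.1 / 2 ^ e := by positivity
    have hq1 : (q.1 : ℝ) / 2 ^ e ≤ 1 := (div_le_one h2e).2 hle'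
    have hy := hin (x + ε / 2) (by linarith) (by linarith)
    obtain ⟨n, c, hnc⟩ := hA ⟨x, hp0.trans hx.1.le, hx.2.le.trans hq1⟩
      ⟨x + ε / 2, hp0.trans hy.1.1.le, hy.1.2.le.trans hq1⟩
      (show x < x + ε / 2 by linarith) (fun b hb hbI => by
        have h3 : x < (b : ℝ) := hbI.1
        have h4 : (b : ℝ) < x + ε / 2 := hbI.2
        exact (hin b h3.le (by linarith)).2 ⟨b, hb, rfl⟩)
    refine ⟨n, ?_⟩
    have e1 := hnc ⟨x, hp0.trans hx.1.le, hx.2.le.trans hq1⟩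
      ⟨le_rfl, show x ≤ x + ε / 2 by linarith⟩
    have e2 := hnc ⟨x + ε / 2, hp0.trans hy.1.1.le, hy.1.2.le.trans hq1⟩
      ⟨show x ≤ x + ε / 2 by linarith, le_rfl⟩
    rw [← extend_coe] at e1 e2
    simp only at e1 e2
    have r1 := hrel' x hx.1.le hx.2.le
    have r2 := hrel' (x + ε / 2) hy.1.1.le hy.1.2.le
    rw [e1] at r1
    rw [e2] at r2
    have h3 : (2 : ℝ) ^ e * (ε / 2) ≠ 0 := by positivity
    apply mul_right_cancel₀ h3
    linear_combination r1 - r2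
  have hA : AffOn (extend f) n (Icc (p.1 / 2 ^ e) (q.1 / 2 ^ e)) := by
    intro x hx y hy
    have r1 := hrel' x hx.1 hx.2
    have r2 := hrel' y hy.1 hy.2
    rw [hn] at r1 r2
    have h3 : (2 : ℝ) ^ e * ((q.1 : ℝ) - p.1) ≠ 0 := mul_ne_zero h2e.ne' hd
    apply mul_right_cancel₀ h3
    linear_combination r2 - r1
  refine ⟨hpq, hle, hpq2, hq2, n, ?_, hn, hfp, hA⟩
  have b1 : (1 : ℝ) ≤ (q.1 : ℝ) - p.1 := by
    have : (p.1 : ℝ) + 1 ≤ q.1 := by exact_mod_cast hpq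
    linarith
  have b2 : (1 : ℝ) ≤ (q.2 : ℝ) - p.2 := by
    have : (p.2 : ℝ) + 1 ≤ q.2 := by exact_mod_cast hpq2
    linarith
  have b3 : (q.1 : ℝ) - p.1 ≤ 2 ^ e := by
    have : (0 : ℝ) ≤ p.1 := by positivity
    linarith
  have b4 : (q.2 : ℝ) - p.2 ≤ 2 ^ e := by
    have : (0 : ℝ) ≤ p.2 := by positivity
    have : (q.2 : ℝ) ≤ 2 ^ e := by exact_mod_cast hq2
    linarith
  have h2n : (0 : ℝ) < 2 ^ n := by positivity
  rw [abs_le]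
  constructor
  · have h3 : (2 : ℝ) ^ (-(e : ℤ)) ≤ 2 ^ n := by
      rw [zpow_neg, zpow_natCast, inv_le_iff_one_le_mul₀ h2e]
      nlinarith
    exact (zpow_le_zpow_iff_right₀ (by norm_num)).1 h3
  · have h3 : (2 : ℝ) ^ n ≤ 2 ^ (e : ℤ) := by
      rw [zpow_natCast]
      nlinarith
    exact (zpow_le_zpow_iff_right₀ (by norm_num)).1 h3

/-- Every point of `(0, 1]` lies on a segment. -/
theorem PLCode.Represents.exists_step {c : PLCode} {f : ThompsonF} (hc : c.Represents f) {x : ℝ}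
    (h0 : 0 < x) (h1 : x ≤ 1) :
    ∃ p q, CodeStep c.2 p q ∧ (p.1 : ℝ) / 2 ^ c.1 < x ∧ x ≤ q.1 / 2 ^ c.1 := by
  obtain ⟨e, l⟩ := c
  obtain ⟨hh, hl, -⟩ := hc
  simp only at hh hl ⊢
  have h2e : (0 : ℝ) < 2 ^ e := by positivity
  cases l with
  | nil => simp at hh
  | cons a l =>
    obtain rfl : a = (0, 0) := by simpa using hh
    obtain ⟨p, q, hpq, h2, h3⟩ := exists_codeStep hl (x := x * 2 ^ e) (by simp; positivity)
      (by push_cast; nlinarith)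
    exact ⟨p, q, hpq, by rwa [div_lt_iff₀ h2e], by rwa [le_div_iff₀ h2e]⟩

/-- The exponent of the common denominator of a code is a level of the element. -/
theorem PLCode.Represents.lev {c : PLCode} {f : ThompsonF} (hc : c.Represents f) :
    Lev c.1 (extend f) := by
  have h2e : (0 : ℝ) < 2 ^ c.1 := by positivity
  refine ⟨fun a b hab hD => ?_, fun x hx => ?_⟩
  · have h0ab : (0 : ℝ) ∉ Ioo a b := fun h => hD 0 h (zero_mem _)
    have h1ab : (1 : ℝ) ∉ Ioo a b := fun h => hD 1 h (by simpa using intCast_mem_Dy 1 _)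
    rcases le_or_gt b 0 with hb | hb
    · refine ⟨0, by simp, fun x hx y hy => ?_⟩
      rw [extend_of_notMem f (Or.inl (hx.2.trans hb)), extend_of_notMem f (Or.inl (hy.2.trans hb))]
      simp
    rcases le_or_gt 1 a with ha | ha
    · refine ⟨0, by simp, fun x hx y hy => ?_⟩
      rw [extend_of_notMem f (Or.inr (ha.trans hx.1)), extend_of_notMem f (Or.inr (ha.trans hy.1))]
      simp
    have ha0 : 0 ≤ a := by
      by_contra! hcon
      exact h0ab ⟨hcon, hb⟩
    have hb1 : b ≤ 1 := by
      by_contra! hcon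
      exact h1ab ⟨ha, hcon⟩
    obtain ⟨x, hx1, hx2⟩ := exists_between hab
    obtain ⟨p, q, hpq, h2, h3⟩ := hc.exists_step (ha0.trans_lt hx1) (hx2.le.trans hb1)
    obtain ⟨-, -, -, -, n, hn, -, -, hA⟩ := hc.step hpq
    refine ⟨n, hn, hA.mono (Icc_subset_Icc ?_ ?_)⟩
    · by_contra! hcon
      refine hD _ ⟨hcon, h2.trans hx2⟩ ?_
      have := div_two_pow_mem_Dy (p.1 : ℤ) c.1
      rwa [Int.cast_natCast] at this
    · by_contra! hcon
      refine hD _ ⟨hx1.trans_le h3, hcon⟩ ?_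
      have := div_two_pow_mem_Dy (q.1 : ℤ) c.1
      rwa [Int.cast_natCast] at this
  · rcases le_or_gt x 0 with hx0 | hx0
    · rw [extend_of_notMem f (Or.inl hx0)]; exact Dy_mono (by omega) hx
    rcases le_or_gt 1 x with hx1 | hx1
    · rw [extend_of_notMem f (Or.inr hx1)]; exact Dy_mono (by omega) hx
    obtain ⟨p, q, hpq, h2, h3⟩ := hc.exists_step hx0 hx1.le
    obtain ⟨h4, -, -, -, n, hn, -, hfp, hA⟩ := hc.step hpq
    have hq := hA _ ⟨le_rfl, h2.le.trans h3⟩ x ⟨h2.le, h3⟩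
    rw [hfp] at hq
    have h5 : extend f x = 2 ^ n * (x - p.1 / 2 ^ c.1) + p.2 / 2 ^ c.1 := by linarith
    have hp1 := div_two_pow_mem_Dy (p.1 : ℤ) c.1
    have hp2 := div_two_pow_mem_Dy (p.2 : ℤ) c.1
    rw [Int.cast_natCast] at hp1 hp2
    rw [h5, two_mul]
    exact (Dy _).add_mem (two_zpow_mul_mem_Dy ((Dy _).sub_mem hx hp1) (abs_le.1 hn).1)
      (Dy_mono (by omega) hp2)

/-! ### Validity of codes -/

/-- The combinatorial conditions on a code to represent an element of `F`. The slope condition is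
written with multiplications of natural numbers only; the subtractions in it are harmless because
a truncated one contradicts the strict monotonicity of the first coordinates. -/
def ValidCode (c : PLCode) : Prop :=
  0 < c.2.length ∧ c.2.getD 0 (0, 0) = (0, 0) ∧
    c.2.getD (c.2.length - 1) (0, 0) = (2 ^ c.1, 2 ^ c.1) ∧
    ∀ i < c.2.length - 1, (c.2.getD i (0, 0)).1 < (c.2.getD (i + 1) (0, 0)).1 ∧
      ∃ a < c.1 + 1,
        ((c.2.getD (i + 1) (0, 0)).2 = (c.2.getD i (0, 0)).2 +
            ((c.2.getD (i + 1) (0, 0)).1 - (c.2.getD i (0, 0)).1) * 2 ^ a ∨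
          (c.2.getD (i + 1) (0, 0)).1 = (c.2.getD i (0, 0)).1 +
            ((c.2.getD (i + 1) (0, 0)).2 - (c.2.getD i (0, 0)).2) * 2 ^ a)

theorem PLCode.Represents.validCode {c : PLCode} {f : ThompsonF} (hc : c.Represents f) :
    ValidCode c := by
  have hst := fun p q (h : CodeStep c.2 p q) => hc.step h
  obtain ⟨h0, h1, -⟩ := hc
  have hlen : 0 < c.2.length := by
    rcases h : c.2 with _ | ⟨a, l⟩
    · rw [h] at h0; simp at h0
    · simp
  refine ⟨hlen, ?_, ?_, fun i hi => ?_⟩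
  · rw [List.getD_eq_getElem?_getD, ← List.head?_eq_getElem?, h0]; rfl
  · rw [List.getD_eq_getElem?_getD, ← List.getLast?_eq_getElem?, h1]; rfl
  obtain ⟨h2, -, h3, -, n, hn, hsl, -⟩ := hst _ _ ⟨i, by omega, rfl, rfl⟩
  refine ⟨h2, n.natAbs, by have := abs_le.1 hn; omega, ?_⟩
  set p := c.2.getD i (0, 0)
  set q := c.2.getD (i + 1) (0, 0)
  rcases le_total 0 n with h | h
  · left
    have h4 : (2 : ℝ) ^ n = 2 ^ n.natAbs := by
      rw [← zpow_natCast]; congr 1; omega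
    have h5 : (q.2 : ℝ) = ((p.2 + (q.1 - p.1) * 2 ^ n.natAbs : ℕ) : ℝ) := by
      push_cast [Nat.cast_sub h2.le]
      rw [← h4]
      linarith
    exact_mod_cast h5
  · right
    have h4 : (2 : ℝ) ^ n * 2 ^ n.natAbs = 1 := by
      rw [← zpow_natCast, ← zpow_add₀ two_ne_zero]
      rw [show n + (n.natAbs : ℤ) = 0 by omega, zpow_zero]
    have h5 : (q.1 : ℝ) = ((p.1 + (q.2 - p.2) * 2 ^ n.natAbs : ℕ) : ℝ) := by
      push_cast [Nat.cast_sub h3.le]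
      linear_combination -(2 : ℝ) ^ n.natAbs * hsl - ((q.1 : ℝ) - p.1) * h4
    exact_mod_cast h5

/-- A chain of segments whose slopes are powers of two is the graph of a homeomorphism of the line
that is a translation on either side. -/
theorem exists_of_steps (e : ℕ) : ∀ (l : List (ℕ × ℕ)) (a : ℕ × ℕ),
    (∀ p q, CodeStep (a :: l) p q → p.1 < q.1 ∧ ∃ n : ℤ, (q.2 : ℝ) - p.2 = 2 ^ n * (q.1 - p.1)) →
    ∃ φ ∈ levGroup, (∀ t : ℝ, t ≤ a.1 / 2 ^ e → φ t = t + (a.2 / 2 ^ e - a.1 / 2 ^ e)) ∧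
      (∀ b, (a :: l).getLast? = some b →
        ∀ t : ℝ, (b.1 : ℝ) / 2 ^ e ≤ t → φ t = t + (b.2 / 2 ^ e - b.1 / 2 ^ e)) ∧
      ∀ p q, CodeStep (a :: l) p q → ∀ t : ℝ, (p.1 : ℝ) / 2 ^ e ≤ t → t ≤ q.1 / 2 ^ e →
        (2 ^ e * φ t - p.2) * ((q.1 : ℝ) - p.1) = ((q.2 : ℝ) - p.2) * (2 ^ e * t - p.1) := by
  have hdy : ∀ m : ℕ, (m : ℝ) / 2 ^ e ∈ Dy e := fun m => by
    have := div_two_pow_mem_Dy (m : ℤ) e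
    rwa [Int.cast_natCast] at this
  have htr : ∀ a : ℕ × ℕ, affIso 0 ((a.2 : ℝ) / 2 ^ e - a.1 / 2 ^ e) ∈ levGroup := fun a =>
    ⟨e, lev_affIso (by simp) (Dy_mono (by omega) ((Dy e).sub_mem (hdy _) (hdy _)))⟩
  intro l
  induction l with
  | nil =>
    intro a _
    refine ⟨_, htr a, fun t _ => ?_, fun b hb t _ => ?_, fun p q h => absurd h not_codeStep_singleton⟩
    · rw [affIso_apply]; simp
    · obtain rfl : a = b := by simpa using hb
      rw [affIso_apply]; simp
  | cons b l ih =>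
    intro a h
    obtain ⟨φ, hφ, hφ1, hφ2, hφ3⟩ := ih b fun p q hpq => h p q (codeStep_cons_cons.2 (Or.inr hpq))
    obtain ⟨hab, n, hn⟩ := h a b (codeStep_cons_cons.2 (Or.inl ⟨rfl, rfl⟩))
    have h2e : (0 : ℝ) < 2 ^ e := by positivity
    have hab' : (a.1 : ℝ) / 2 ^ e ≤ b.1 / 2 ^ e := by gcongr
    have hα : affIso n ((a.2 : ℝ) / 2 ^ e - 2 ^ n * (a.1 / 2 ^ e)) ∈ levGroup := by
      refine ⟨e + n.natAbs, lev_affIso (by push_cast; omega) ((Dy _).sub_mem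
        (Dy_mono (by omega) (hdy _)) (Dy_mono (N := e + n.natAbs) (by omega)
          (two_zpow_mul_mem_Dy (hdy _) (by omega))))⟩
    have e1 : affIso 0 ((a.2 : ℝ) / 2 ^ e - a.1 / 2 ^ e) (a.1 / 2 ^ e) =
        affIso n ((a.2 : ℝ) / 2 ^ e - 2 ^ n * (a.1 / 2 ^ e)) (a.1 / 2 ^ e) := by
      rw [affIso_apply, affIso_apply, zpow_zero]; ring
    have e2 : glue _ _ _ e1 (b.1 / 2 ^ e) = φ (b.1 / 2 ^ e) := by
      rw [glue_apply_of_ge e1 hab', affIso_apply, hφ1 _ le_rfl]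
      field_simp
      linear_combination -hn
    refine ⟨glue _ _ _ e2, glue_mem_levGroup e2 (glue_mem_levGroup e1 (htr a) hα ⟨e, hdy _⟩) hφ
      ⟨e, hdy _⟩, fun t ht => ?_, fun c hc t ht => ?_, fun p q hpq t ht1 ht2 => ?_⟩
    · rw [glue_apply_of_le e2 (ht.trans hab'), glue_apply_of_le e1 ht, affIso_apply]
      simp
    · have hbc : b.1 ≤ c.1 := (codeStep_le (φ := Prod.fst) (l := l) (a := b) (b := c)
        (fun p q hpq => (h p q (codeStep_cons_cons.2 (Or.inr hpq))).1.le) (by simpa using hc)).1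
      have hbc' : (b.1 : ℝ) / 2 ^ e ≤ c.1 / 2 ^ e := by gcongr
      rw [glue_apply_of_ge e2 (hbc'.trans ht), hφ2 c (by simpa using hc) t ht]
    · rcases codeStep_cons_cons.1 hpq with ⟨rfl, rfl⟩ | hpq'
      · rw [glue_apply_of_le e2 ht2, glue_apply_of_ge e1 ht1, affIso_apply, hn]
        field_simp
        ring
      · obtain ⟨c, hc⟩ : ∃ c, (b :: l).getLast? = some c :=
          ⟨(b :: l).getLast (by simp), List.getLast?_eq_some_getLast (by simp)⟩
        have hbp : b.1 ≤ p.1 := ((codeStep_le (φ := Prod.fst) (l := l) (a := b) (b := c)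
          (fun p q hpq => (h p q (codeStep_cons_cons.2 (Or.inr hpq))).1.le) hc).2 p q hpq').1
        have hbp' : (b.1 : ℝ) / 2 ^ e ≤ p.1 / 2 ^ e := by gcongr
        rw [glue_apply_of_ge e2 (hbp'.trans ht1)]
        exact hφ3 p q hpq' t ht1 ht2

theorem ValidCode.exists_represents {c : PLCode} (hc : ValidCode c) :
    ∃ f : ThompsonF, c.Represents f := by
  obtain ⟨e, l⟩ := c
  obtain ⟨hlen, h0, h1, hst⟩ := hc
  simp only at hlen h0 h1 hst
  cases l with
  | nil => simp at hlen
  | cons a l =>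
    obtain rfl : a = (0, 0) := by simpa using h0
    have hlast : ((0, 0) :: l).getLast? = some (2 ^ e, 2 ^ e) := by
      rw [List.getLast?_eq_getElem?, ← h1, List.getD_eq_getElem _ _ (by simp)]
      exact List.getElem?_eq_getElem (by simp)
    have hsteps : ∀ p q, CodeStep ((0, 0) :: l) p q →
        p.1 < q.1 ∧ ∃ n : ℤ, (q.2 : ℝ) - p.2 = 2 ^ n * (q.1 - p.1) := by
      rintro p q ⟨i, hi, hp, hq⟩
      obtain ⟨hlt, m, -, hm⟩ := hst i (by omega)
      rw [hp, hq] at hlt hm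
      refine ⟨hlt, ?_⟩
      rcases hm with hm | hm
      · refine ⟨m, ?_⟩
        rw [hm]
        push_cast [Nat.cast_sub hlt.le]
        rw [zpow_natCast]
        ring
      · have hlt2 : p.2 ≤ q.2 := by
          by_contra! hcon
          rw [Nat.sub_eq_zero_of_le hcon.le] at hm
          omega
        refine ⟨-m, ?_⟩
        rw [hm]
        push_cast [Nat.cast_sub hlt2]
        rw [zpow_neg, zpow_natCast]
        field_simp
        ring
    obtain ⟨φ, hφ, hφ1, hφ2, hφ3⟩ := exists_of_steps e l (0, 0) hsteps
    have hf0 : φ 0 = 0 := by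
      have := hφ1 0 (by simp)
      simpa using this
    have h2e : (2 : ℝ) ^ e ≠ 0 := by positivity
    have hf1 : φ 1 = 1 := by
      have := hφ2 _ hlast 1 (by push_cast; rw [div_self h2e])
      simpa using this
    obtain ⟨f, hf⟩ := exists_thompson hφ hf0 hf1
    refine ⟨f, by simp, hlast, isChain_iff_codeStep.2 fun p q hpq => ⟨(hsteps p q hpq).1, ?_⟩⟩
    intro t ht1 ht2
    simp only at ht1 ht2 ⊢
    rw [hf]
    have h2e' : (0 : ℝ) < 2 ^ e := by positivity
    refine hφ3 p q hpq t ?_ ?_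
    · rw [div_le_iff₀ h2e']; linarith
    · rw [le_div_iff₀ h2e']; linarith

/-! ### Equality of homeomorphisms on a grid -/

/-- Two homeomorphisms of level `N` that agree on `Dy N` are equal. -/
theorem Lev.ext_of_Dy {N : ℕ} {f g : ℝ ≃o ℝ} (hf : Lev N f) (hg : Lev N g)
    (h : ∀ x ∈ Dy N, f x = g x) : f = g := by
  ext t
  obtain ⟨e, he, h1, h2⟩ := exists_Dy_floor N t
  have he' := (Dy N).add_mem he (one_div_mem_Dy N)
  obtain ⟨n, -, hn⟩ := hf.cell he
  obtain ⟨m, -, hm⟩ := hg.cell he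
  have hpos : (0 : ℝ) < 1 / 2 ^ N := by positivity
  have hl : e ∈ Icc e (e + 1 / 2 ^ N) := ⟨le_rfl, by linarith⟩
  have hr : e + 1 / 2 ^ N ∈ Icc e (e + 1 / 2 ^ N) := ⟨by linarith, le_rfl⟩
  have ht : t ∈ Icc e (e + 1 / 2 ^ N) := ⟨h1, h2.le⟩
  have e1 := hn _ hl _ hr
  have e2 := hm _ hl _ hr
  have e3 := hn _ hl _ ht
  have e4 := hm _ hl _ ht
  rw [h _ he, h _ he'] at e1
  rw [h _ he] at e3
  have hnm : (2 : ℝ) ^ n = 2 ^ m := by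
    apply mul_right_cancel₀ hpos.ne'
    linarith
  rw [hnm] at e3
  linarith

/-- The grid point with coordinates `(s / 2 ^ M, t / 2 ^ M)` lies on the polygonal line described
by the code `c`. No subtraction is truncated if `c` represents an element of `F`. -/
def OnGraph (c : PLCode) (M s t : ℕ) : Prop :=
  ∃ i < c.2.length - 1, (c.2.getD i (0, 0)).1 * 2 ^ M ≤ s * 2 ^ c.1 ∧
    s * 2 ^ c.1 ≤ (c.2.getD (i + 1) (0, 0)).1 * 2 ^ M ∧
    t * 2 ^ c.1 * ((c.2.getD (i + 1) (0, 0)).1 - (c.2.getD i (0, 0)).1) =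
      (c.2.getD i (0, 0)).2 * 2 ^ M * ((c.2.getD (i + 1) (0, 0)).1 - (c.2.getD i (0, 0)).1) +
      ((c.2.getD (i + 1) (0, 0)).2 - (c.2.getD i (0, 0)).2) *
        (s * 2 ^ c.1 - (c.2.getD i (0, 0)).1 * 2 ^ M)

theorem PLCode.Represents.onGraph_iff {c : PLCode} {f : ThompsonF} (hc : c.Represents f)
    {M s t : ℕ} (hs : s ≤ 2 ^ M) :
    OnGraph c M s t ↔ extend f (s / 2 ^ M) = t / 2 ^ M := by
  have h2e : (0 : ℝ) < 2 ^ c.1 := by positivity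
  have h2M : (0 : ℝ) < 2 ^ M := by positivity
  -- on the segment from `p` to `q`, the equation with natural numbers is that of the graph
  have key : ∀ p q, CodeStep c.2 p q → p.1 * 2 ^ M ≤ s * 2 ^ c.1 → s * 2 ^ c.1 ≤ q.1 * 2 ^ M →
      (t * 2 ^ c.1 * (q.1 - p.1) =
        p.2 * 2 ^ M * (q.1 - p.1) + (q.2 - p.2) * (s * 2 ^ c.1 - p.1 * 2 ^ M) ↔
      extend f (s / 2 ^ M) = t / 2 ^ M) := by
    intro p q hpq h1 h2
    obtain ⟨hlt, -, hlt2, -, n, -, hsl, hfp, hA⟩ := hc.step hpq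
    have h1' : (p.1 : ℝ) * 2 ^ M ≤ s * 2 ^ c.1 := by exact_mod_cast h1
    have h2' : (s : ℝ) * 2 ^ c.1 ≤ q.1 * 2 ^ M := by exact_mod_cast h2
    have hlt' : (p.1 : ℝ) < q.1 := by exact_mod_cast hlt
    have hx : (s : ℝ) / 2 ^ M ∈ Icc ((p.1 : ℝ) / 2 ^ c.1) (q.1 / 2 ^ c.1) := by
      constructor
      · rwa [div_le_div_iff₀ h2e h2M]
      · rwa [div_le_div_iff₀ h2M h2e]
    have hval := hA _ (left_mem_Icc.2 (by gcongr)) _ hx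
    rw [hfp] at hval
    have hd : (q.1 : ℝ) - p.1 ≠ 0 := (sub_pos.2 hlt').ne'
    rw [← Nat.cast_inj (R := ℝ)]
    push_cast [Nat.cast_sub hlt.le, Nat.cast_sub hlt2.le, Nat.cast_sub h1]
    have hval' : extend f (s / 2 ^ M) * 2 ^ M * 2 ^ c.1 =
        p.2 * 2 ^ M + 2 ^ n * (s * 2 ^ c.1 - p.1 * 2 ^ M) := by
      have : extend f (s / 2 ^ M) = p.2 / 2 ^ c.1 + 2 ^ n * (s / 2 ^ M - p.1 / 2 ^ c.1) := by
        linarith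
      rw [this]
      field_simp
    rw [eq_div_iff h2M.ne', hsl]
    constructor
    · intro h
      apply mul_right_cancel₀ h2e.ne'
      apply mul_right_cancel₀ hd
      linear_combination ((q.1 : ℝ) - p.1) * hval' - h
    · intro h
      rw [h] at hval'
      linear_combination ((q.1 : ℝ) - p.1) * hval'
  constructor
  · rintro ⟨i, hi, h1, h2, h3⟩
    exact (key _ _ ⟨i, by omega, rfl, rfl⟩ h1 h2).1 h3
  · intro h
    obtain ⟨p, q, hpq, h1, h2⟩ : ∃ p q, CodeStep c.2 p q ∧ (p.1 : ℝ) / 2 ^ c.1 ≤ s / 2 ^ M ∧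
        (s : ℝ) / 2 ^ M ≤ q.1 / 2 ^ c.1 := by
      rcases Nat.eq_zero_or_pos s with rfl | hpos
      · have h2e1 : (1 : ℝ) ≤ 2 ^ c.1 := one_le_pow₀ (by norm_num)
        obtain ⟨p, q, hpq, h1, h2⟩ := hc.exists_step (x := 1 / 2 ^ c.1) (by positivity)
          ((div_le_one h2e).2 h2e1)
        rw [div_lt_div_iff_of_pos_right h2e] at h1
        have h3 : p.1 = 0 := by
          have : p.1 < 1 := by exact_mod_cast h1
          omega
        exact ⟨p, q, hpq, by rw [h3]; simp, by simp; positivity⟩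
      · have hpos' : (0 : ℝ) < s := by exact_mod_cast hpos
        have hs' : (s : ℝ) ≤ 2 ^ M := by exact_mod_cast hs
        obtain ⟨p, q, hpq, h1, h2⟩ := hc.exists_step (x := s / 2 ^ M) (by positivity)
          ((div_le_one h2M).2 hs')
        exact ⟨p, q, hpq, h1.le, h2⟩
    rw [div_le_div_iff₀ h2e h2M] at h1
    rw [div_le_div_iff₀ h2M h2e] at h2
    have h1' : p.1 * 2 ^ M ≤ s * 2 ^ c.1 := by exact_mod_cast h1
    have h2' : s * 2 ^ c.1 ≤ q.1 * 2 ^ M := by exact_mod_cast h2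
    obtain ⟨i, hi, rfl, rfl⟩ := hpq
    exact ⟨i, by omega, h1', h2', (key _ _ ⟨i, hi, rfl, rfl⟩ h1' h2').2 h⟩

/-- The grid test for `x * g = g * y`, where `x`, `y`, `g` are given by the codes `cx`, `cy`, `c`.
The factor `8` makes the grid contain the breakpoints of both sides and all points that occur in
their evaluation there. -/
def GridConj (cx cy c : PLCode) : Prop :=
  ∀ s < 2 ^ (8 * (cx.1 + cy.1 + c.1)) + 1, ∀ u < 2 ^ (8 * (cx.1 + cy.1 + c.1)) + 1,
  ∀ v < 2 ^ (8 * (cx.1 + cy.1 + c.1)) + 1, ∀ w < 2 ^ (8 * (cx.1 + cy.1 + c.1)) + 1,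
    OnGraph cy (8 * (cx.1 + cy.1 + c.1)) s u → OnGraph c (8 * (cx.1 + cy.1 + c.1)) s v →
      OnGraph cx (8 * (cx.1 + cy.1 + c.1)) v w → OnGraph c (8 * (cx.1 + cy.1 + c.1)) u w

theorem exists_nat_of_mem_Dy {M : ℕ} {x : ℝ} (hx : x ∈ Dy M) (h0 : 0 ≤ x) (h1 : x ≤ 1) :
    ∃ m : ℕ, m ≤ 2 ^ M ∧ x = m / 2 ^ M := by
  obtain ⟨m, hm⟩ := hx
  have h2M : (0 : ℝ) < 2 ^ M := by positivity
  have hm0 : 0 ≤ m := by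
    have : (0 : ℝ) ≤ m := by rw [← hm]; positivity
    exact_mod_cast this
  lift m to ℕ using hm0
  rw [Int.cast_natCast] at hm
  refine ⟨m, ?_, by rw [← hm]; field_simp⟩
  have : (m : ℝ) ≤ 2 ^ M := by rw [← hm]; nlinarith
  exact_mod_cast this

theorem extend_mem_Icc (f : ThompsonF) {t : ℝ} (ht : t ∈ Icc (0 : ℝ) 1) :
    extend f t ∈ Icc (0 : ℝ) 1 := by
  constructor
  · have := (extend f).le_iff_le.2 ht.1
    rwa [extend_of_notMem f (Or.inl le_rfl)] at this
  · have := (extend f).le_iff_le.2 ht.2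
    rwa [extend_of_notMem f (Or.inr le_rfl)] at this

theorem gridConj_iff {cx cy c : PLCode} {x y g : ThompsonF} (hx : cx.Represents x)
    (hy : cy.Represents y) (hg : c.Represents g) : GridConj cx cy c ↔ x * g = g * y := by
  have hlt : ∀ {n M : ℕ}, n < 2 ^ M + 1 ↔ n ≤ 2 ^ M := Nat.lt_succ_iff
  rw [GridConj]
  set T := cx.1 + cy.1 + c.1 with hT
  have h2M : (0 : ℝ) < 2 ^ (8 * T) := by positivity
  constructor
  · intro h
    apply extend_injective
    rw [extend_mul, extend_mul]
    refine ((hx.lev.mul hg.lev).mono (M := 4 * T) (by omega)).ext_of_Dy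
      ((hg.lev.mul hy.lev).mono (by omega)) fun t ht => ?_
    change extend x (extend g t) = extend g (extend y t)
    by_cases ht01 : t ∈ Icc (0 : ℝ) 1
    · have hy1 := hy.lev.image_mem (K := 4 * T) (by omega) ht
      have hg1 := hg.lev.image_mem (K := 4 * T) (by omega) ht
      have hx1 := hx.lev.image_mem (by omega) hg1
      have mem := extend_mem_Icc
      obtain ⟨s, hs, rfl⟩ := exists_nat_of_mem_Dy (Dy_mono (M := 8 * T) (by omega) ht) ht01.1 ht01.2
      obtain ⟨u, hu, eu⟩ := exists_nat_of_mem_Dy (Dy_mono (M := 8 * T) (by omega) hy1)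
        (mem y ht01).1 (mem y ht01).2
      obtain ⟨v, hv, ev⟩ := exists_nat_of_mem_Dy (Dy_mono (M := 8 * T) (by omega) hg1)
        (mem g ht01).1 (mem g ht01).2
      obtain ⟨w, hw, ew⟩ := exists_nat_of_mem_Dy (Dy_mono (M := 8 * T) (by omega) hx1)
        (mem x (mem g ht01)).1 (mem x (mem g ht01)).2
      have := h s (hlt.2 hs) u (hlt.2 hu) v (hlt.2 hv) w (hlt.2 hw) ((hy.onGraph_iff hs).2 eu)
        ((hg.onGraph_iff hs).2 ev) ((hx.onGraph_iff hv).2 (by rw [← ev, ew]))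
      rw [ew, eu, (hg.onGraph_iff hu).1 this]
    · have ht' : t ≤ 0 ∨ 1 ≤ t := by
        rw [mem_Icc, not_and_or, not_le, not_le] at ht01
        exact ht01.imp le_of_lt le_of_lt
      rw [extend_of_notMem g ht', extend_of_notMem x ht', extend_of_notMem y ht',
        extend_of_notMem g ht']
  · intro h s hs u hu v hv w _ h1 h2 h3
    rw [hlt] at hs hu hv
    rw [hy.onGraph_iff hs] at h1
    rw [hg.onGraph_iff hs] at h2
    rw [hx.onGraph_iff hv] at h3
    rw [hg.onGraph_iff hu, ← h1, ← h3, ← h2]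
    have := DFunLike.congr_fun (congrArg extend h) ((s : ℝ) / 2 ^ (8 * T))
    rw [extend_mul, extend_mul] at this
    exact this.symm

/-! ### Codes of bounded size -/

/-- A bound for the numerical codes of lists of length `n` of pairs of numbers at most `B`. -/
def listBound (B n : ℕ) : ℕ := (fun z => ((B + 1) ^ 2 + z + 1) ^ 2)^[n] 0

theorem encode_list_le {B : ℕ} : ∀ {l : List (ℕ × ℕ)}, (∀ p ∈ l, p.1 ≤ B ∧ p.2 ≤ B) →
    Encodable.encode l ≤ listBound B l.length := by
  intro l
  induction l with
  | nil => intro _; simp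
  | cons a l ih =>
    intro h
    have h1 := ih fun p hp => h p (List.mem_cons_of_mem _ hp)
    obtain ⟨h2, h3⟩ := h a List.mem_cons_self
    rw [Encodable.encode_list_cons, listBound, List.length_cons, Function.iterate_succ_apply',
      ← listBound]
    have h4 : Encodable.encode a < (B + 1) ^ 2 := by
      refine (Nat.pair_lt_max_add_one_sq a.1 a.2).trans_le ?_
      gcongr
      exact max_le h2 h3
    refine (Nat.succ_le_of_lt (Nat.pair_lt_max_add_one_sq _ _)).trans ?_
    gcongr
    exact max_le (by omega) (by omega)

/-- A bound for the numerical code of some code of each element of `F` of level `N`. -/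
def codeBound (N : ℕ) : ℕ := (2 * N + listBound (2 ^ (2 * N)) (2 ^ N + 1) + 1) ^ 2

/-- An element of `F` of level `N` is represented by the list of its values on the grid `Dy N`. -/
theorem exists_code_of_lev {f : ThompsonF} {N : ℕ} (hf : Lev N (extend f)) :
    ∃ c : PLCode, c.Represents f ∧ Encodable.encode c ≤ codeBound N := by
  have h2N : (0 : ℝ) < 2 ^ N := by positivity
  have hex : ∀ i : ℕ, ∃ m : ℕ, i ≤ 2 ^ N →
      m ≤ 2 ^ (2 * N) ∧ extend f (i / 2 ^ N) = m / 2 ^ (2 * N) := by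
    intro i
    by_cases hi : i ≤ 2 ^ N
    · have hi' : (i : ℝ) ≤ 2 ^ N := by exact_mod_cast hi
      have h1 : (i : ℝ) / 2 ^ N ∈ Icc (0 : ℝ) 1 := ⟨by positivity, (div_le_one h2N).2 hi'⟩
      have h2 : (i : ℝ) / 2 ^ N ∈ Dy N := by
        have := div_two_pow_mem_Dy (i : ℤ) N
        rwa [Int.cast_natCast] at this
      obtain ⟨m, hm⟩ := exists_nat_of_mem_Dy (Dy_mono (M := 2 * N) (by omega)
        (hf.image_mem le_rfl h2)) (extend_mem_Icc f h1).1 (extend_mem_Icc f h1).2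
      exact ⟨m, fun _ => hm⟩
    · exact ⟨0, fun h => absurd h hi⟩
  choose m hm using hex
  have hm0 : m 0 = 0 := by
    have := (hm 0 (by positivity)).2
    rw [Nat.cast_zero, zero_div, extend_of_notMem f (Or.inl le_rfl)] at this
    have h3 : (m 0 : ℝ) = 0 := by
      rw [eq_comm, div_eq_zero_iff] at this
      exact this.resolve_right (by positivity)
    exact_mod_cast h3
  have hm1 : m (2 ^ N) = 2 ^ (2 * N) := by
    have := (hm (2 ^ N) le_rfl).2
    push_cast at this
    rw [div_self h2N.ne', extend_of_notMem f (Or.inr le_rfl), eq_comm,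
      div_eq_one_iff_eq (by positivity)] at this
    exact_mod_cast this
  set l : List (ℕ × ℕ) := (List.range (2 ^ N + 1)).map fun i => (i * 2 ^ N, m i) with hl
  have hlen : l.length = 2 ^ N + 1 := by simp [hl]
  refine ⟨(2 * N, l), ⟨?_, ?_, ?_⟩, ?_⟩
  · simp [hl, List.head?_range, hm0]
  · simp only [hl, List.getLast?_map, List.getLast?_range]
    simp [hm1, two_mul, pow_add]
  · refine isChain_iff_codeStep.2 ?_
    rintro p q ⟨i, hi, rfl, rfl⟩
    rw [hlen] at hi
    have hget : ∀ j, j ≤ 2 ^ N → l.getD j (0, 0) = (j * 2 ^ N, m j) := by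
      intro j hj
      rw [List.getD_eq_getElem _ _ (by omega)]
      simp [hl]
    rw [hget i (by omega), hget (i + 1) (by omega)]
    refine ⟨by have : 0 < 2 ^ N := by positivity
               simp only; nlinarith, fun t ht1 ht2 => ?_⟩
    simp only at ht1 ht2 ⊢
    push_cast at ht1 ht2 ⊢
    have he : ((i : ℤ) : ℝ) / 2 ^ N ∈ Dy N := div_two_pow_mem_Dy _ _
    rw [Int.cast_natCast] at he
    obtain ⟨n, -, hn⟩ := hf.cell he
    have hsum : (i : ℝ) / 2 ^ N + 1 / 2 ^ N = ((i + 1 : ℕ) : ℝ) / 2 ^ N := by push_cast; ring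
    rw [hsum] at hn
    have hle : (i : ℝ) / 2 ^ N ≤ ((i + 1 : ℕ) : ℝ) / 2 ^ N := by rw [← hsum]; simp
    have hpow : (2 : ℝ) ^ (2 * N) = 2 ^ N * 2 ^ N := by rw [two_mul, pow_add]
    rw [hpow] at ht1 ht2
    have e1 := hn _ (left_mem_Icc.2 hle) _ (right_mem_Icc.2 hle)
    have e2 := hn _ (left_mem_Icc.2 hle) t ⟨by rw [div_le_iff₀ h2N]; nlinarith,
      by rw [le_div_iff₀ h2N]; push_cast; nlinarith⟩
    rw [(hm i (by omega)).2] at e1 e2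
    rw [(hm (i + 1) (by omega)).2] at e1
    rw [extend_coe] at e2
    push_cast at e1
    have e1' : (m (i + 1) : ℝ) - m i = 2 ^ n * 2 ^ N := by
      rw [hpow] at e1
      field_simp at e1
      linear_combination e1
    have e2' : (2 : ℝ) ^ (2 * N) * (f.1 t : ℝ) - m i = 2 ^ n * (2 ^ (2 * N) * t - i * 2 ^ N) := by
      rw [hpow] at e2 ⊢
      field_simp at e2
      linear_combination e2
    rw [e2', e1']
    ring
  · have h1 : Encodable.encode l ≤ listBound (2 ^ (2 * N)) (2 ^ N + 1) := by
      rw [← hlen]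
      refine encode_list_le fun p hp => ?_
      obtain ⟨i, hi, rfl⟩ := List.mem_map.1 hp
      have hi' : i ≤ 2 ^ N := Nat.lt_succ_iff.1 (List.mem_range.1 hi)
      refine ⟨?_, (hm i hi').1⟩
      rw [two_mul, pow_add]
      exact Nat.mul_le_mul_right _ hi'
    refine (Nat.pair_lt_max_add_one_sq _ _).le.trans ?_
    rw [codeBound]
    gcongr
    exact max_le (by simp) (h1.trans (by omega))

/-! ### Primitive recursive predicates -/

section Primrec

variable {α : Type*} [Primcodable α]

theorem primrec_pow {f g : α → ℕ} (hf : Primrec f) (hg : Primrec g) :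
    Primrec fun a => f a ^ g a :=
  (Primrec₂.unpaired'.1 Nat.Primrec.pow).comp hf hg

theorem primrecPred_forall_lt {R : α → ℕ → Prop} {b : α → ℕ} (hb : Primrec b)
    (hR : PrimrecPred fun p : α × ℕ => R p.1 p.2) : PrimrecPred fun a => ∀ n < b a, R a n := by
  have h : PrimrecRel fun (n : ℕ) (a : α) => R a n :=
    hR.comp (Primrec.pair Primrec.snd Primrec.fst)
  exact (h.forall_mem_list.comp (Primrec.list_range.comp hb) Primrec.id).of_eq fun a => by simp

theorem primrecPred_exists_lt {R : α → ℕ → Prop} {b : α → ℕ} (hb : Primrec b)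
    (hR : PrimrecPred fun p : α × ℕ => R p.1 p.2) : PrimrecPred fun a => ∃ n < b a, R a n := by
  have h : PrimrecRel fun (n : ℕ) (a : α) => R a n :=
    hR.comp (Primrec.pair Primrec.snd Primrec.fst)
  exact (h.exists_mem_list.comp (Primrec.list_range.comp hb) Primrec.id).of_eq fun a => by simp

theorem primrecPred_imp {p q : α → Prop} (hp : PrimrecPred p) (hq : PrimrecPred q) :
    PrimrecPred fun a => p a → q a := by
  classical
  exact (hp.not.or hq).of_eq fun a => by tauto

theorem primrecPred_forall_fin : ∀ {k : ℕ} {R : Fin k → α → Prop}, (∀ i, PrimrecPred (R i)) →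
    PrimrecPred fun a => ∀ i, R i a
  | 0, _, _ => (Primrec.eq.comp (Primrec.const 0) (Primrec.const 0)).of_eq fun a => by simp
  | _ + 1, _, h =>
    ((h 0).and (primrecPred_forall_fin fun i => h i.succ)).of_eq fun a => by
      rw [Fin.forall_fin_succ]

theorem primrec_sum_fin : ∀ {k : ℕ} {f : Fin k → α → ℕ}, (∀ i, Primrec (f i)) →
    Primrec fun a => ∑ i, f i a
  | 0, _, _ => (Primrec.const 0).of_eq fun a => by simp
  | _ + 1, _, h => (Primrec.nat_add.comp (h 0) (primrec_sum_fin fun i => h i.succ)).of_eq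
      fun a => by rw [Fin.sum_univ_succ]

/-- Bounded search for a solution of a primitive recursive condition. -/
theorem exists_primrec_search {β : Type*} [Primcodable β] {V : α → β → Prop}
    (hV : PrimrecPred fun p : α × β => V p.1 p.2) {b : α → ℕ} (hb : Primrec b) :
    ∃ A : α → Option β, Primrec A ∧ (∀ a c, A a = some c → V a c) ∧
      ∀ a c, V a c → Encodable.encode c ≤ b a → (A a).isSome := by
  classical
  let G : α → ℕ → Option β := fun a j =>
    (Encodable.decode (α := β) j).bind fun c => if V a c then some c else none
  have hG : Primrec₂ G := by
    refine Primrec.option_bind (Primrec.decode.comp Primrec.snd) ?_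
    exact Primrec.ite (hV.comp (Primrec.pair (Primrec.fst.comp Primrec.fst) Primrec.snd))
      (Primrec.option_some.comp Primrec.snd) (Primrec.const none)
  refine ⟨fun a => ((List.range (b a + 1)).filterMap (G a)).head?,
    Primrec.list_head?.comp (Primrec.listFilterMap
      (Primrec.list_range.comp (Primrec.succ.comp hb)) hG), fun a c h => ?_, fun a c h hle => ?_⟩
  · obtain ⟨j, -, hj⟩ := List.mem_filterMap.1 (List.mem_of_head? h)
    obtain ⟨c', -, hc'⟩ := Option.bind_eq_some_iff.1 hj
    split_ifs at hc' with hv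
    · simp only [Option.some.injEq] at hc'
      rwa [← hc']
  · have hmem : c ∈ (List.range (b a + 1)).filterMap (G a) := by
      refine List.mem_filterMap.2 ⟨Encodable.encode c, List.mem_range.2 (by omega), ?_⟩
      simp [G, h]
    rw [List.isSome_head?]
    simpa using List.ne_nil_of_mem hmem

end Primrec

/-! ### The bounds and the test are primitive recursive -/

section Primrec

variable {α : Type*} [Primcodable α]

theorem primrec_conjBound : Primrec conjBound := by
  have add := fun {f g : ℕ → ℕ} (hf : Primrec f) (hg : Primrec g) => Primrec.nat_add.comp hf hg
  have mul := fun {f g : ℕ → ℕ} (hf : Primrec f) (hg : Primrec g) => Primrec.nat_mul.comp hf hg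
  have pow2 := fun {f : ℕ → ℕ} (hf : Primrec f) => primrec_pow (Primrec.const 2) hf
  have cst := fun n : ℕ => Primrec.const (α := ℕ) n
  have hid : Primrec fun E : ℕ => E := Primrec.id
  have hcomp : Primrec₂ compBound := by
    have h1 : Primrec fun p : ℕ × ℕ => p.1 := Primrec.fst
    have h2 : Primrec fun p : ℕ × ℕ => p.2 := Primrec.snd
    have c := fun n : ℕ => Primrec.const (α := ℕ × ℕ) n
    have hE := Primrec.nat_mul.comp (c 2) h1
    have hexp := Primrec.nat_add.comp (Primrec.nat_add.comp (Primrec.nat_add.comp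
      (Primrec.nat_add.comp (Primrec.nat_mul.comp (c 4) h1) (c 1)) h2) h1) (c 1)
    exact Primrec.nat_add.comp (Primrec.nat_add.comp h2 hE)
      (Primrec.nat_mul.comp hE (primrec_pow (c 2) hexp))
  have hrigid : Primrec rigidBound := mul hid (pow2 (add (mul (cst 41) hid) (cst 2)))
  have hstd : Primrec stdBound :=
    add (mul (cst 21) (mul (mul (cst 3) (pow2 hid)) (add hid (cst 1)))) (mul (cst 28) hid)
  have hblock : Primrec fun E => blockBound E (rigidBound E + E) :=
    Primrec.nat_iterate (pow2 (mul (cst 4) hid)) (add hrigid hid) hcomp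
  have hfine : Primrec fineBound :=
    add (add hblock (hstd.comp (mul (cst 2) hid))) (mul (cst 2) hid)
  have hlev : Primrec levBound :=
    add hid (mul (mul (cst 2) (add (pow2 hid) (cst 1))) hid)
  exact hlev.comp hfine

theorem primrec_codeBound : Primrec codeBound := by
  have hid : Primrec fun N : ℕ => N := Primrec.id
  have cst := fun n : ℕ => Primrec.const (α := ℕ) n
  have h2N := Primrec.nat_mul.comp (cst 2) hid
  have hstep : Primrec₂ fun B z : ℕ => ((B + 1) ^ 2 + z + 1) ^ 2 := by
    have c := fun n : ℕ => Primrec.const (α := ℕ × ℕ) n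
    exact primrec_pow (Primrec.nat_add.comp (Primrec.nat_add.comp (primrec_pow
      (Primrec.nat_add.comp Primrec.fst (c 1)) (c 2)) Primrec.snd) (c 1)) (c 2)
  have hlist : Primrec fun N => listBound (2 ^ (2 * N)) (2 ^ N + 1) :=
    Primrec.nat_iterate (Primrec.nat_add.comp (primrec_pow (cst 2) hid) (cst 1)) (cst 0)
      (hstep.comp₂ ((primrec_pow (cst 2) h2N).comp₂ Primrec₂.left) Primrec₂.right)
  exact primrec_pow (Primrec.nat_add.comp (Primrec.nat_add.comp h2N hlist) (cst 1)) (cst 2)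

theorem primrec_entry {c : α → PLCode} {i : α → ℕ} (hc : Primrec c) (hi : Primrec i) :
    Primrec fun a => (c a).2.getD (i a) (0, 0) :=
  (Primrec.list_getD (0, 0)).comp (Primrec.snd.comp hc) hi

theorem primrec_pred_length {c : α → PLCode} (hc : Primrec c) :
    Primrec fun a => (c a).2.length - 1 :=
  Primrec.nat_sub.comp (Primrec.list_length.comp (Primrec.snd.comp hc)) (Primrec.const 1)

theorem primrecPred_onGraph {c : α → PLCode} {M s t : α → ℕ} (hc : Primrec c) (hM : Primrec M)
    (hs : Primrec s) (ht : Primrec t) : PrimrecPred fun a => OnGraph (c a) (M a) (s a) (t a) := by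
  have add := fun {f g : α × ℕ → ℕ} (hf : Primrec f) (hg : Primrec g) => Primrec.nat_add.comp hf hg
  have sub := fun {f g : α × ℕ → ℕ} (hf : Primrec f) (hg : Primrec g) => Primrec.nat_sub.comp hf hg
  have mul := fun {f g : α × ℕ → ℕ} (hf : Primrec f) (hg : Primrec g) => Primrec.nat_mul.comp hf hg
  have hc' := hc.comp (Primrec.fst (α := α) (β := ℕ))
  have hp := primrec_entry hc' Primrec.snd
  have hq := primrec_entry hc' (Primrec.succ.comp Primrec.snd)
  have hp1 := Primrec.fst.comp hp
  have hp2 := Primrec.snd.comp hp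
  have hq1 := Primrec.fst.comp hq
  have hq2 := Primrec.snd.comp hq
  have h2M := primrec_pow (Primrec.const 2) (hM.comp (Primrec.fst (α := α) (β := ℕ)))
  have h2e := primrec_pow (Primrec.const 2) (Primrec.fst.comp hc')
  have hs' := hs.comp (Primrec.fst (α := α) (β := ℕ))
  have ht' := ht.comp (Primrec.fst (α := α) (β := ℕ))
  have hse := mul hs' h2e
  exact primrecPred_exists_lt (primrec_pred_length hc)
    ((Primrec.nat_le.comp (mul hp1 h2M) hse).and ((Primrec.nat_le.comp hse (mul hq1 h2M)).and
      (Primrec.eq.comp (mul (mul ht' h2e) (sub hq1 hp1))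
        (add (mul (mul hp2 h2M) (sub hq1 hp1)) (mul (sub hq2 hp2) (sub hse (mul hp1 h2M)))))))

theorem primrecPred_validCode : PrimrecPred ValidCode := by
  have hc : Primrec fun c : PLCode => c := Primrec.id
  have hlen := primrec_pred_length hc
  have h2e := primrec_pow (Primrec.const 2) (Primrec.fst.comp hc)
  have hc1 : Primrec fun a : PLCode × ℕ => a.1 := Primrec.fst
  have hc2 := hc1.comp (Primrec.fst (α := PLCode × ℕ) (β := ℕ))
  have hi : Primrec fun a : (PLCode × ℕ) × ℕ => a.1.2 := Primrec.snd.comp Primrec.fst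
  have hp := primrec_entry hc2 hi
  have hq := primrec_entry hc2 (Primrec.succ.comp hi)
  have hp1 := Primrec.fst.comp hp
  have hp2 := Primrec.snd.comp hp
  have hq1 := Primrec.fst.comp hq
  have hq2 := Primrec.snd.comp hq
  have h2a := primrec_pow (Primrec.const 2) (Primrec.snd (α := PLCode × ℕ) (β := ℕ))
  refine (Primrec.nat_lt.comp (Primrec.const 0)
    (Primrec.list_length.comp (Primrec.snd.comp hc))).and
    ((Primrec.eq.comp (primrec_entry hc (Primrec.const 0)) (Primrec.const (0, 0))).and
    ((Primrec.eq.comp (primrec_entry hc hlen) (Primrec.pair h2e h2e)).and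
    (primrecPred_forall_lt hlen ((Primrec.nat_lt.comp
      (Primrec.fst.comp (primrec_entry hc1 Primrec.snd))
      (Primrec.fst.comp (primrec_entry hc1 (Primrec.succ.comp Primrec.snd)))).and
    (primrecPred_exists_lt (Primrec.succ.comp (Primrec.fst.comp hc1))
      ((Primrec.eq.comp hq2
        (Primrec.nat_add.comp hp2 (Primrec.nat_mul.comp (Primrec.nat_sub.comp hq1 hp1) h2a))).or
      (Primrec.eq.comp hq1
        (Primrec.nat_add.comp hp1
          (Primrec.nat_mul.comp (Primrec.nat_sub.comp hq2 hp2) h2a)))))))))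

theorem primrecPred_gridConj {cx cy c : α → PLCode} (hx : Primrec cx) (hy : Primrec cy)
    (hc : Primrec c) : PrimrecPred fun a => GridConj (cx a) (cy a) (c a) := by
  have hM : Primrec fun a => 8 * ((cx a).1 + (cy a).1 + (c a).1) :=
    Primrec.nat_mul.comp (Primrec.const 8) (Primrec.nat_add.comp (Primrec.nat_add.comp
      (Primrec.fst.comp hx) (Primrec.fst.comp hy)) (Primrec.fst.comp hc))
  have hb : Primrec fun a => 2 ^ (8 * ((cx a).1 + (cy a).1 + (c a).1)) + 1 :=
    Primrec.succ.comp (primrec_pow (Primrec.const 2) hM)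
  have p1 : Primrec fun a : (((α × ℕ) × ℕ) × ℕ) × ℕ => a.1.1.1.1 :=
    Primrec.fst.comp (Primrec.fst.comp (Primrec.fst.comp Primrec.fst))
  have ps : Primrec fun a : (((α × ℕ) × ℕ) × ℕ) × ℕ => a.1.1.1.2 :=
    Primrec.snd.comp (Primrec.fst.comp (Primrec.fst.comp Primrec.fst))
  have pu : Primrec fun a : (((α × ℕ) × ℕ) × ℕ) × ℕ => a.1.1.2 :=
    Primrec.snd.comp (Primrec.fst.comp Primrec.fst)
  have pv : Primrec fun a : (((α × ℕ) × ℕ) × ℕ) × ℕ => a.1.2 := Primrec.snd.comp Primrec.fst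
  have pw : Primrec fun a : (((α × ℕ) × ℕ) × ℕ) × ℕ => a.2 := Primrec.snd
  have hM' := hM.comp p1
  refine primrecPred_forall_lt hb (primrecPred_forall_lt (hb.comp Primrec.fst)
    (primrecPred_forall_lt (hb.comp (Primrec.fst.comp Primrec.fst))
    (primrecPred_forall_lt (hb.comp (Primrec.fst.comp (Primrec.fst.comp Primrec.fst))) ?_)))
  exact primrecPred_imp (primrecPred_onGraph (hy.comp p1) hM' ps pu)
    (primrecPred_imp (primrecPred_onGraph (hc.comp p1) hM' ps pv)
      (primrecPred_imp (primrecPred_onGraph (hx.comp p1) hM' pv pw)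
        (primrecPred_onGraph (hc.comp p1) hM' pu pw)))

end Primrec

/-! ### Bounded conjugators and the algorithm -/

/-- If two tuples of elements of `F` are conjugate, then some conjugator has a code whose size is
bounded in terms of the levels of the given elements. -/
theorem exists_bounded_conjugator {k : ℕ} {x y : Fin k → ThompsonF} {N : ℕ}
    (hx : ∀ i, Lev N (extend (x i))) (hy : ∀ i, Lev N (extend (y i))) {g : ThompsonF}
    (hgN : extend g ∈ levGroup) (hg : ∀ i, x i * g = g * y i) :
    ∃ (f : ThompsonF) (c : PLCode), c.Represents f ∧ (∀ i, x i * f = f * y i) ∧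
      Encodable.encode c ≤ codeBound (conjBound (2 * N)) := by
  -- the pairs `(xᵢ, yᵢ)` and their inverses
  set P : Set ((ℝ ≃o ℝ) × (ℝ ≃o ℝ)) := {q | ∃ i, q = (extend (x i), extend (y i)) ∨
    q = ((extend (x i))⁻¹, (extend (y i))⁻¹)} with hP
  have hconj : ∀ i, extend (x i) * extend g = extend g * extend (y i) := fun i => by
    rw [← extend_mul, ← extend_mul, hg i]
  have hfix : ∀ (f : ThompsonF) {t : ℝ}, t ≤ 0 ∨ 1 ≤ t → (extend f)⁻¹ t = t := fun f t ht =>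
    (extend f).injective (by
      rw [extend_of_notMem f ht]; exact (extend f).apply_symm_apply t)
  have hdata : ConjData (2 * N) P (extend g) := by
    refine ⟨?_, ?_, ?_, ?_, hgN⟩
    · rintro q ⟨i, rfl | rfl⟩
      · exact (hx i).mono (by omega)
      · exact (hx i).inv
    · rintro q ⟨i, rfl | rfl⟩
      · exact (hy i).mono (by omega)
      · exact (hy i).inv
    · rintro q ⟨i, rfl | rfl⟩
      · exact ⟨i, Or.inr rfl⟩
      · exact ⟨i, Or.inl (by simp)⟩
    · rintro q ⟨i, rfl | rfl⟩ t
      · exact DFunLike.congr_fun (hconj i) t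
      · refine DFunLike.congr_fun (f := (extend (x i))⁻¹ * extend g)
          (g := extend g * (extend (y i))⁻¹) ?_ t
        rw [inv_mul_eq_iff_eq_mul, ← mul_assoc, hconj, mul_inv_cancel_right]
  have hP' : ∀ {t : ℝ}, t ≤ 0 ∨ 1 ≤ t → ∀ q ∈ P, q.2 t = t := by
    rintro t ht q ⟨i, rfl | rfl⟩
    · exact extend_of_notMem _ ht
    · exact hfix _ ht
  obtain ⟨φ, hφ, hφ1, hφ2⟩ := hdata.exists_lev (hP' (Or.inl le_rfl)) (hP' (Or.inr le_rfl))
    fun t ht => extend_of_notMem g ht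
  obtain ⟨f, hf⟩ := exists_thompson ⟨_, hφ⟩ (hφ1 0 (Or.inl le_rfl)) (hφ1 1 (Or.inr le_rfl))
  have hfφ : extend f = φ := by
    ext t
    by_cases ht : t ∈ Icc (0 : ℝ) 1
    · exact (extend_coe f ⟨t, ht⟩).trans (hf ⟨t, ht⟩)
    · have ht' : t ≤ 0 ∨ 1 ≤ t := by
        rw [mem_Icc, not_and_or, not_le, not_le] at ht
        exact ht.imp le_of_lt le_of_lt
      rw [extend_of_notMem f ht', hφ1 t ht']
  obtain ⟨c, hc, hcb⟩ := exists_code_of_lev (hfφ ▸ hφ : Lev (conjBound (2 * N)) (extend f))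
  refine ⟨f, c, hc, fun i => extend_injective ?_, hcb⟩
  rw [extend_mul, extend_mul, hfφ]
  ext t
  exact hφ2 _ ⟨i, Or.inl rfl⟩ t

theorem theorem1p1 (k : ℕ) :
    ∃ A : (Fin k → PLCode) × (Fin k → PLCode) → Option PLCode,
      Computable A ∧
      ∀ (x y : Fin k → ThompsonF) (cx cy : Fin k → PLCode),
        (∀ i, (cx i).Represents (x i)) → (∀ i, (cy i).Represents (y i)) →
          ((A (cx, cy)).isSome ↔ ∃ g : ThompsonF, ∀ i, g⁻¹ * x i * g = y i) ∧
          ∀ c : PLCode, A (cx, cy) = some c →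
            ∃ g : ThompsonF, c.Represents g ∧ ∀ i, g⁻¹ * x i * g = y i := by
  have app : ∀ i : Fin k, Primrec fun s : Fin k → PLCode => s i := fun i =>
    Primrec.fin_app.comp Primrec.id (Primrec.const i)
  have hx : ∀ i : Fin k, Primrec fun a : (Fin k → PLCode) × (Fin k → PLCode) => a.1 i :=
    fun i => (app i).comp Primrec.fst
  have hy : ∀ i : Fin k, Primrec fun a : (Fin k → PLCode) × (Fin k → PLCode) => a.2 i :=
    fun i => (app i).comp Primrec.snd
  obtain ⟨A, hA, hA1, hA2⟩ := exists_primrec_search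
    (V := fun (a : (Fin k → PLCode) × (Fin k → PLCode)) (c : PLCode) =>
      ValidCode c ∧ ∀ i, GridConj (a.1 i) (a.2 i) c)
    (b := fun a => codeBound (conjBound (2 * ∑ i, ((a.1 i).1 + (a.2 i).1))))
    ((primrecPred_validCode.comp Primrec.snd).and (primrecPred_forall_fin fun i =>
      primrecPred_gridConj ((hx i).comp Primrec.fst) ((hy i).comp Primrec.fst) Primrec.snd))
    (primrec_codeBound.comp (primrec_conjBound.comp (Primrec.nat_mul.comp (Primrec.const 2)
      (primrec_sum_fin fun i => Primrec.nat_add.comp (Primrec.fst.comp (hx i))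
        (Primrec.fst.comp (hy i))))))
  have hiff : ∀ {g x y : ThompsonF}, g⁻¹ * x * g = y ↔ x * g = g * y := fun {g x y} => by
    rw [mul_assoc, inv_mul_eq_iff_eq_mul]
  refine ⟨A, hA.to_comp, fun x y cx cy hcx hcy => ?_⟩
  simp only [hiff]
  have sound : ∀ c : PLCode, A (cx, cy) = some c →
      ∃ g : ThompsonF, c.Represents g ∧ ∀ i, x i * g = g * y i := by
    intro c hc
    obtain ⟨hv, hgrid⟩ := hA1 _ _ hc
    obtain ⟨g, hg⟩ := hv.exists_represents
    exact ⟨g, hg, fun i => (gridConj_iff (hcx i) (hcy i) hg).1 (hgrid i)⟩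
  refine ⟨⟨fun h => ?_, fun ⟨g, hg⟩ => ?_⟩, sound⟩
  · obtain ⟨c, hc⟩ := Option.isSome_iff_exists.1 h
    obtain ⟨g, -, hg⟩ := sound c hc
    exact ⟨g, hg⟩
  · obtain ⟨d, hd⟩ := PLCode.exists_represents g
    have hle : ∀ i, (cx i).1 + (cy i).1 ≤ ∑ i, ((cx i).1 + (cy i).1) := fun i =>
      Finset.single_le_sum (f := fun i => (cx i).1 + (cy i).1) (fun _ _ => Nat.zero_le _)
        (Finset.mem_univ i)
    obtain ⟨f, c, hc, hf, hcb⟩ := exists_bounded_conjugator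
      (N := ∑ i, ((cx i).1 + (cy i).1))
      (fun i => (hcx i).lev.mono (by have := hle i; omega))
      (fun i => (hcy i).lev.mono (by have := hle i; omega)) ⟨_, hd.lev⟩ hg
    exact hA2 (cx, cy) c ⟨hc.validCode, fun i => (gridConj_iff (hcx i) (hcy i) hc).2 (hf i)⟩ hcb
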